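/- Theorem (parabolic interpolation inequality). Let $N\ge 2$, let $\Omega\subset\mathbb R^N$ be a bounded domain with $\partial\Omega\in C^2$, let $T>0$, $Q_T=\Omega\times(0,T]$, and write $z=(x,t)$. Put $r^\sharp=\frac{4}{N+2}$. Let $p,q,a,b:\overline Q_T\to\mathbb R$ satisfy, with constants $p^\pm,q^\pm,a^+,b^+,\alpha,L_{p,q},L_{a,b}$, $$\tfrac{2N}{N+2}<p^-\le p(z)\le p^+,\qquad \tfrac{2N}{N+2}<q^-\le q(z)\le q^+,\qquad |p(z)-q(z)|<\tfrac{2}{N+2}\qquad\text{for all } z\in\overline Q_T,$$ $$0\le a(z)\le a^+,\qquad 0\le b(z)\le b^+,\qquad a(z)+b(z)\ge\alpha>0\qquad\text{for all } z\in\overline Q_T,$$ where $p,q$ are Lipschitz continuous on $\overline Q_T$ with constant $L_{p,q}$ and $a,b$ are Lipschitz continuous on $\overline Q_T$ with constant $L_{a,b}$. Let $\underline s(z)=\min\{p(z),q(z)\}$, $r_1=\underline s+r^\sharp-p$, $r_2=\underline s+r^\sharp-q$. For $\epsilon\in(0,1)$, $\xi\in\mathbb R^N$ and functions $s_1,s_2$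 of $z$ put $$\mathcal F_\epsilon^{(s_1,s_2)}(z,\xi)=a(z)\,(\epsilon^2+|\xi|^2)^{\frac{p(z)+s_1(z)-2}{2}}+b(z)\,(\epsilon^2+|\xi|^2)^{\frac{q(z)+s_2(z)-2}{2}}.$$ Let $u\in C^0([0,T];C^1(\overline\Omega)\cap H^2(\Omega)\cap H^1_0(\Omega))$ (this includes all $u\in C^0([0,T];C^1(\overline\Omega)\cap H^2_0(\Omega))$), let $|u_{xx}|^2=\sum_{i,j=1}^N|D^2_{x_ix_j}u|^2$ with the weak spatial derivatives, and assume that $$\int_{Q_T}\mathcal F_\epsilon^{(0,0)}(z,\nabla u)|u_{xx}|^2\,dz<\infty,\qquad \sup_{t\in(0,T)}\|u(t)\|_{L^2(\Omega)}^2=M_0 .$$ Then for every $\varsigma\in(0,r^\sharp)$ and every $\beta\in(0,1)$ the integrals on the left-hand sides below are finite, and $$\int_{Q_T}\mathcal F_\epsilon^{(r_1-\varsigma,\,r_2-\varsigma)}(z,\nabla u)|\nabla u|^2\,dz\le\beta\int_{Q_T}\mathcal F_\epsilon^{(0,0)}(z,\nabla u)|u_{xx}|^2\,dz+C,$$ $$\alpha\int_{Q_T}|\nabla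 u|^{\underline s(z)+r^\sharp-\varsigma}\,dz\le\beta\int_{Q_T}\mathcal F_\epsilon^{(0,0)}(z,\nabla u)|u_{xx}|^2\,dz+C,$$ where the constant $C$ depends only on $N,\Omega,T,p^\pm,q^\pm,L_{p,q},L_{a,b},a^+,b^+,\alpha,M_0,\varsigma,\beta$; in particular it does not depend on $\epsilon$ and, apart from $M_0$, not on $u$. -/

import Mathlib

open MeasureTheory Set Filter Topology
open scoped ENNReal ContDiff

namespace ParabolicInterp

noncomputable section

/-- The Euclidean space `ℝ^N`. -/
abbrev E (N : ℕ) : Type := EuclideanSpace ℝ (Fin N)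

/-- The classical partial derivative in the direction of the `i`-th coordinate vector. -/
def pd {N : ℕ} (i : Fin N) (f : E N → ℝ) : E N → ℝ :=
  fun x => fderiv ℝ f x (EuclideanSpace.single i 1)

/-- The boundary of `Ω` is of class `C²`: near each boundary point, after a choice of the
vertical direction `n`, the set `Ω` is the region strictly above the graph of a `C²` function of
the remaining variables (of the component of `x` orthogonal to `n`). -/
def HasC2Boundary {N : ℕ} (Ω : Set (E N)) : Prop :=
  ∀ x₀ ∈ frontier Ω, ∃ r > 0, ∃ n : E N, ‖n‖ = 1 ∧ ∃ γ : E N → ℝ, ContDiff ℝ 2 γ ∧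
    ∀ x ∈ Metric.ball x₀ r, (x ∈ Ω ↔ γ (x - inner ℝ n x • n) < inner ℝ n x)

/-- Bounded domain (open connected nonempty set) with boundary of class `C²`. -/
structure IsC2Domain {N : ℕ} (Ω : Set (E N)) : Prop where
  isOpen : IsOpen Ω
  isConnected : IsConnected Ω
  isBounded : Bornology.IsBounded Ω
  boundary : HasC2Boundary Ω

/-- `φ ∈ C_c^∞(Ω)`. -/
structure IsTest {N : ℕ} (Ω : Set (E N)) (φ : E N → ℝ) : Prop where
  smooth : ContDiff ℝ ∞ φ
  compact : HasCompactSupport φ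
  subset : tsupport φ ⊆ Ω

/-- `f ∈ L²(Ω)`. -/
def MemL2 {N : ℕ} (Ω : Set (E N)) (f : E N → ℝ) : Prop :=
  MemLp f 2 (volume.restrict Ω)

/-- `g` is the weak partial derivative `D_{x_i} f` in `Ω` (used for `f, g ∈ L²(Ω)`). -/
def IsWeakD1 {N : ℕ} (Ω : Set (E N)) (i : Fin N) (f g : E N → ℝ) : Prop :=
  ∀ φ : E N → ℝ, IsTest Ω φ → ∫ x in Ω, f x * pd i φ x = -∫ x in Ω, g x * φ x

/-- `h` is the weak second derivative `D²_{x_i x_j} f` in `Ω` (used for `f, h ∈ L²(Ω)`). -/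
def IsWeakD2 {N : ℕ} (Ω : Set (E N)) (i j : Fin N) (f h : E N → ℝ) : Prop :=
  ∀ φ : E N → ℝ, IsTest Ω φ → ∫ x in Ω, f x * pd i (pd j φ) x = ∫ x in Ω, h x * φ x

/-- `H` is the matrix of weak second derivatives of `f` in `Ω`, with entries in `L²(Ω)`. -/
def IsWeakHessian {N : ℕ} (Ω : Set (E N)) (f : E N → ℝ) (H : Fin N → Fin N → E N → ℝ) : Prop :=
  ∀ i j, MemL2 Ω (H i j) ∧ IsWeakD2 Ω i j f (H i j)

/-- `f ∈ H²(Ω)`: `f` and its weak derivatives of order one and two are in `L²(Ω)`. -/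
def MemH2 {N : ℕ} (Ω : Set (E N)) (f : E N → ℝ) : Prop :=
  MemL2 Ω f ∧ (∀ i, ∃ g, MemL2 Ω g ∧ IsWeakD1 Ω i f g) ∧ ∃ H, IsWeakHessian Ω f H

/-- `f ∈ H¹₀(Ω)`: `f` belongs to the closure of `C_c^∞(Ω)` in the norm of `H¹(Ω)`. -/
def MemH10 {N : ℕ} (Ω : Set (E N)) (f : E N → ℝ) : Prop :=
  MemL2 Ω f ∧ ∃ (G : Fin N → E N → ℝ) (φ : ℕ → E N → ℝ),
    (∀ i, MemL2 Ω (G i)) ∧ (∀ n, IsTest Ω (φ n)) ∧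
    Tendsto (fun n => eLpNorm (fun x => φ n x - f x) 2 (volume.restrict Ω)) atTop (𝓝 0) ∧
    ∀ i, Tendsto (fun n => eLpNorm (fun x => pd i (φ n) x - G i x) 2 (volume.restrict Ω))
      atTop (𝓝 0)

/-- `f ∈ C¹(closure Ω)`: `f` is `C¹` in `Ω`, and `f`, `∇f` extend continuously to the closure. -/
structure MemC1 {N : ℕ} (Ω : Set (E N)) (f : E N → ℝ) : Prop where
  contDiffOn : ContDiffOn ℝ 1 f Ω
  continuousOn : ContinuousOn f (closure Ω)
  gradient_ext : ∃ G : E N → E N, ContinuousOn G (closure Ω) ∧ ∀ x ∈ Ω, G x = gradient f x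

/-- `f ∈ C¹(closure Ω) ∩ H²(Ω) ∩ H¹₀(Ω)`. -/
structure MemX {N : ℕ} (Ω : Set (E N)) (f : E N → ℝ) : Prop where
  memC1 : MemC1 Ω f
  memH2 : MemH2 Ω f
  memH10 : MemH10 Ω f

/-- `u ∈ C⁰([0,T]; C¹(closure Ω) ∩ H²(Ω) ∩ H¹₀(Ω))`: every `u t` is in the space, and `t ↦ u t` is
continuous in the `C¹(closure Ω)` norm and in the `H²(Ω)` norm. As `Ω` is bounded, the `C¹` norm
controls the `L²` norms of the function and of its gradient, so that only the second derivatives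
remain to be listed for the `H²` norm. -/
structure MemCX {N : ℕ} (Ω : Set (E N)) (T : ℝ) (u : ℝ → E N → ℝ) : Prop where
  mem : ∀ t ∈ Icc 0 T, MemX Ω (u t)
  continuous_C1 : ∀ t₀ ∈ Icc 0 T, ∀ η > 0, ∀ᶠ t in 𝓝[Icc 0 T] t₀, ∀ x ∈ Ω,
    |u t x - u t₀ x| ≤ η ∧ ‖gradient (u t) x - gradient (u t₀) x‖ ≤ η
  continuous_H2 : ∀ t₀ ∈ Icc 0 T, ∀ η > 0, ∀ᶠ t in 𝓝[Icc 0 T] t₀,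
    ∃ H, IsWeakHessian Ω (fun x => u t x - u t₀ x) H ∧ ∫ x in Ω, ∑ i, ∑ j, H i j x ^ 2 ≤ η

/-- The cylinder `Q_T = Ω × (0,T]`. -/
def cyl {N : ℕ} (Ω : Set (E N)) (T : ℝ) : Set (E N × ℝ) := Ω ×ˢ Ioc 0 T

/-- `W i j x t` is (a representative, measurable in `z = (x,t)`, of) the weak spatial derivative
`D²_{x_i x_j} u (x,t)` in `Q_T`. -/
structure IsSpatialHessian {N : ℕ} (Ω : Set (E N)) (T : ℝ) (u : ℝ → E N → ℝ)
    (W : Fin N → Fin N → E N → ℝ → ℝ) : Prop where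
  measurable : ∀ i j,
    AEStronglyMeasurable (fun z : E N × ℝ => W i j z.1 z.2) (volume.restrict (cyl Ω T))
  hessian : ∀ᵐ t ∂(volume.restrict (Ioc 0 T)), IsWeakHessian Ω (u t) (fun i j x => W i j x t)

/-- `|u_xx|² = ∑_{i,j} |D²_{x_i x_j} u|²` at the point `(x,t)`. -/
def hessSq {N : ℕ} (W : Fin N → Fin N → E N → ℝ → ℝ) (x : E N) (t : ℝ) : ℝ :=
  ∑ i, ∑ j, W i j x t ^ 2

/-- `f ∈ C^{0,1}` on the closed cylinder `closure Ω × [0,T]` with Lipschitz constant `L`, with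
respect to the Euclidean distance of `ℝ^{N+1}`. -/
def LipschitzCyl {N : ℕ} (Ω : Set (E N)) (T L : ℝ) (f : E N → ℝ → ℝ) : Prop :=
  ∀ x ∈ closure Ω, ∀ y ∈ closure Ω, ∀ t ∈ Icc 0 T, ∀ s ∈ Icc 0 T,
    |f x t - f y s| ≤ L * √(‖x - y‖ ^ 2 + (t - s) ^ 2)

/-- The regularized flux `F_ε^{(s₁,s₂)}(z,ξ) = a(z) (ε²+|ξ|²)^{(p(z)+s₁(z)-2)/2}
+ b(z) (ε²+|ξ|²)^{(q(z)+s₂(z)-2)/2}`, `z = (x,t)`. -/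
def flux {N : ℕ} (ε : ℝ) (a b p q s₁ s₂ : E N → ℝ → ℝ) (x : E N) (t : ℝ) (ξ : E N) : ℝ :=
  a x t * (ε ^ 2 + ‖ξ‖ ^ 2) ^ ((p x t + s₁ x t - 2) / 2) +
    b x t * (ε ^ 2 + ‖ξ‖ ^ 2) ^ ((q x t + s₂ x t - 2) / 2)

/-- `s(z) = min {p(z), q(z)}`. -/
def sMin {N : ℕ} (p q : E N → ℝ → ℝ) (x : E N) (t : ℝ) : ℝ := min (p x t) (q x t)

/-- The threshold number `r^♯ = 4/(N+2)`. -/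
def rSharp (N : ℕ) : ℝ := 4 / ((N : ℝ) + 2)

/-- `r₁(z) = s(z) + r^♯ - p(z)`; with `p` and `q` exchanged this is `r₂`. -/
def rExp {N : ℕ} (p q : E N → ℝ → ℝ) (x : E N) (t : ℝ) : ℝ :=
  sMin p q x t + rSharp N - p x t

end

end ParabolicInterp

open ParabolicInterp

/-!
The estimate holds on every time slice with a constant that does not depend on the slice, and
Tonelli's theorem then gives it on the cylinder.

On a slice write `X = (1 + f²)^{1/2}` and `Y = (1 + |∇f|²)^{1/2}` (`bracket`), let `s` be a smooth
exponent slightly below `min p q` (a mollification of a Lipschitz extension,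
`exists_contDiff_approx`), and put `m = s + r` with `r` slightly below `4 / (N + 2)`. Since
`s + r ≥ min p q + 4 / (N + 2) - ς`, it is enough to bound `∫ Y^m`. The variable exponents are
differentiated directly, which costs only logarithms of `X` and `Y`; no localization is needed.

* Testing with the field `η(|∇f|² - 1) Y^{m-2} ∇f`, `η` a smooth transition, and integrating by
  parts bounds `∫ Y^m` by `∫ |f| (Y^{m-2} |D²f| + Y^{m-1} log Y)`, where the second derivatives
  enter only where `|∇f| > 1` (`exists_energy_estimate`). There is no boundary term, because `f`
  is a limit of uniformly bounded test functions (`MemX.exists_test_approx`); regularity of the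
  boundary plays no role. The weak chain rule that is needed for the field is
  `weak_chain_rule`.
* By Young's inequality the first term is absorbed in `∫_{|∇f|>1} Y^{s-2} |D²f|²`, up to
  `∫ X² Y^{s+2r-2}`. On the set `|∇f| > 1` the weight `Y^{s-2}` is controlled by the regularized
  flux, uniformly in `ε` (`mul_bracket_rpow_le_flux`).
* The Sobolev inequality for `X^γ - 1`, with `γ = κ - 2/N`, and Hölder's inequality with the
  `L²` bound give `∫ X^κ ≤ C + ∫ Y^m` for `κ = lam * m` and `lam < (N + 2) / N`
  (`exists_integral_bracket_rpow_le`).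
* The remaining products of powers of `X` and `Y` are subcritical with respect to `X^κ` and `Y^m`
  as soon as `lam > 2 / (2 - r)`, and are absorbed by a Young inequality that is uniform in the
  exponents (`exists_young_subcritical`). Both conditions on `lam` can be met precisely because
  `r < 4 / (N + 2)`.
-/

namespace ParabolicInterp

/-! ### Test functions, `C¹` functions and approximation in `H¹₀` -/

section

variable {N : ℕ} {Ω : Set (E N)}

theorem pd_eq_gradient (f : E N → ℝ) (i : Fin N) (x : E N) : pd i f x = gradient f x i := by
  have h : inner ℝ (gradient f x) (EuclideanSpace.single i (1 : ℝ)) = pd i f x := by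
    simp [gradient, pd]
  rw [← h, EuclideanSpace.inner_single_right]
  simp

theorem norm_fderiv_eq_norm_gradient (f : E N → ℝ) (x : E N) :
    ‖fderiv ℝ f x‖ = ‖gradient f x‖ := by
  simp [gradient]

theorem IsTest.continuous {φ : E N → ℝ} (h : IsTest Ω φ) : Continuous φ := h.smooth.continuous

theorem IsTest.eq_zero {φ : E N → ℝ} (h : IsTest Ω φ) {x : E N} (hx : x ∉ Ω) : φ x = 0 :=
  image_eq_zero_of_notMem_tsupport fun h' => hx (h.subset h')

theorem IsTest.pd {φ : E N → ℝ} (h : IsTest Ω φ) (i : Fin N) : IsTest Ω (pd i φ) where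
  smooth := by
    have h1 : ContDiff ℝ ∞ (fderiv ℝ φ) := h.smooth.fderiv_right (by simp)
    exact h1.clm_apply contDiff_const
  compact := h.compact.fderiv_apply ℝ _
  subset := (tsupport_fderiv_apply_subset ℝ _).trans h.subset

theorem IsTest.differentiable {φ : E N → ℝ} (h : IsTest Ω φ) : Differentiable ℝ φ :=
  h.smooth.differentiable (by simp)

theorem integrable_mul_of_tsupport_subset (hΩ : IsOpen Ω) {k φ : E N → ℝ} (hk : ContinuousOn k Ω)
    (hφ : Continuous φ) (hc : HasCompactSupport φ) (hs : tsupport φ ⊆ Ω) :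
    Integrable (fun x => k x * φ x) := by
  have hcont : Continuous (fun x => k x * φ x) := by
    refine continuous_of_tsupport fun x hx => ?_
    have hx' : x ∈ Ω := hs (tsupport_mul_subset_right hx)
    exact (hk.continuousAt (hΩ.mem_nhds hx')).mul hφ.continuousAt
  exact hcont.integrable_of_hasCompactSupport hc.mul_left

theorem MemC1.differentiableAt (hΩ : IsOpen Ω) {f : E N → ℝ} (hf : MemC1 Ω f) {x : E N}
    (hx : x ∈ Ω) : DifferentiableAt ℝ f x :=
  (hf.contDiffOn.contDiffAt (hΩ.mem_nhds hx)).differentiableAt (by simp)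

theorem MemC1.continuousOn_gradient {f : E N → ℝ} (hf : MemC1 Ω f) :
    ContinuousOn (gradient f) Ω := by
  obtain ⟨G, hG, hGf⟩ := hf.gradient_ext
  exact (hG.mono subset_closure).congr fun x hx => (hGf x hx).symm

theorem MemC1.continuousOn_pd {f : E N → ℝ} (hf : MemC1 Ω f) (i : Fin N) :
    ContinuousOn (pd i f) Ω := by
  have h : pd i f = fun x => gradient f x i := funext fun x => pd_eq_gradient f i x
  rw [h]
  exact (EuclideanSpace.proj (𝕜 := ℝ) i).continuous.comp_continuousOn hf.continuousOn_gradient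

theorem MemC1.exists_bound (hb : Bornology.IsBounded Ω) {f : E N → ℝ} (hf : MemC1 Ω f) :
    ∃ B, 0 ≤ B ∧ ∀ x ∈ Ω, |f x| ≤ B ∧ ‖gradient f x‖ ≤ B := by
  obtain ⟨G, hG, hGf⟩ := hf.gradient_ext
  obtain ⟨B₁, h₁⟩ := hb.isCompact_closure.exists_bound_of_continuousOn hf.continuousOn
  obtain ⟨B₂, h₂⟩ := hb.isCompact_closure.exists_bound_of_continuousOn hG
  refine ⟨|B₁| + |B₂|, by positivity, fun x hx => ⟨?_, ?_⟩⟩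
  · have := h₁ x (subset_closure hx)
    rw [Real.norm_eq_abs] at this
    linarith [le_abs_self B₁, abs_nonneg B₂]
  · have := h₂ x (subset_closure hx)
    rw [hGf x hx] at this
    linarith [le_abs_self B₂, abs_nonneg B₁]

theorem isFiniteMeasure_restrict (hb : Bornology.IsBounded Ω) :
    IsFiniteMeasure (volume.restrict Ω) :=
  ⟨by simpa using hb.measure_lt_top⟩

theorem integrableOn_of_bound (hΩ : IsOpen Ω) (hb : Bornology.IsBounded Ω) {F : Type*}
    [NormedAddCommGroup F] {k : E N → F} (hk : ContinuousOn k Ω) {B : ℝ}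
    (hB : ∀ x ∈ Ω, ‖k x‖ ≤ B) : IntegrableOn k Ω := by
  have := isFiniteMeasure_restrict hb
  exact Integrable.of_bound (hk.aestronglyMeasurable hΩ.measurableSet) B
    ((ae_restrict_iff' hΩ.measurableSet).2 (ae_of_all _ hB))

/-- Integration by parts of a `C¹` function against a test function. -/
theorem integral_mul_pd (hΩ : IsOpen Ω) {f φ : E N → ℝ} (hd : ∀ x ∈ Ω, DifferentiableAt ℝ f x)
    (i : Fin N) (hc : ContinuousOn (pd i f) Ω) (hφ : IsTest Ω φ) :
    ∫ x in Ω, f x * pd i φ x = -∫ x in Ω, pd i f x * φ x := by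
  have hfc : ContinuousOn f Ω := fun x hx => (hd x hx).continuousAt.continuousWithinAt
  have hφ' := hφ.pd i
  rw [setIntegral_eq_integral_of_forall_compl_eq_zero
      (fun x hx => by simp [hφ'.eq_zero hx]),
    setIntegral_eq_integral_of_forall_compl_eq_zero (fun x hx => by simp [hφ.eq_zero hx])]
  exact integral_mul_fderiv_eq_neg_fderiv_mul_of_integrable
    (integrable_mul_of_tsupport_subset hΩ hc hφ.continuous hφ.compact hφ.subset)
    (integrable_mul_of_tsupport_subset hΩ hfc hφ'.continuous hφ'.compact hφ'.subset)
    (integrable_mul_of_tsupport_subset hΩ hfc hφ.continuous hφ.compact hφ.subset)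
    (fun x hx => hd x (hφ.subset hx)) (fun x _ => hφ.differentiable x)

theorem IsTest.exists_bound {φ : E N → ℝ} (h : IsTest Ω φ) : ∃ C, 0 ≤ C ∧ ∀ x, |φ x| ≤ C := by
  obtain ⟨C, hC⟩ := h.compact.exists_bound_of_continuous h.continuous
  exact ⟨|C|, abs_nonneg _, fun x => (hC x).trans (le_abs_self C)⟩

theorem tendsto_integral_mul_of_tendsto {α : Type*} [MeasurableSpace α] {μ : Measure α}
    {k : ℕ → α → ℝ} {k₀ θ : α → ℝ} {C : ℝ} (hk : ∀ n, Integrable (k n) μ) (hk₀ : Integrable k₀ μ)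
    (hθ : AEStronglyMeasurable θ μ) (hC : ∀ᵐ x ∂μ, |θ x| ≤ C)
    (h : Tendsto (fun n => ∫ x, |k n x - k₀ x| ∂μ) atTop (𝓝 0)) :
    Tendsto (fun n => ∫ x, k n x * θ x ∂μ) atTop (𝓝 (∫ x, k₀ x * θ x ∂μ)) := by
  rw [tendsto_iff_norm_sub_tendsto_zero]
  have h' := h.mul_const C
  rw [zero_mul] at h'
  refine squeeze_zero (fun _ => norm_nonneg _) (fun n => ?_) h'
  have hC' : ∀ᵐ x ∂μ, ‖θ x‖ ≤ C := hC
  rw [← integral_sub ((hk n).mul_bdd (c := C) hθ hC') (hk₀.mul_bdd (c := C) hθ hC'),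
    ← integral_mul_const]
  refine norm_integral_le_of_norm_le (((hk n).sub hk₀).abs.mul_const C) ?_
  filter_upwards [hC] with x hx
  rw [← sub_mul, norm_mul]
  exact mul_le_mul_of_nonneg_left hx (norm_nonneg _)

theorem tendsto_integral_abs_of_eLpNorm_two {α : Type*} [MeasurableSpace α] {μ : Measure α}
    [IsFiniteMeasure μ] {k : ℕ → α → ℝ} {k₀ : α → ℝ} (hk : ∀ n, MemLp (k n) 2 μ)
    (hk₀ : MemLp k₀ 2 μ)
    (h : Tendsto (fun n => eLpNorm (fun x => k n x - k₀ x) 2 μ) atTop (𝓝 0)) :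
    Tendsto (fun n => ∫ x, |k n x - k₀ x| ∂μ) atTop (𝓝 0) := by
  have h1 : Tendsto (fun n => eLpNorm (fun x => k n x - k₀ x) 1 μ) atTop (𝓝 0) := by
    have hc := ENNReal.Tendsto.mul_const (b := μ univ ^ (1 / (1 : ℝ≥0∞).toReal -
      1 / (2 : ℝ≥0∞).toReal)) h (Or.inr (by
        refine ENNReal.rpow_ne_top_of_nonneg (by norm_num) (measure_ne_top _ _)))
    rw [zero_mul] at hc
    refine tendsto_of_tendsto_of_tendsto_of_le_of_le tendsto_const_nhds hc
      (fun _ => bot_le) (fun n => ?_)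
    exact eLpNorm_le_eLpNorm_mul_rpow_measure_univ (by norm_num) ((hk n).sub hk₀).1
  have h2 := (ENNReal.tendsto_toReal ENNReal.zero_ne_top).comp h1
  rw [ENNReal.toReal_zero] at h2
  refine h2.congr fun n => ?_
  simp only [Function.comp, eLpNorm_one_eq_lintegral_enorm]
  have hi : Integrable (fun x => k n x - k₀ x) μ := ((hk n).sub hk₀).integrable (by norm_num)
  exact (integral_norm_eq_lintegral_enorm hi.1).symm

theorem IsTest.memLp {φ : E N → ℝ} (h : IsTest Ω φ) (p : ℝ≥0∞) :
    MemLp φ p (volume.restrict Ω) :=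
  (h.continuous.memLp_of_hasCompactSupport h.compact).restrict Ω

/-- The `L²` limit of the gradients in the definition of `H¹₀(Ω)` is the classical gradient. -/
theorem MemH10.ae_eq_pd (hΩ : IsOpen Ω) (hb : Bornology.IsBounded Ω) {f : E N → ℝ}
    (hf : MemC1 Ω f) (hf2 : MemL2 Ω f) {G : Fin N → E N → ℝ} {φ : ℕ → E N → ℝ}
    (hG : ∀ i, MemL2 Ω (G i)) (hφ : ∀ n, IsTest Ω (φ n))
    (h0 : Tendsto (fun n => eLpNorm (fun x => φ n x - f x) 2 (volume.restrict Ω)) atTop (𝓝 0))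
    (h1 : ∀ i, Tendsto (fun n => eLpNorm (fun x => pd i (φ n) x - G i x) 2 (volume.restrict Ω))
      atTop (𝓝 0)) (i : Fin N) : G i =ᵐ[volume.restrict Ω] pd i f := by
  have := isFiniteMeasure_restrict hb
  obtain ⟨B, hB, hfB⟩ := hf.exists_bound hb
  have hpd : IntegrableOn (pd i f) Ω := by
    refine integrableOn_of_bound hΩ hb (hf.continuousOn_pd i) (B := B) fun x hx => ?_
    rw [pd_eq_gradient]
    exact (PiLp.norm_apply_le _ i).trans (hfB x hx).2
  have hGi : IntegrableOn (G i) Ω := (hG i).integrable (by norm_num)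
  have key := hΩ.ae_eq_zero_of_integral_contDiff_smul_eq_zero (μ := volume)
    (f := fun x => G i x - pd i f x) (hGi.sub hpd).locallyIntegrableOn (fun ψ hψ hc hs => by
      have hψt : IsTest Ω ψ := ⟨hψ, hc, hs⟩
      obtain ⟨C, -, hC⟩ := hψt.exists_bound
      obtain ⟨C', -, hC'⟩ := (hψt.pd i).exists_bound
      have t1 := tendsto_integral_mul_of_tendsto
        (fun n => (((hφ n).pd i).memLp 2).integrable (by norm_num)) hGi
        hψt.continuous.aestronglyMeasurable (ae_of_all _ hC)
        (tendsto_integral_abs_of_eLpNorm_two (fun n => ((hφ n).pd i).memLp 2) (hG i) (h1 i))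
      have t2 := tendsto_integral_mul_of_tendsto
        (fun n => ((hφ n).memLp 2).integrable (by norm_num)) (hf2.integrable (by norm_num))
        (hψt.pd i).continuous.aestronglyMeasurable (ae_of_all _ hC')
        (tendsto_integral_abs_of_eLpNorm_two (fun n => (hφ n).memLp 2) hf2 h0)
      have e1 : ∀ n, ∫ x in Ω, pd i (φ n) x * ψ x = -∫ x in Ω, φ n x * pd i ψ x := fun n => by
        rw [integral_mul_pd hΩ (fun x _ => (hφ n).differentiable x) i
          ((hφ n).pd i).continuous.continuousOn hψt, neg_neg]
      simp only [e1] at t1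
      have e2 := tendsto_nhds_unique t1 t2.neg
      rw [integral_mul_pd hΩ (fun x hx => hf.differentiableAt hΩ hx) i (hf.continuousOn_pd i) hψt,
        neg_neg] at e2
      have e3 : ∫ x in Ω, ψ x • (G i x - pd i f x) = 0 := by
        have : ∀ x, ψ x • (G i x - pd i f x) = G i x * ψ x - pd i f x * ψ x := fun x => by
          simp only [smul_eq_mul]; ring
        simp only [this]
        rw [integral_sub (hGi.mul_bdd (c := C) hψt.continuous.aestronglyMeasurable (ae_of_all _ hC))
          (hpd.mul_bdd (c := C) hψt.continuous.aestronglyMeasurable (ae_of_all _ hC)), e2, sub_self]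
      rwa [setIntegral_eq_integral_of_forall_compl_eq_zero
        (fun x hx => by simp [hψt.eq_zero hx])] at e3)
  rw [EventuallyEq, ae_restrict_iff' hΩ.measurableSet]
  filter_upwards [key] with x hx hxΩ
  exact sub_eq_zero.1 (hx hxΩ)

/-- A smooth compactly supported function of one variable that is the identity on `[-B, B]`. -/
theorem exists_smooth_truncation (B : ℝ) :
    ∃ Θ : ℝ → ℝ, ContDiff ℝ ∞ Θ ∧ HasCompactSupport Θ ∧ ∀ τ, |τ| ≤ B → Θ =ᶠ[𝓝 τ] id := by
  let b : ContDiffBump (0 : ℝ) := ⟨|B| + 1, |B| + 2, by positivity, by linarith⟩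
  refine ⟨fun τ => τ * b τ, contDiff_id.mul b.contDiff, b.hasCompactSupport.mul_left,
    fun τ hτ => ?_⟩
  have : τ ∈ Metric.ball (0 : ℝ) b.rIn := by
    rw [mem_ball_zero_iff, Real.norm_eq_abs]
    exact lt_of_le_of_lt (hτ.trans (le_abs_self B)) (lt_add_one _)
  filter_upwards [b.eventuallyEq_one_of_mem_ball this] with y hy
  simp [hy]

/-- A function of `C¹(closure Ω) ∩ H¹₀(Ω)` is a limit of uniformly bounded test functions, almost
everywhere and with `L¹` convergence of the gradients. -/
theorem MemX.exists_test_approx (hΩ : IsOpen Ω) (hb : Bornology.IsBounded Ω) {f : E N → ℝ}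
    (hf : MemX Ω f) :
    ∃ (B : ℝ) (ψ : ℕ → E N → ℝ), (∀ n, IsTest Ω (ψ n)) ∧ (∀ n x, |ψ n x| ≤ B) ∧
      (∀ᵐ x ∂(volume.restrict Ω), Tendsto (fun n => ψ n x) atTop (𝓝 (f x))) ∧
      ∀ i, Tendsto (fun n => ∫ x in Ω, |pd i (ψ n) x - pd i f x|) atTop (𝓝 0) := by
  have := isFiniteMeasure_restrict hb
  obtain ⟨hf2, G, φ, hG, hφ, h0, h1⟩ := hf.memH10
  have hGf := MemH10.ae_eq_pd hΩ hb hf.memC1 hf2 hG hφ h0 h1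
  obtain ⟨B, hB, hfB⟩ := hf.memC1.exists_bound hb
  obtain ⟨Θ, hΘ, hΘc, hΘi⟩ := exists_smooth_truncation B
  have hΘd : Continuous (deriv Θ) := hΘ.continuous_deriv (by simp)
  obtain ⟨C₀, hC₀⟩ := hΘc.exists_bound_of_continuous hΘ.continuous
  obtain ⟨C₁, hC₁⟩ := hΘc.deriv.exists_bound_of_continuous hΘd
  have hΘ0 : Θ 0 = 0 := (hΘi 0 (by simpa using hB)).eq_of_nhds
  -- along an a.e. convergent subsequence `Θ ∘ φ` is bounded, and `Θ' (φ) → Θ' (f) = 1`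
  have hm : TendstoInMeasure (volume.restrict Ω) φ atTop f :=
    tendstoInMeasure_of_tendsto_eLpNorm (p := 2) (by norm_num)
      (fun n => (hφ n).continuous.aestronglyMeasurable) hf2.1 h0
  obtain ⟨ns, hns, hae⟩ := hm.exists_seq_tendsto_ae
  have hpd : ∀ n i x, pd i (Θ ∘ φ (ns n)) x = deriv Θ (φ (ns n) x) * pd i (φ (ns n)) x := by
    intro n i x
    have hd : HasFDerivAt (Θ ∘ φ (ns n)) (deriv Θ (φ (ns n) x) • fderiv ℝ (φ (ns n)) x) x :=
      ((hΘ.differentiable (by simp)) _).hasDerivAt.comp_hasFDerivAt x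
        ((hφ (ns n)).differentiable x).hasFDerivAt
    simp [pd, hd.fderiv]
  have haeΩ : ∀ᵐ x ∂(volume.restrict Ω), x ∈ Ω := ae_restrict_mem hΩ.measurableSet
  refine ⟨C₀, fun n => Θ ∘ φ (ns n), fun n => ⟨hΘ.comp (hφ _).smooth,
    (hφ _).compact.comp_left hΘ0, ?_⟩, fun n x => hC₀ _, ?_, fun i => ?_⟩
  · exact (tsupport_comp_subset hΘ0 _).trans (hφ _).subset
  · filter_upwards [hae, haeΩ] with x hx hxΩ
    have h := (hΘ.continuous.tendsto (f x)).comp hx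
    rwa [(hΘi (f x) (hfB x hxΩ).1).eq_of_nhds] at h
  · have hpi : MemLp (pd i f) 2 (volume.restrict Ω) := (memLp_congr_ae (hGf i)).1 (hG i)
    have l1 : Tendsto (fun n => ∫ x in Ω, |pd i (φ (ns n)) x - pd i f x|) atTop (𝓝 0) := by
      refine tendsto_integral_abs_of_eLpNorm_two (fun n => ((hφ (ns n)).pd i).memLp 2) hpi ?_
      refine ((h1 i).comp hns.tendsto_atTop).congr fun n => ?_
      refine eLpNorm_congr_ae ?_
      filter_upwards [hGf i] with x hx
      rw [hx]
    have l2 : Tendsto (fun n => ∫ x in Ω, |(deriv Θ (φ (ns n) x) - 1) * pd i f x|) atTop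
        (𝓝 0) := by
      have := tendsto_integral_of_dominated_convergence (μ := volume.restrict Ω)
        (F := fun n x => |(deriv Θ (φ (ns n) x) - 1) * pd i f x|) (f := fun _ => (0 : ℝ))
        (fun x => (C₁ + 1) * |pd i f x|) ?_ ?_ ?_ ?_
      · simpa using this
      · intro n
        exact (((hΘd.comp (hφ (ns n)).continuous).sub
          continuous_const).aestronglyMeasurable.mul hpi.1).norm
      · exact (hpi.integrable (by norm_num)).abs.const_mul _
      · refine fun n => ae_of_all _ fun x => ?_
        rw [Real.norm_eq_abs, abs_abs, abs_mul]
        refine mul_le_mul_of_nonneg_right ?_ (abs_nonneg _)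
        have := hC₁ (φ (ns n) x)
        rw [Real.norm_eq_abs] at this
        calc |deriv Θ (φ (ns n) x) - 1| ≤ |deriv Θ (φ (ns n) x)| + |(1 : ℝ)| := abs_sub _ _
          _ ≤ C₁ + 1 := by simpa using this
      · filter_upwards [hae, haeΩ] with x hx hxΩ
        have h := (hΘd.tendsto (f x)).comp hx
        have hd : deriv Θ (f x) = 1 := by
          rw [(hΘi (f x) (hfB x hxΩ).1).deriv_eq]; simp
        rw [hd] at h
        have := (((h.sub_const 1).mul_const (pd i f x))).abs
        simpa using this
    have l3 := (l1.const_mul C₁).add l2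
    rw [mul_zero, zero_add] at l3
    refine squeeze_zero (fun n => integral_nonneg fun x => abs_nonneg _) (fun n => ?_) l3
    have i1 : Integrable (fun x => |pd i (φ (ns n)) x - pd i f x|) (volume.restrict Ω) :=
      ((((hφ (ns n)).pd i).memLp 2).sub hpi).integrable (by norm_num) |>.abs
    have i2 : Integrable (fun x => |(deriv Θ (φ (ns n) x) - 1) * pd i f x|)
        (volume.restrict Ω) := by
      refine ((hpi.integrable (by norm_num)).bdd_mul (c := C₁ + 1)
        ((hΘd.comp (hφ (ns n)).continuous).sub continuous_const).aestronglyMeasurable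
        (ae_of_all _ fun x => ?_)).abs
      exact (norm_sub_le _ _).trans (by simpa using hC₁ _)
    rw [← integral_const_mul, ← integral_add (i1.const_mul _) i2]
    refine integral_mono_of_nonneg (ae_of_all _ fun x => abs_nonneg _)
      ((i1.const_mul _).add i2) (ae_of_all _ fun x => ?_)
    simp only [hpd]
    have e : deriv Θ (φ (ns n) x) * pd i (φ (ns n)) x - pd i f x =
        deriv Θ (φ (ns n) x) * (pd i (φ (ns n)) x - pd i f x) +
          (deriv Θ (φ (ns n) x) - 1) * pd i f x := by ring
    rw [e]
    refine (abs_add_le _ _).trans (add_le_add ?_ le_rfl)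
    rw [abs_mul]
    exact mul_le_mul_of_nonneg_right (hC₁ _) (abs_nonneg _)

end

/-! ### Mollification and the chain rule for weak derivatives -/

section

variable {N : ℕ} {Ω : Set (E N)} {F : Type*} [NormedAddCommGroup F] [NormedSpace ℝ F]

/-- The mollification of `g` with the normalized bump function `φ`. -/
noncomputable def mollify (φ : ContDiffBump (0 : E N)) (g : E N → F) : E N → F :=
  convolution (φ.normed volume) g (ContinuousLinearMap.lsmul ℝ ℝ) volume

theorem mollify_apply (φ : ContDiffBump (0 : E N)) (g : E N → F) (x : E N) :
    mollify φ g x = ∫ t, φ.normed volume t • g (x - t) := rfl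

theorem mollify_apply_swap (φ : ContDiffBump (0 : E N)) (g : E N → F) (x : E N) :
    mollify φ g x = ∫ t, φ.normed volume (x - t) • g t := by
  rw [mollify, convolution_eq_swap]; rfl

theorem integrable_normed (φ : ContDiffBump (0 : E N)) : Integrable (φ.normed volume) :=
  φ.continuous_normed.integrable_of_hasCompactSupport φ.hasCompactSupport_normed

theorem integrable_mollify (φ : ContDiffBump (0 : E N)) {g : E N → F} (hg : Integrable g) :
    Integrable (mollify φ g) :=
  (integrable_normed φ).integrable_convolution _ hg

theorem integral_norm_mollify_le (φ : ContDiffBump (0 : E N)) {g : E N → F} (hg : Integrable g) :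
    ∫ x, ‖mollify φ g x‖ ≤ ∫ x, ‖g x‖ := by
  have h1 : ∫ x, mollify φ (fun y => ‖g y‖) x = ∫ x, ‖g x‖ := by
    simp only [mollify]
    rw [integral_convolution _ (integrable_normed φ) hg.norm, φ.integral_normed]
    simp
  rw [← h1]
  refine integral_mono_of_nonneg (ae_of_all _ fun x => norm_nonneg _)
    (integrable_mollify φ hg.norm) (ae_of_all _ fun x => ?_)
  simp only [mollify_apply]
  refine (norm_integral_le_integral_norm _).trans (le_of_eq ?_)
  refine integral_congr_ae (ae_of_all _ fun t => ?_)
  simp [norm_smul, abs_of_nonneg (φ.nonneg_normed _)]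

theorem norm_mollify_le (φ : ContDiffBump (0 : E N)) {g : E N → F} {B : ℝ}
    (hB : ∀ x, ‖g x‖ ≤ B) (x : E N) : ‖mollify φ g x‖ ≤ B := by
  rw [mollify_apply]
  have h := norm_integral_le_of_norm_le (f := fun t => φ.normed volume t • g (x - t))
    ((integrable_normed φ).mul_const B) (ae_of_all _ fun t => by
      rw [norm_smul, Real.norm_eq_abs, abs_of_nonneg (φ.nonneg_normed _)]
      exact mul_le_mul_of_nonneg_left (hB _) (φ.nonneg_normed _))
  rwa [integral_mul_const, φ.integral_normed, one_mul] at h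

theorem mollify_sub (φ : ContDiffBump (0 : E N)) {g k : E N → F}
    (hg : LocallyIntegrable g) (hk : LocallyIntegrable k) (x : E N) :
    mollify φ (fun y => g y - k y) x = mollify φ g x - mollify φ k x := by
  have e : ∀ {l : E N → F}, LocallyIntegrable l →
      Integrable (fun t => φ.normed volume t • l (x - t)) := fun hl =>
    (φ.hasCompactSupport_normed.convolutionExists_left (ContinuousLinearMap.lsmul ℝ ℝ)
      φ.continuous_normed hl x).integrable
  simp only [mollify_apply, smul_sub]
  exact integral_sub (e hg) (e hk)

theorem contDiff_mollify (φ : ContDiffBump (0 : E N)) {g : E N → F} (hg : LocallyIntegrable g) :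
    ContDiff ℝ ∞ (mollify φ g) :=
  φ.hasCompactSupport_normed.contDiff_convolution_left _ φ.contDiff_normed hg

/-- On the points at distance more than the mollification radius from the complement of `Ω`, the
derivative of a mollification is the mollification of the weak derivative. -/
theorem fderiv_mollify (hΩ : IsOpen Ω) (φ : ContDiffBump (0 : E N)) {g h : E N → F} {i : Fin N}
    (hg : IntegrableOn g Ω)
    (hw : ∀ ψ, IsTest Ω ψ → ∫ x in Ω, pd i ψ x • g x = -∫ x in Ω, ψ x • h x)
    {x : E N} (hx : Metric.closedBall x φ.rOut ⊆ Ω) :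
    fderiv ℝ (mollify φ (Ω.indicator g)) x (EuclideanSpace.single i 1) =
      mollify φ (Ω.indicator h) x := by
  have hgi : Integrable (Ω.indicator g) := (integrable_indicator_iff hΩ.measurableSet).2 hg
  have hc1 : ContDiff ℝ 1 (φ.normed (volume : Measure (E N))) := φ.contDiff_normed
  have hd := φ.hasCompactSupport_normed.hasFDerivAt_convolution_left (μ := volume)
    (ContinuousLinearMap.lsmul ℝ ℝ) hc1 hgi.locallyIntegrable x
  have hd' : fderiv ℝ (mollify φ (Ω.indicator g)) x = _ := hd.fderiv
  -- the reflected kernel is an admissible test function for the weak derivative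
  set ψ : E N → ℝ := fun y => φ.normed volume (x - y) with hψ
  have hψt : IsTest Ω ψ := by
    have hts : tsupport ψ ⊆ Metric.closedBall x φ.rOut := by
      refine closure_minimal (fun y hy => ?_) Metric.isClosed_closedBall
      have : x - y ∈ Function.support (φ.normed volume) := hy
      rw [φ.support_normed_eq, mem_ball_zero_iff] at this
      rw [Metric.mem_closedBall, dist_comm, dist_eq_norm]
      exact this.le
    exact ⟨φ.contDiff_normed.comp (contDiff_const.sub contDiff_id),
      HasCompactSupport.of_support_subset_isCompact (isCompact_closedBall x φ.rOut)
        (subset_closure.trans hts), hts.trans hx⟩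
  have hpd : ∀ y, pd i ψ y = -fderiv ℝ (φ.normed volume) (x - y) (EuclideanSpace.single i 1) := by
    intro y
    have h1 : HasFDerivAt (fun y : E N => x - y) (-ContinuousLinearMap.id ℝ (E N)) y := by
      simpa using (hasFDerivAt_id y).const_sub x
    have h2 := (hc1.differentiable (by simp) (x - y)).hasFDerivAt.comp y h1
    have h3 : fderiv ℝ ψ y = _ := h2.fderiv
    simp [pd, h3]
  rw [hd', convolution_eq_swap, ContinuousLinearMap.integral_apply]
  · have e1 : ∀ y, ((ContinuousLinearMap.precompL (E N) (ContinuousLinearMap.lsmul ℝ ℝ))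
        (fderiv ℝ (φ.normed volume) (x - y)) (Ω.indicator g y)) (EuclideanSpace.single i 1) =
        Ω.indicator (fun y => -(pd i ψ y • g y)) y := by
      intro y
      by_cases hy : y ∈ Ω
      · simp [hy, hpd]
      · simp [hy]
    have e2 : ∀ y, φ.normed volume (x - y) • Ω.indicator h y =
        Ω.indicator (fun y => ψ y • h y) y := by
      intro y
      by_cases hy : y ∈ Ω <;> simp [hy, hψ]
    simp only [e1]
    rw [mollify_apply_swap]
    simp only [e2]
    rw [integral_indicator hΩ.measurableSet, integral_indicator hΩ.measurableSet, integral_neg,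
      hw ψ hψt, neg_neg]
  · have := (φ.hasCompactSupport_normed.fderiv ℝ).convolutionExists_left
      (ContinuousLinearMap.precompL (E N) (ContinuousLinearMap.lsmul ℝ ℝ))
      (hc1.continuous_fderiv (by simp)) hgi.locallyIntegrable x
    exact this.integrable_swap

variable [CompleteSpace F]

theorem exists_bumps (N : ℕ) :
    ∃ φ : ℕ → ContDiffBump (0 : E N), Tendsto (fun n => (φ n).rOut) atTop (𝓝 0) := by
  refine ⟨fun n => ⟨1 / (2 * ((n : ℝ) + 1)), 1 / ((n : ℝ) + 1), by positivity, ?_⟩,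
    tendsto_one_div_add_atTop_nhds_zero_nat⟩
  exact one_div_lt_one_div_of_lt (by positivity) (by linarith [n.cast_nonneg (α := ℝ)])

/-- Mollifications of a continuous compactly supported function converge in `L¹`. -/
theorem tendsto_mollify_of_continuous {φ : ℕ → ContDiffBump (0 : E N)}
    (hφ : Tendsto (fun n => (φ n).rOut) atTop (𝓝 0)) {g : E N → F} (hg : Continuous g)
    (hc : HasCompactSupport g) :
    Tendsto (fun n => ∫ x, ‖mollify (φ n) g x - g x‖) atTop (𝓝 0) := by
  set K := Metric.cthickening 1 (tsupport g) with hK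
  have hKc : IsCompact K := hc.isCompact.cthickening
  rw [Metric.tendsto_atTop]
  intro ε hε
  set ε' := ε / (2 * (volume.real K + 1)) with hε'
  have hV : 0 ≤ volume.real K := measureReal_nonneg
  have hε'0 : 0 < ε' := by positivity
  obtain ⟨δ, hδ, hgδ⟩ := Metric.uniformContinuous_iff.1 (hc.uniformContinuous_of_continuous hg)
    ε' hε'0
  obtain ⟨n₀, hn₀⟩ := Metric.tendsto_atTop.1 hφ (min δ 1) (lt_min hδ one_pos)
  refine ⟨n₀, fun n hn => ?_⟩
  have hr : (φ n).rOut < min δ 1 := by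
    have := hn₀ n hn
    rwa [Real.dist_0_eq_abs, abs_of_pos (φ n).rOut_pos] at this
  have hr1 := hr.trans_le (min_le_right _ _)
  have hrδ := hr.trans_le (min_le_left _ _)
  have hpt : ∀ x, ‖mollify (φ n) g x - g x‖ ≤ ε' := fun x => by
    rw [← dist_eq_norm]
    refine ContDiffBump.dist_normed_convolution_le hg.aestronglyMeasurable fun y hy => ?_
    exact (hgδ ((Metric.mem_ball.1 hy).trans hrδ)).le
  have hout : ∀ x ∉ K, mollify (φ n) g x - g x = 0 := fun x hx => by
    have hz : ∀ y ∈ Metric.ball x (φ n).rOut, g y = 0 := fun y hy => by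
      refine image_eq_zero_of_notMem_tsupport fun hy' => hx ?_
      exact Metric.mem_cthickening_of_dist_le x y 1 _ hy'
        (by rw [dist_comm]; exact ((Metric.mem_ball.1 hy).trans hr1).le)
    have hx0 := hz x (Metric.mem_ball_self (φ n).rOut_pos)
    rw [sub_eq_zero]
    exact ContDiffBump.normed_convolution_eq_right (fun y hy => by rw [hz y hy, hx0])
  rw [Real.dist_0_eq_abs, abs_of_nonneg (integral_nonneg fun x => norm_nonneg _),
    ← setIntegral_eq_integral_of_forall_compl_eq_zero (s := K)
      (fun x hx => by rw [hout x hx, norm_zero])]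
  have h := norm_setIntegral_le_of_norm_le_const (μ := volume) (s := K)
    (f := fun x => ‖mollify (φ n) g x - g x‖) (C := ε') hKc.measure_lt_top
    (fun x _ => by rw [norm_norm]; exact hpt x)
  refine ((le_abs_self _).trans h).trans_lt ?_
  rw [hε', div_mul_eq_mul_div, div_lt_iff₀ (by positivity)]
  nlinarith

/-- Mollifications of an integrable function converge in `L¹`. -/
theorem tendsto_mollify {φ : ℕ → ContDiffBump (0 : E N)}
    (hφ : Tendsto (fun n => (φ n).rOut) atTop (𝓝 0)) {g : E N → F} (hg : Integrable g) :
    Tendsto (fun n => ∫ x, ‖mollify (φ n) g x - g x‖) atTop (𝓝 0) := by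
  rw [Metric.tendsto_atTop]
  intro ε hε
  obtain ⟨k, hkc, hk, hkcont, hki⟩ := hg.exists_hasCompactSupport_integral_sub_le
    (show 0 < ε / 4 by positivity)
  obtain ⟨n₀, hn₀⟩ := Metric.tendsto_atTop.1 (tendsto_mollify_of_continuous hφ hkcont hkc)
    (ε / 4) (by positivity)
  refine ⟨n₀, fun n hn => ?_⟩
  have h0 := hn₀ n hn
  rw [Real.dist_0_eq_abs, abs_of_nonneg (integral_nonneg fun x => norm_nonneg _)] at h0 ⊢
  have i1 := (integrable_mollify (φ n) (hg.sub hki)).norm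
  have i2 := ((integrable_mollify (φ n) hki).sub hki).norm
  have i3 := (hg.sub hki).norm
  have h1 := integral_norm_mollify_le (φ n) (hg.sub hki)
  have hle : ∫ x, ‖mollify (φ n) g x - g x‖ ≤
      ∫ x, (‖mollify (φ n) (g - k) x‖ + ‖mollify (φ n) k x - k x‖ + ‖g x - k x‖) := by
    refine integral_mono_of_nonneg (ae_of_all _ fun x => norm_nonneg _)
      ((i1.add i2).add i3) (ae_of_all _ fun x => ?_)
    have e : mollify (φ n) g x - g x = mollify (φ n) (g - k) x +
        (mollify (φ n) k x - k x) - (g x - k x) := by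
      have := mollify_sub (φ n) hg.locallyIntegrable hki.locallyIntegrable x
      have h' : mollify (φ n) (g - k) x = mollify (φ n) g x - mollify (φ n) k x := this
      rw [h']; abel
    simp only [e]
    exact (norm_sub_le _ _).trans (add_le_add_left (norm_add_le _ _) _)
  have hsum : ∫ x, (‖mollify (φ n) (g - k) x‖ + ‖mollify (φ n) k x - k x‖ + ‖g x - k x‖) =
      (∫ x, ‖mollify (φ n) (g - k) x‖) + (∫ x, ‖mollify (φ n) k x - k x‖) +
        ∫ x, ‖g x - k x‖ := by
    have i12 : Integrable (fun x => ‖mollify (φ n) (g - k) x‖ + ‖mollify (φ n) k x - k x‖) :=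
      i1.add i2
    have i3' : Integrable (fun x => ‖g x - k x‖) := i3
    have i2' : Integrable (fun x => ‖mollify (φ n) k x - k x‖) := i2
    rw [integral_add i12 i3', integral_add i1 i2']
  have h1' : ∫ x, ‖mollify (φ n) (g - k) x‖ ≤ ∫ x, ‖g x - k x‖ := h1
  linarith

/-- The chain rule for weak derivatives: if the bounded continuous field `G` has the integrable weak
derivative `H` in the direction `i`, then `x ↦ Ψ (x, G x)` has the weak derivative
`DΨ (x, G x) (eᵢ, H x)`. -/
theorem weak_chain_rule (hΩ : IsOpen Ω) (hb : Bornology.IsBounded Ω) {G H : E N → E N} {B : ℝ}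
    (hG : ContinuousOn G Ω) (hB0 : 0 ≤ B) (hB : ∀ x ∈ Ω, ‖G x‖ ≤ B) (hH : IntegrableOn H Ω)
    {i : Fin N} (hw : ∀ ψ, IsTest Ω ψ → ∫ x in Ω, pd i ψ x • G x = -∫ x in Ω, ψ x • H x)
    {Ψ : E N × E N → ℝ} (hΨ : ContDiff ℝ 1 Ψ) {φ : E N → ℝ} (hφ : IsTest Ω φ) :
    ∫ x in Ω, Ψ (x, G x) * pd i φ x =
      -∫ x in Ω, fderiv ℝ Ψ (x, G x) (EuclideanSpace.single i 1, H x) * φ x := by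
  have := isFiniteMeasure_restrict hb
  obtain ⟨b, hbt⟩ := exists_bumps N
  set e : E N := EuclideanSpace.single i 1 with he
  have he1 : ‖e‖ = 1 := by simp [he]
  have hGi : IntegrableOn G Ω := integrableOn_of_bound hΩ hb hG hB
  have hGi' : Integrable (Ω.indicator G) := (integrable_indicator_iff hΩ.measurableSet).2 hGi
  have hHi' : Integrable (Ω.indicator H) := (integrable_indicator_iff hΩ.measurableSet).2 hH
  set g : ℕ → E N → E N := fun n => mollify (b n) (Ω.indicator G) with hg
  set k : ℕ → E N → E N := fun n => mollify (b n) (Ω.indicator H) with hk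
  have hgs : ∀ n, ContDiff ℝ ∞ (g n) := fun n => contDiff_mollify _ hGi'.locallyIntegrable
  have hgB : ∀ n x, ‖g n x‖ ≤ B := fun n x => norm_mollify_le _ (fun y => by
    by_cases hy : y ∈ Ω
    · simpa [hy] using hB y hy
    · simpa [hy] using hB0) x
  have hgt : ∀ x ∈ Ω, Tendsto (fun n => g n x) atTop (𝓝 (G x)) := fun x hx => by
    refine ContDiffBump.convolution_tendsto_right hbt
      (Eventually.of_forall fun n => hGi'.aestronglyMeasurable) ?_ tendsto_const_nhds
    have hc : ContinuousAt (Ω.indicator G) x := by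
      refine (hG.continuousAt (hΩ.mem_nhds hx)).congr ?_
      filter_upwards [hΩ.mem_nhds hx] with y hy
      simp [hy]
    have := hc.tendsto
    rw [indicator_of_mem hx] at this
    exact this.comp tendsto_snd
  -- uniform bounds on the compact set that contains all the arguments
  have hcpt : IsCompact (tsupport φ ×ˢ Metric.closedBall (0 : E N) B) :=
    hφ.compact.isCompact.prod (isCompact_closedBall 0 B)
  have hΨ' : Continuous (fderiv ℝ Ψ) := hΨ.continuous_fderiv (by simp)
  obtain ⟨C₀, hC₀⟩ := hcpt.exists_bound_of_continuousOn hΨ.continuous.continuousOn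
  obtain ⟨C₁, hC₁⟩ := hcpt.exists_bound_of_continuousOn hΨ'.continuousOn
  obtain ⟨M₀, hM₀0, hM₀⟩ := hφ.exists_bound
  obtain ⟨M₁, hM₁0, hM₁⟩ := (hφ.pd i).exists_bound
  have hmem : ∀ n, ∀ x ∈ tsupport φ, ((x, g n x) : E N × E N) ∈
      tsupport φ ×ˢ Metric.closedBall (0 : E N) B := fun n x hx =>
    ⟨hx, by simpa using hgB n x⟩
  obtain ⟨δ, hδ, hδΩ⟩ := hφ.compact.isCompact.exists_cthickening_subset_open hΩ hφ.subset
  have hev : ∀ᶠ n in atTop, (b n).rOut < δ := (tendsto_order.1 hbt).2 δ hδ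
  have hFs : ∀ n, ContDiff ℝ 1 (fun x => Ψ (x, g n x)) := fun n =>
    hΨ.comp (contDiff_id.prodMk ((hgs n).of_le (by simp)))
  have hFpd : ∀ n x, pd i (fun x => Ψ (x, g n x)) x =
      fderiv ℝ Ψ (x, g n x) (e, fderiv ℝ (g n) x e) := fun n x => by
    have h1 : HasFDerivAt (fun x => (x, g n x))
        ((ContinuousLinearMap.id ℝ (E N)).prod (fderiv ℝ (g n) x)) x :=
      (hasFDerivAt_id x).prodMk ((hgs n).differentiable (by simp) x).hasFDerivAt
    have h2 := (hΨ.differentiable (by simp) (x, g n x)).hasFDerivAt.comp x h1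
    have h3 : fderiv ℝ (fun x => Ψ (x, g n x)) x = _ := h2.fderiv
    simp [pd, h3, he]
  have hparts : ∀ n, ∫ x in Ω, Ψ (x, g n x) * pd i φ x =
      -∫ x in Ω, pd i (fun x => Ψ (x, g n x)) x * φ x := fun n =>
    integral_mul_pd hΩ (fun x _ => (hFs n).differentiable (by simp) x) i
      (((hFs n).continuous_fderiv (by simp)).clm_apply continuous_const).continuousOn hφ
  -- the limit of the left-hand sides
  have haeΩ : ∀ᵐ x ∂(volume.restrict Ω), x ∈ Ω := ae_restrict_mem hΩ.measurableSet
  have lim1 : Tendsto (fun n => ∫ x in Ω, Ψ (x, g n x) * pd i φ x) atTop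
      (𝓝 (∫ x in Ω, Ψ (x, G x) * pd i φ x)) := by
    refine tendsto_integral_of_dominated_convergence (fun _ => |C₀| * M₁) (fun n => ?_)
      (integrable_const _) (fun n => ae_of_all _ fun x => ?_) ?_
    · exact ((hFs n).continuous.mul (hφ.pd i).continuous).aestronglyMeasurable
    · rw [norm_mul]
      by_cases hx : x ∈ tsupport φ
      · exact mul_le_mul ((hC₀ _ (hmem n x hx)).trans (le_abs_self _)) (hM₁ x)
          (norm_nonneg _) (abs_nonneg _)
      · have : pd i φ x = 0 := image_eq_zero_of_notMem_tsupport
          fun h => hx (tsupport_fderiv_apply_subset ℝ _ h)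
        rw [this, norm_zero, mul_zero]
        positivity
    · filter_upwards [haeΩ] with x hx
      exact ((hΨ.continuous.tendsto _).comp
        (tendsto_const_nhds.prodMk_nhds (hgt x hx))).mul_const _
  -- the limit of the right-hand sides, with the mollified weak derivative replaced by its limit
  have hmeas : ∀ n, AEStronglyMeasurable
      (fun x => fderiv ℝ Ψ (x, g n x) (e, H x) * φ x) (volume.restrict Ω) := fun n => by
    have h1 : AEStronglyMeasurable (fun x => fderiv ℝ Ψ (x, g n x)) (volume.restrict Ω) :=
      (hΨ'.comp (continuous_id.prodMk (hgs n).continuous)).aestronglyMeasurable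
    exact (isBoundedBilinearMap_apply.continuous.comp_aestronglyMeasurable
      (h1.prodMk (aestronglyMeasurable_const.prodMk hH.1))).mul
      hφ.continuous.aestronglyMeasurable
  have hbd : ∀ n x (v : E N × E N), ‖fderiv ℝ Ψ (x, g n x) v * φ x‖ ≤ |C₁| * ‖v‖ * M₀ := by
    intro n x v
    rw [norm_mul]
    by_cases hx : x ∈ tsupport φ
    · refine mul_le_mul ((ContinuousLinearMap.le_opNorm _ _).trans ?_) (hM₀ x)
        (norm_nonneg _) (by positivity)
      exact mul_le_mul_of_nonneg_right ((hC₁ _ (hmem n x hx)).trans (le_abs_self _))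
        (norm_nonneg _)
    · rw [image_eq_zero_of_notMem_tsupport hx, norm_zero, mul_zero]
      positivity
  have hdom : IntegrableOn (fun x => |C₁| * (1 + ‖H x‖) * M₀) Ω :=
    (((integrable_const (1 : ℝ)).add hH.norm).const_mul _).mul_const _
  have hbd' : ∀ n x, ‖fderiv ℝ Ψ (x, g n x) (e, H x) * φ x‖ ≤ |C₁| * (1 + ‖H x‖) * M₀ := by
    intro n x
    refine (hbd n x _).trans ?_
    gcongr
    rw [Prod.norm_mk, he1]
    exact max_le (by linarith [norm_nonneg (H x)]) (by linarith)
  have lim2 : Tendsto (fun n => ∫ x in Ω, fderiv ℝ Ψ (x, g n x) (e, H x) * φ x) atTop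
      (𝓝 (∫ x in Ω, fderiv ℝ Ψ (x, G x) (e, H x) * φ x)) := by
    refine tendsto_integral_of_dominated_convergence _ hmeas hdom
      (fun n => ae_of_all _ fun x => hbd' n x) ?_
    filter_upwards [haeΩ] with x hx
    have h1 := (hΨ'.tendsto _).comp (tendsto_const_nhds (x := x) |>.prodMk_nhds (hgt x hx))
    exact (((ContinuousLinearMap.apply ℝ ℝ (e, H x)).continuous.tendsto _).comp h1).mul_const _
  have lim3 : Tendsto (fun n => (∫ x in Ω, pd i (fun x => Ψ (x, g n x)) x * φ x) -
      ∫ x in Ω, fderiv ℝ Ψ (x, g n x) (e, H x) * φ x) atTop (𝓝 0) := by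
    have hL := (tendsto_mollify hbt hHi').const_mul (|C₁| * M₀)
    rw [mul_zero] at hL
    refine squeeze_zero_norm' ?_ hL
    filter_upwards [hev] with n hn
    have iA : Integrable (fun x => fderiv ℝ Ψ (x, g n x) (e, H x) * φ x) (volume.restrict Ω) :=
      hdom.mono' (hmeas n) (ae_of_all _ fun x => hbd' n x)
    have iF : Integrable (fun x => pd i (fun x => Ψ (x, g n x)) x * φ x) (volume.restrict Ω) :=
      (integrable_mul_of_tsupport_subset hΩ
        (((hFs n).continuous_fderiv (by simp)).clm_apply continuous_const).continuousOn
        hφ.continuous hφ.compact hφ.subset).restrict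
    have iD : Integrable (fun x => ‖k n x - Ω.indicator H x‖) :=
      ((integrable_mollify (b n) hHi').sub hHi').norm
    rw [← integral_sub iF iA]
    have h1 := norm_integral_le_of_norm_le (μ := volume.restrict Ω)
      (f := fun x => pd i (fun x => Ψ (x, g n x)) x * φ x -
        fderiv ℝ Ψ (x, g n x) (e, H x) * φ x) (iD.restrict.const_mul (|C₁| * M₀)) (by
        filter_upwards [haeΩ] with x hx
        by_cases hxφ : x ∈ tsupport φ
        · have hball : Metric.closedBall x (b n).rOut ⊆ Ω := fun y hy =>
            hδΩ (Metric.mem_cthickening_of_dist_le y x δ _ hxφ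
              ((Metric.mem_closedBall.1 hy).trans hn.le))
          rw [hFpd, fderiv_mollify hΩ (b n) hGi hw hball, ← sub_mul, ← map_sub, Prod.mk_sub_mk,
            sub_self]
          refine (hbd n x _).trans (le_of_eq ?_)
          rw [Prod.norm_mk, norm_zero, max_eq_right (norm_nonneg _), indicator_of_mem hx]
          ring
        · rw [image_eq_zero_of_notMem_tsupport hxφ]
          simp only [mul_zero, sub_zero, norm_zero]
          positivity)
    refine h1.trans ?_
    rw [integral_const_mul]
    exact mul_le_mul_of_nonneg_left (setIntegral_le_integral iD
      (ae_of_all _ fun x => norm_nonneg _)) (by positivity)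
  have lim4 := lim3.add lim2
  simp only [sub_add_cancel, zero_add] at lim4
  simp only [hparts] at lim1
  exact tendsto_nhds_unique lim1 lim4.neg

end

/-! ### Integration by parts and the energy estimate -/

section

variable {N : ℕ} {Ω : Set (E N)}

/-- The `j`-th column `D_{x_j} ∇f` of a matrix of second derivatives. -/
noncomputable def hessCol (H : Fin N → Fin N → E N → ℝ) (j : Fin N) (x : E N) : E N :=
  WithLp.toLp 2 fun i => H i j x

/-- The squared Frobenius norm of a matrix of second derivatives. -/
noncomputable def hessNormSq (H : Fin N → Fin N → E N → ℝ) (x : E N) : ℝ :=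
  ∑ i, ∑ j, H i j x ^ 2

theorem hessNormSq_nonneg (H : Fin N → Fin N → E N → ℝ) (x : E N) : 0 ≤ hessNormSq H x :=
  Finset.sum_nonneg fun _ _ => Finset.sum_nonneg fun _ _ => sq_nonneg _

theorem norm_hessCol_le (H : Fin N → Fin N → E N → ℝ) (j : Fin N) (x : E N) :
    ‖hessCol H j x‖ ≤ √(hessNormSq H x) := by
  rw [EuclideanSpace.norm_eq]
  refine Real.sqrt_le_sqrt (Finset.sum_le_sum fun i _ => ?_)
  have := Finset.single_le_sum (f := fun j => H i j x ^ 2) (fun _ _ => sq_nonneg _)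
    (Finset.mem_univ j)
  simpa [hessCol] using this

theorem IsWeakHessian.integrable_hessNormSq {f : E N → ℝ} {H : Fin N → Fin N → E N → ℝ}
    (hH : IsWeakHessian Ω f H) : IntegrableOn (hessNormSq H) Ω :=
  integrable_finsetSum _ fun i _ => integrable_finsetSum _ fun j _ => (hH i j).1.integrable_sq

theorem IsWeakHessian.integrable_sqrt (hb : Bornology.IsBounded Ω) {f : E N → ℝ}
    {H : Fin N → Fin N → E N → ℝ} (hH : IsWeakHessian Ω f H) :
    IntegrableOn (fun x => √(hessNormSq H x)) Ω := by
  have := isFiniteMeasure_restrict hb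
  refine ((integrable_const (1 : ℝ)).add hH.integrable_hessNormSq).mono'
    (Real.continuous_sqrt.comp_aestronglyMeasurable hH.integrable_hessNormSq.1)
    (ae_of_all _ fun x => ?_)
  rw [Real.norm_eq_abs, abs_of_nonneg (Real.sqrt_nonneg _)]
  have h := Real.sq_sqrt (hessNormSq_nonneg H x)
  simp only [Pi.add_apply]
  nlinarith [sq_nonneg (√(hessNormSq H x) - 1)]

theorem IsWeakHessian.integrable_hessCol (hb : Bornology.IsBounded Ω) {f : E N → ℝ}
    {H : Fin N → Fin N → E N → ℝ} (hH : IsWeakHessian Ω f H) (j : Fin N) :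
    IntegrableOn (hessCol H j) Ω := by
  have := isFiniteMeasure_restrict hb
  have h : hessCol H j = fun x => ∑ i, H i j x • (EuclideanSpace.single i (1 : ℝ) : E N) := by
    ext x k
    simp [hessCol, Finset.sum_apply, Pi.single_apply]
  rw [h]
  exact integrable_finsetSum _ fun i _ =>
    ((hH i j).1.integrable (by norm_num)).smul_const _

/-- The gradient of `f` has the columns of the weak Hessian as its weak derivatives. -/
theorem integral_pd_smul_gradient (hΩ : IsOpen Ω) (hb : Bornology.IsBounded Ω) {f : E N → ℝ}
    (hf : MemC1 Ω f) {H : Fin N → Fin N → E N → ℝ} (hH : IsWeakHessian Ω f H) (j : Fin N)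
    {ψ : E N → ℝ} (hψ : IsTest Ω ψ) :
    ∫ x in Ω, pd j ψ x • gradient f x = -∫ x in Ω, ψ x • hessCol H j x := by
  obtain ⟨B, -, hB⟩ := hf.exists_bound hb
  obtain ⟨C, -, hC⟩ := hψ.exists_bound
  obtain ⟨C', -, hC'⟩ := (hψ.pd j).exists_bound
  have hg : IntegrableOn (gradient f) Ω :=
    integrableOn_of_bound hΩ hb hf.continuousOn_gradient fun x hx => (hB x hx).2
  have i1 : Integrable (fun x => pd j ψ x • gradient f x) (volume.restrict Ω) :=
    hg.bdd_smul C' (hψ.pd j).continuous.aestronglyMeasurable (ae_of_all _ hC')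
  have i2 : Integrable (fun x => ψ x • hessCol H j x) (volume.restrict Ω) :=
    (hH.integrable_hessCol hb j).bdd_smul C hψ.continuous.aestronglyMeasurable (ae_of_all _ hC)
  ext i
  have e1 := ((EuclideanSpace.proj (𝕜 := ℝ) i : E N →L[ℝ] ℝ)).integral_comp_comm i1
  have e2 := ((EuclideanSpace.proj (𝕜 := ℝ) i : E N →L[ℝ] ℝ)).integral_comp_comm i2
  simp only [map_smul, EuclideanSpace.coe_proj, smul_eq_mul] at e1 e2
  rw [← e1, PiLp.neg_apply, ← e2]
  have h1 := (hH i j).2 ψ hψ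
  rw [integral_mul_pd hΩ (fun x hx => hf.differentiableAt hΩ hx) i (hf.continuousOn_pd i)
    (hψ.pd j)] at h1
  have h2 : ∫ x in Ω, pd j ψ x * gradient f x i = ∫ x in Ω, pd i f x * pd j ψ x :=
    integral_congr_ae (ae_of_all _ fun x => by simp only [pd_eq_gradient f]; ring)
  have h3 : ∫ x in Ω, ψ x * hessCol H j x i = ∫ x in Ω, H i j x * ψ x :=
    integral_congr_ae (ae_of_all _ fun x => by simp only [hessCol]; ring)
  rw [h2, h3, ← h1, neg_neg]

/-- Integration by parts of `Ψ(x, ∇f)` against `f` itself. There is no boundary term, because `f`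
is a limit of test functions. -/
theorem integral_comp_gradient_mul_pd (hΩ : IsOpen Ω) (hb : Bornology.IsBounded Ω) {f : E N → ℝ}
    (hf : MemX Ω f) {H : Fin N → Fin N → E N → ℝ} (hH : IsWeakHessian Ω f H)
    {Ψ : E N × E N → ℝ} (hΨ : ContDiff ℝ 1 Ψ) (i : Fin N) :
    ∫ x in Ω, Ψ (x, gradient f x) * pd i f x =
      -∫ x in Ω, fderiv ℝ Ψ (x, gradient f x) (EuclideanSpace.single i 1, hessCol H i x) *
        f x := by
  have := isFiniteMeasure_restrict hb
  obtain ⟨B, hB0, hB⟩ := hf.memC1.exists_bound hb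
  obtain ⟨B', ψ, hψ, hψB, hψf, hψg⟩ := hf.exists_test_approx hΩ hb
  have hG := hf.memC1.continuousOn_gradient
  have hcol := hH.integrable_hessCol hb i
  have hcpt : IsCompact (closure Ω ×ˢ Metric.closedBall (0 : E N) B) :=
    hb.isCompact_closure.prod (isCompact_closedBall 0 B)
  have hΨ' : Continuous (fderiv ℝ Ψ) := hΨ.continuous_fderiv (by simp)
  obtain ⟨C₀, hC₀⟩ := hcpt.exists_bound_of_continuousOn hΨ.continuous.continuousOn
  obtain ⟨C₁, hC₁⟩ := hcpt.exists_bound_of_continuousOn hΨ'.continuousOn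
  have hmem : ∀ x ∈ Ω, ((x, gradient f x) : E N × E N) ∈
      closure Ω ×ˢ Metric.closedBall (0 : E N) B := fun x hx =>
    ⟨subset_closure hx, by simpa using (hB x hx).2⟩
  have haeΩ : ∀ᵐ x ∂(volume.restrict Ω), x ∈ Ω := ae_restrict_mem hΩ.measurableSet
  have hpair : ContinuousOn (fun x => ((x, gradient f x) : E N × E N)) Ω :=
    continuousOn_id.prodMk hG
  have hweak := fun n => weak_chain_rule hΩ hb hG hB0 (fun x hx => (hB x hx).2) hcol
    (fun φ hφ => integral_pd_smul_gradient hΩ hb hf.memC1 hH i hφ) hΨ (hψ n)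
  have hpi : IntegrableOn (pd i f) Ω := by
    refine integrableOn_of_bound hΩ hb (hf.memC1.continuousOn_pd i) (B := B) fun x hx => ?_
    rw [pd_eq_gradient]
    exact (PiLp.norm_apply_le _ i).trans (hB x hx).2
  have lim1 := tendsto_integral_mul_of_tendsto (μ := volume.restrict Ω)
    (θ := fun x => Ψ (x, gradient f x)) (C := C₀)
    (fun n => (((hψ n).pd i).memLp 1).integrable le_rfl) hpi
    ((hΨ.continuous.comp_continuousOn hpair).aestronglyMeasurable hΩ.measurableSet)
    (haeΩ.mono fun x hx => hC₀ _ (hmem x hx)) (hψg i)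
  set A : E N → ℝ := fun x =>
    fderiv ℝ Ψ (x, gradient f x) (EuclideanSpace.single i 1, hessCol H i x) with hA
  have hAm : AEStronglyMeasurable A (volume.restrict Ω) :=
    isBoundedBilinearMap_apply.continuous.comp_aestronglyMeasurable
      (((hΨ'.comp_continuousOn hpair).aestronglyMeasurable hΩ.measurableSet).prodMk
        (aestronglyMeasurable_const.prodMk hcol.1))
  have hAi : IntegrableOn A Ω := by
    refine (((integrable_const (1 : ℝ)).add hcol.norm).const_mul C₁).mono' hAm ?_
    filter_upwards [haeΩ] with x hx
    have hC := hC₁ _ (hmem x hx)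
    refine (ContinuousLinearMap.le_opNorm _ _).trans
      (mul_le_mul hC ?_ (norm_nonneg _) ((norm_nonneg _).trans hC))
    rw [Prod.norm_mk]
    refine max_le ?_ ?_
    · simp
    · simp
  have lim2 : Tendsto (fun n => ∫ x in Ω, A x * ψ n x) atTop (𝓝 (∫ x in Ω, A x * f x)) := by
    refine tendsto_integral_of_dominated_convergence (fun x => ‖A x‖ * B')
      (fun n => hAm.mul (hψ n).continuous.aestronglyMeasurable) (hAi.norm.mul_const _)
      (fun n => ae_of_all _ fun x => ?_) ?_
    · rw [norm_mul]
      exact mul_le_mul_of_nonneg_left (hψB n x) (norm_nonneg _)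
    · filter_upwards [hψf] with x hx
      exact hx.const_mul _
  have e1 : ∀ n, ∫ x in Ω, pd i (ψ n) x * Ψ (x, gradient f x) = -∫ x in Ω, A x * ψ n x :=
    fun n => by rw [← hweak n]; simp only [mul_comm]
  simp only [e1] at lim1
  rw [← tendsto_nhds_unique lim1 lim2.neg]
  simp only [mul_comm]

/-- The bracket `⟨v⟩ = (1 + |v|²)^{1/2}`. -/
noncomputable def bracket {V : Type*} [Norm V] (v : V) : ℝ := √(1 + ‖v‖ ^ 2)

section bracket

variable {V : Type*} [NormedAddCommGroup V]

theorem bracket_sq (v : V) : bracket v ^ 2 = 1 + ‖v‖ ^ 2 := Real.sq_sqrt (by positivity)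

theorem one_le_bracket (v : V) : 1 ≤ bracket v := by
  rw [bracket, Real.one_le_sqrt]; nlinarith [sq_nonneg ‖v‖]

theorem bracket_pos (v : V) : 0 < bracket v := one_pos.trans_le (one_le_bracket v)

theorem norm_le_bracket (v : V) : ‖v‖ ≤ bracket v :=
  Real.le_sqrt_of_sq_le (by linarith)

theorem continuous_bracket : Continuous (bracket : V → ℝ) := by
  unfold bracket; fun_prop

theorem contDiff_bracket {V : Type*} [NormedAddCommGroup V] [InnerProductSpace ℝ V] {n : ℕ∞ω} :
    ContDiff ℝ n (bracket : V → ℝ) := by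
  unfold bracket
  exact (contDiff_const.add (contDiff_norm_sq ℝ)).sqrt fun x => by positivity

end bracket

/-- The components of the field `η(|ξ|² - 1) ⟨ξ⟩^{m(x)-2} ξ`, where `η` is a smooth transition. The
field vanishes for `|ξ| ≤ 1`, where the weight of the second derivatives degenerates. -/
noncomputable def truncField (m : E N → ℝ) (i : Fin N) (z : E N × E N) : ℝ :=
  Real.smoothTransition (‖z.2‖ ^ 2 - 1) * bracket z.2 ^ (m z.1 - 2) * z.2 i

theorem contDiff_truncField {m : E N → ℝ} (hm : ContDiff ℝ 1 m) (i : Fin N) :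
    ContDiff ℝ 1 (truncField m i) := by
  unfold truncField
  have h1 : ContDiff ℝ 1 fun z : E N × E N => Real.smoothTransition (‖z.2‖ ^ 2 - 1) :=
    Real.smoothTransition.contDiff.comp
      (((contDiff_norm_sq ℝ).comp contDiff_snd).sub contDiff_const)
  have h2 : ContDiff ℝ 1 fun z : E N × E N => bracket z.2 ^ (m z.1 - 2) :=
    (contDiff_bracket.comp contDiff_snd).rpow ((hm.comp contDiff_fst).sub contDiff_const)
      fun z => (bracket_pos z.2).ne'
  exact (h1.mul h2).mul ((EuclideanSpace.proj (𝕜 := ℝ) i).contDiff.comp contDiff_snd)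

theorem deriv_smoothTransition_of_nonpos {y : ℝ} (hy : y ≤ 0) :
    deriv Real.smoothTransition y = 0 := by
  refine IsLocalMin.deriv_eq_zero (Eventually.of_forall fun z => ?_)
  rw [Real.smoothTransition.zero_of_nonpos hy]
  exact Real.smoothTransition.nonneg z

theorem deriv_smoothTransition_of_one_le {y : ℝ} (hy : 1 ≤ y) :
    deriv Real.smoothTransition y = 0 := by
  refine IsLocalMax.deriv_eq_zero (Eventually.of_forall fun z => ?_)
  rw [Real.smoothTransition.one_of_one_le hy]
  exact Real.smoothTransition.le_one z

theorem exists_bound_deriv_smoothTransition :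
    ∃ C, 0 ≤ C ∧ ∀ y, |deriv Real.smoothTransition y| ≤ C := by
  have hc : Continuous (deriv Real.smoothTransition) :=
    (Real.smoothTransition.contDiff (n := 1)).continuous_deriv le_rfl
  obtain ⟨C, hC⟩ := (isCompact_Icc (a := (0 : ℝ)) (b := 1)).exists_bound_of_continuousOn
    hc.continuousOn
  refine ⟨|C|, abs_nonneg _, fun y => ?_⟩
  rcases le_total y 0 with h | h
  · simp [deriv_smoothTransition_of_nonpos h]
  rcases le_total 1 y with h' | h'
  · simp [deriv_smoothTransition_of_one_le h']
  · exact (hC y ⟨h, h'⟩).trans (le_abs_self _)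

theorem fderiv_truncField {m : E N → ℝ} (hm : ContDiff ℝ 1 m) (i : Fin N) (x ξ e h : E N) :
    fderiv ℝ (truncField m i) (x, ξ) (e, h) =
      (deriv Real.smoothTransition (‖ξ‖ ^ 2 - 1) * (2 * inner ℝ ξ h) * bracket ξ ^ (m x - 2) +
        Real.smoothTransition (‖ξ‖ ^ 2 - 1) *
          (inner ℝ ξ h / bracket ξ * (m x - 2) * bracket ξ ^ (m x - 2 - 1) +
            fderiv ℝ m x e * bracket ξ ^ (m x - 2) * Real.log (bracket ξ))) * ξ i +
      Real.smoothTransition (‖ξ‖ ^ 2 - 1) * bracket ξ ^ (m x - 2) * h i := by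
  have hline : HasDerivAt (fun t : ℝ => ((x, ξ) : E N × E N) + t • (e, h)) (e, h) 0 := by
    simpa using ((hasDerivAt_id (0 : ℝ)).smul_const ((e, h) : E N × E N)).const_add (x, ξ)
  have hx : HasDerivAt (fun t : ℝ => x + t • e) e 0 := by
    simpa using ((hasDerivAt_id (0 : ℝ)).smul_const e).const_add x
  have hξ : HasDerivAt (fun t : ℝ => ξ + t • h) h 0 := by
    simpa using ((hasDerivAt_id (0 : ℝ)).smul_const h).const_add ξ
  have hcomp := ((contDiff_truncField hm i).differentiable (by simp)
    ((x, ξ) + (0 : ℝ) • (e, h))).hasFDerivAt.comp_hasDerivAt 0 hline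
  have hn : HasDerivAt (fun t : ℝ => ‖ξ + t • h‖ ^ 2) (2 * inner ℝ ξ h) 0 := by
    simpa using hξ.norm_sq
  have hη : HasDerivAt (fun t : ℝ => Real.smoothTransition (‖ξ + t • h‖ ^ 2 - 1))
      (deriv Real.smoothTransition (‖ξ‖ ^ 2 - 1) * (2 * inner ℝ ξ h)) 0 := by
    have h1 : HasDerivAt Real.smoothTransition
        (deriv Real.smoothTransition (‖ξ + (0 : ℝ) • h‖ ^ 2 - 1)) (‖ξ + (0 : ℝ) • h‖ ^ 2 - 1) :=
      ((Real.smoothTransition.contDiff (n := 1)).differentiable (by simp) _).hasDerivAt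
    have h2 := h1.comp (0 : ℝ) (hn.sub_const 1)
    simp only [zero_smul, add_zero] at h2
    exact h2
  have hY : HasDerivAt (fun t : ℝ => bracket (ξ + t • h)) (inner ℝ ξ h / bracket ξ) 0 := by
    have h1 := (hn.const_add 1).sqrt (by positivity)
    have h2 : (2 * inner ℝ ξ h) / (2 * √(1 + ‖ξ + (0 : ℝ) • h‖ ^ 2)) =
        inner ℝ ξ h / bracket ξ := by
      rw [mul_div_mul_left _ _ two_ne_zero]; simp [bracket]
    rw [h2] at h1
    exact h1
  have hk : HasDerivAt (fun t : ℝ => m (x + t • e) - 2) (fderiv ℝ m x e) 0 := by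
    have h1 := (hm.differentiable (by simp) (x + (0 : ℝ) • e)).hasFDerivAt.comp_hasDerivAt
      0 hx
    simpa using h1.sub_const 2
  have hp := hY.rpow hk (bracket_pos _)
  have hi : HasDerivAt (fun t : ℝ => (ξ + t • h) i) (h i) 0 :=
    (EuclideanSpace.proj (𝕜 := ℝ) i : E N →L[ℝ] ℝ).hasFDerivAt.comp_hasDerivAt 0 hξ
  have hall := ((hη.mul hp).mul hi).unique hcomp
  simp only [zero_smul, add_zero, Pi.mul_apply] at hall
  rw [← hall]

/-- The derivative of the truncated field grows like `⟨ξ⟩^{m-2}` in `ξ`, and like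
`⟨ξ⟩^{m-1} log ⟨ξ⟩` in the variable `x` of the exponent. -/
theorem exists_bound_fderiv_truncField (K : ℝ) : ∃ C, 0 ≤ C ∧ ∀ {N : ℕ} {m : E N → ℝ},
    ContDiff ℝ 1 m → ∀ (i : Fin N) (x ξ e h : E N), |m x - 2| ≤ K →
    (‖ξ‖ ≤ 1 → fderiv ℝ (truncField m i) (x, ξ) (e, h) = 0) ∧
    |fderiv ℝ (truncField m i) (x, ξ) (e, h)| ≤ C * (bracket ξ ^ (m x - 2) * ‖h‖ +
      ‖fderiv ℝ m x‖ * ‖e‖ * (bracket ξ ^ (m x - 1) * Real.log (bracket ξ))) := by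
  obtain ⟨D, hD0, hD⟩ := exists_bound_deriv_smoothTransition
  refine ⟨4 * D + |K| + 1, by positivity, fun {N m} hm i x ξ e h hK => ?_⟩
  rw [fderiv_truncField hm]
  set Y := bracket ξ with hY
  have hY1 : 1 ≤ Y := one_le_bracket ξ
  have hY0 : 0 < Y := bracket_pos ξ
  constructor
  · intro hξ
    have h0 : ‖ξ‖ ^ 2 - 1 ≤ 0 := by nlinarith [norm_nonneg ξ]
    rw [deriv_smoothTransition_of_nonpos h0, Real.smoothTransition.zero_of_nonpos h0]
    ring
  · set k := m x - 2 with hk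
    have hYk : 0 < Y ^ k := Real.rpow_pos_of_pos hY0 _
    have hlog : 0 ≤ Real.log Y := Real.log_nonneg hY1
    have hin : |inner ℝ ξ h| ≤ ‖ξ‖ * ‖h‖ := abs_real_inner_le_norm ξ h
    have hξi : |ξ i| ≤ ‖ξ‖ := PiLp.norm_apply_le ξ i
    have hhi : |h i| ≤ ‖h‖ := PiLp.norm_apply_le h i
    have hξY : ‖ξ‖ ≤ Y := norm_le_bracket ξ
    have hη0 := Real.smoothTransition.nonneg (‖ξ‖ ^ 2 - 1)
    have hη1 := Real.smoothTransition.le_one (‖ξ‖ ^ 2 - 1)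
    set η := Real.smoothTransition (‖ξ‖ ^ 2 - 1)
    have t1 : |deriv Real.smoothTransition (‖ξ‖ ^ 2 - 1) * (2 * inner ℝ ξ h) * Y ^ k * ξ i| ≤
        4 * D * (Y ^ k * ‖h‖) := by
      rcases le_total 1 (‖ξ‖ ^ 2 - 1) with h1 | h1
      · rw [deriv_smoothTransition_of_one_le h1]
        simp only [zero_mul, abs_zero]
        positivity
      · rw [abs_mul, abs_mul, abs_mul, abs_mul, abs_two, abs_of_pos hYk]
        calc |deriv Real.smoothTransition (‖ξ‖ ^ 2 - 1)| * (2 * |inner ℝ ξ h|) * Y ^ k * |ξ i|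
            ≤ D * (2 * (‖ξ‖ * ‖h‖)) * Y ^ k * ‖ξ‖ := by gcongr; exact hD _
          _ = 2 * D * ‖ξ‖ ^ 2 * (Y ^ k * ‖h‖) := by ring
          _ ≤ 2 * D * 2 * (Y ^ k * ‖h‖) := by gcongr; linarith
          _ = _ := by ring
    have t2 : |η * (inner ℝ ξ h / Y * k * Y ^ (k - 1)) * ξ i| ≤ |K| * (Y ^ k * ‖h‖) := by
      rw [abs_mul, abs_mul, abs_mul, abs_mul, abs_div, abs_of_pos hY0, abs_of_nonneg hη0,
        abs_of_pos (Real.rpow_pos_of_pos hY0 _)]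
      calc η * (|inner ℝ ξ h| / Y * |k| * Y ^ (k - 1)) * |ξ i|
          ≤ 1 * (Y * ‖h‖ / Y * |K| * Y ^ (k - 1)) * Y := by
            have h1 : |inner ℝ ξ h| ≤ Y * ‖h‖ := hin.trans (by gcongr)
            have h2 : |k| ≤ |K| := hK.trans (le_abs_self K)
            have h3 : |ξ i| ≤ Y := hξi.trans hξY
            have h4 : 0 ≤ Y ^ (k - 1) := (Real.rpow_pos_of_pos hY0 _).le
            refine mul_le_mul (mul_le_mul hη1 ?_ (by positivity) zero_le_one) h3
              (abs_nonneg _) (by positivity)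
            refine mul_le_mul_of_nonneg_right (mul_le_mul ?_ h2 (abs_nonneg _) (by positivity)) h4
            exact div_le_div_of_nonneg_right h1 hY0.le
        _ = |K| * (Y ^ k * ‖h‖) := by
            rw [Real.rpow_sub_one hY0.ne']; field_simp
    have t3 : |η * (fderiv ℝ m x e * Y ^ k * Real.log Y) * ξ i| ≤
        ‖fderiv ℝ m x‖ * ‖e‖ * (Y ^ (m x - 1) * Real.log Y) := by
      rw [abs_mul, abs_mul, abs_mul, abs_mul, abs_of_nonneg hη0, abs_of_pos hYk,
        abs_of_nonneg hlog]
      have hm1 : Y ^ (m x - 1) = Y ^ k * Y := by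
        rw [← Real.rpow_add_one hY0.ne', hk]; congr 1; ring
      rw [hm1]
      calc η * (|fderiv ℝ m x e| * Y ^ k * Real.log Y) * |ξ i|
          ≤ 1 * (‖fderiv ℝ m x‖ * ‖e‖ * Y ^ k * Real.log Y) * Y := by
            gcongr
            · exact (fderiv ℝ m x).le_opNorm e
            · exact hξi.trans hξY
        _ = _ := by ring
    have t4 : |η * Y ^ k * h i| ≤ Y ^ k * ‖h‖ := by
      rw [abs_mul, abs_mul, abs_of_nonneg hη0, abs_of_pos hYk]
      calc η * Y ^ k * |h i| ≤ 1 * Y ^ k * ‖h‖ := by gcongr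
        _ = _ := by ring
    have hR : 0 ≤ ‖fderiv ℝ m x‖ * ‖e‖ * (Y ^ (m x - 1) * Real.log Y) := by positivity
    have hsum : ∀ A B C D' : ℝ, |A + B + C + D'| ≤ |A| + |B| + |C| + |D'| := fun A B C D' =>
      (abs_add_le _ _).trans (add_le_add_left ((abs_add_le _ _).trans
        (add_le_add_left (abs_add_le _ _) _)) _)
    have e1 : (deriv Real.smoothTransition (‖ξ‖ ^ 2 - 1) * (2 * inner ℝ ξ h) * Y ^ k +
        η * (inner ℝ ξ h / Y * k * Y ^ (k - 1) + fderiv ℝ m x e * Y ^ k * Real.log Y)) * ξ i +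
        η * Y ^ k * h i =
        deriv Real.smoothTransition (‖ξ‖ ^ 2 - 1) * (2 * inner ℝ ξ h) * Y ^ k * ξ i +
        η * (inner ℝ ξ h / Y * k * Y ^ (k - 1)) * ξ i +
        η * (fderiv ℝ m x e * Y ^ k * Real.log Y) * ξ i + η * Y ^ k * h i := by ring
    rw [e1]
    refine (hsum _ _ _ _).trans ?_
    have : 0 ≤ (4 * D + |K|) * (‖fderiv ℝ m x‖ * ‖e‖ * (Y ^ (m x - 1) * Real.log Y)) := by
      positivity
    linarith

/-- Functions of `x`, `f x` and `∇f x` are bounded for `f ∈ C¹(closure Ω)`. -/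
theorem MemC1.comp_bound (hb : Bornology.IsBounded Ω) {f : E N → ℝ}
    (hf : MemC1 Ω f) {Φ : E N × ℝ × E N → ℝ} (hΦ : Continuous Φ) :
    ContinuousOn (fun x => Φ (x, f x, gradient f x)) Ω ∧
      ∃ C, ∀ x ∈ Ω, ‖Φ (x, f x, gradient f x)‖ ≤ C := by
  obtain ⟨B, -, hB⟩ := hf.exists_bound hb
  have hcpt : IsCompact (closure Ω ×ˢ Metric.closedBall (0 : ℝ) B ×ˢ
      Metric.closedBall (0 : E N) B) :=
    hb.isCompact_closure.prod ((isCompact_closedBall 0 B).prod (isCompact_closedBall 0 B))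
  obtain ⟨C, hC⟩ := hcpt.exists_bound_of_continuousOn hΦ.continuousOn
  refine ⟨hΦ.comp_continuousOn (continuousOn_id.prodMk
    ((hf.continuousOn.mono subset_closure).prodMk hf.continuousOn_gradient)), C, fun x hx => ?_⟩
  refine hC _ ⟨subset_closure hx, ?_, ?_⟩
  · simpa using (hB x hx).1
  · simpa using (hB x hx).2

theorem MemC1.integrableOn_comp (hΩ : IsOpen Ω) (hb : Bornology.IsBounded Ω) {f : E N → ℝ}
    (hf : MemC1 Ω f) {Φ : E N × ℝ × E N → ℝ} (hΦ : Continuous Φ) :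
    IntegrableOn (fun x => Φ (x, f x, gradient f x)) Ω := by
  obtain ⟨h, C, hC⟩ := hf.comp_bound hb hΦ
  exact integrableOn_of_bound hΩ hb h hC

theorem MemC1.integrableOn_comp_mul (hΩ : IsOpen Ω) (hb : Bornology.IsBounded Ω) {f : E N → ℝ}
    (hf : MemC1 Ω f) {Φ : E N × ℝ × E N → ℝ} (hΦ : Continuous Φ) {k : E N → ℝ}
    (hk : IntegrableOn k Ω) : IntegrableOn (fun x => Φ (x, f x, gradient f x) * k x) Ω := by
  obtain ⟨h, C, hC⟩ := hf.comp_bound hb hΦ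
  exact Integrable.bdd_mul (c := C) hk (h.aestronglyMeasurable hΩ.measurableSet)
    ((ae_restrict_iff' hΩ.measurableSet).2 (ae_of_all _ hC))

theorem MemC1.nullMeasurableSet_gradient (hΩ : IsOpen Ω) {f : E N → ℝ} (hf : MemC1 Ω f) :
    NullMeasurableSet {x | 1 < ‖gradient f x‖} (volume.restrict Ω) := by
  have h : AEMeasurable (fun x => ‖gradient f x‖) (volume.restrict Ω) :=
    (hf.continuousOn_gradient.norm.aestronglyMeasurable hΩ.measurableSet).aemeasurable
  exact nullMeasurableSet_lt aemeasurable_const h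

theorem continuous_bracket_rpow {V : Type*} [NormedAddCommGroup V] {m : E N → ℝ}
    (hm : Continuous m) (c : ℝ) :
    Continuous fun z : E N × V => bracket z.2 ^ (m z.1 + c) :=
  (continuous_bracket.comp continuous_snd).rpow
    ((hm.comp continuous_fst).add continuous_const) fun z => Or.inl (bracket_pos z.2).ne'

theorem continuous_log_bracket {V : Type*} [NormedAddCommGroup V] :
    Continuous fun v : V => Real.log (bracket v) :=
  continuous_bracket.log fun v => (bracket_pos v).ne'

theorem bracket_rpow_le_add {ξ : E N} {k K : ℝ} (hk : |k - 2| ≤ K) :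
    bracket ξ ^ k ≤ 3 ^ (K + 2) +
      2 * (Real.smoothTransition (‖ξ‖ ^ 2 - 1) * bracket ξ ^ (k - 2) * ‖ξ‖ ^ 2) := by
  have hY1 := one_le_bracket ξ
  have hY0 := bracket_pos ξ
  have hsq := bracket_sq ξ
  have hk2 : bracket ξ ^ k = bracket ξ ^ (k - 2) * bracket ξ ^ 2 := by
    rw [← Real.rpow_add_natCast hY0.ne']; congr 1; push_cast; ring
  have hYk : 0 < bracket ξ ^ (k - 2) := Real.rpow_pos_of_pos hY0 _
  rcases le_total 2 (‖ξ‖ ^ 2) with h | h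
  · rw [Real.smoothTransition.one_of_one_le (by linarith), hk2, hsq]
    have : (0 : ℝ) ≤ 3 ^ (K + 2) := by positivity
    nlinarith
  · have h3 : bracket ξ ≤ 3 := by nlinarith
    have h1 : bracket ξ ^ k ≤ 3 ^ (K + 2) :=
      (Real.rpow_le_rpow_of_exponent_le hY1 (by linarith [(abs_le.1 hk).2])).trans
        (Real.rpow_le_rpow hY0.le h3 (by linarith [abs_nonneg (k - 2)]))
    have := Real.smoothTransition.nonneg (‖ξ‖ ^ 2 - 1)
    have : 0 ≤ Real.smoothTransition (‖ξ‖ ^ 2 - 1) * bracket ξ ^ (k - 2) * ‖ξ‖ ^ 2 := by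
      positivity
    linarith

/-- The energy estimate obtained by testing with the truncated field: no second derivatives
enter at the points where `|∇f| ≤ 1`. -/
theorem exists_energy_estimate (N : ℕ) (K L : ℝ) : ∃ C, 0 ≤ C ∧ ∀ {Ω : Set (E N)}, IsOpen Ω →
    Bornology.IsBounded Ω → ∀ {m : E N → ℝ}, ContDiff ℝ 1 m → (∀ x ∈ Ω, |m x - 2| ≤ K) →
    (∀ x ∈ Ω, ‖fderiv ℝ m x‖ ≤ L) → ∀ {f : E N → ℝ} {H : Fin N → Fin N → E N → ℝ},
    MemX Ω f → IsWeakHessian Ω f H →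
    ∫ x in Ω, bracket (gradient f x) ^ m x ≤ C * volume.real Ω + C * ∫ x in Ω, |f x| *
      ({x | 1 < ‖gradient f x‖}.indicator
          (fun x => bracket (gradient f x) ^ (m x - 2) * √(hessNormSq H x)) x +
        bracket (gradient f x) ^ (m x - 1) * Real.log (bracket (gradient f x))) := by
  obtain ⟨C, hC0, hC⟩ := exists_bound_fderiv_truncField K
  refine ⟨3 ^ (K + 2) + 2 * (N * (C * (1 + |L|))), by positivity, ?_⟩
  intro Ω hΩ hb m hm hK hL f H hf hH
  have := isFiniteMeasure_restrict hb
  have haeΩ : ∀ᵐ x ∂(volume.restrict Ω), x ∈ Ω := ae_restrict_mem hΩ.measurableSet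
  have hmc := hm.continuous
  set Y : E N → ℝ := fun x => bracket (gradient f x) with hY
  set R : E N → ℝ := fun x => |f x| * ({x | 1 < ‖gradient f x‖}.indicator
    (fun x => Y x ^ (m x - 2) * √(hessNormSq H x)) x + Y x ^ (m x - 1) * Real.log (Y x)) with hR
  have hR0 : ∀ x, 0 ≤ R x := fun x => by
    have h1 : 0 ≤ Real.log (Y x) := Real.log_nonneg (one_le_bracket _)
    have h2 : 0 ≤ Y x ^ (m x - 1) := (Real.rpow_pos_of_pos (bracket_pos _) _).le
    refine mul_nonneg (abs_nonneg _) (add_nonneg (indicator_nonneg (fun y _ => ?_) _)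
      (mul_nonneg h2 h1))
    exact mul_nonneg (Real.rpow_pos_of_pos (bracket_pos _) _).le (Real.sqrt_nonneg _)
  have hRi : IntegrableOn R Ω := by
    have c1 : Continuous fun z : E N × ℝ × E N => |z.2.1| * bracket z.2.2 ^ (m z.1 + -2) :=
      (continuous_abs.comp (continuous_fst.comp continuous_snd)).mul
        ((continuous_bracket_rpow hmc (-2)).comp
          (continuous_fst.prodMk (continuous_snd.comp continuous_snd)))
    have c2 : Continuous fun z : E N × ℝ × E N =>
        |z.2.1| * (bracket z.2.2 ^ (m z.1 + -1) * Real.log (bracket z.2.2)) :=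
      (continuous_abs.comp (continuous_fst.comp continuous_snd)).mul
        (((continuous_bracket_rpow hmc (-1)).comp
          (continuous_fst.prodMk (continuous_snd.comp continuous_snd))).mul
          (continuous_log_bracket.comp (continuous_snd.comp continuous_snd)))
    have i1 := (hf.memC1.integrableOn_comp_mul hΩ hb c1 (hH.integrable_sqrt hb)).indicator₀
      (hf.memC1.nullMeasurableSet_gradient hΩ)
    have i2 := hf.memC1.integrableOn_comp hΩ hb c2
    refine (Integrable.add i1 i2).congr (ae_of_all _ fun x => ?_)
    simp only [hR, hY, Pi.add_apply, ← sub_eq_add_neg, mul_add]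
    by_cases hx : x ∈ {x | 1 < ‖gradient f x‖}
    · rw [indicator_of_mem hx, indicator_of_mem hx]; ring
    · rw [indicator_of_notMem hx, indicator_of_notMem hx]; ring
  have hΨc := fun i : Fin N => contDiff_truncField hm i
  have iΨ : ∀ i, IntegrableOn (fun x => truncField m i (x, gradient f x) * pd i f x) Ω := by
    intro i
    have c : Continuous fun z : E N × ℝ × E N => truncField m i (z.1, z.2.2) * z.2.2 i :=
      ((hΨc i).continuous.comp
        (continuous_fst.prodMk (continuous_snd.comp continuous_snd))).mul
        ((EuclideanSpace.proj (𝕜 := ℝ) i).continuous.comp (continuous_snd.comp continuous_snd))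
    simpa only [pd_eq_gradient] using hf.memC1.integrableOn_comp hΩ hb c
  have hpt : ∀ i, ∫ x in Ω, truncField m i (x, gradient f x) * pd i f x ≤
      C * (1 + |L|) * ∫ x in Ω, R x := by
    intro i
    rw [integral_comp_gradient_mul_pd hΩ hb hf hH (hΨc i) i, ← integral_const_mul,
      ← integral_neg]
    refine (Real.le_norm_self _).trans (norm_integral_le_of_norm_le (hRi.const_mul _) ?_)
    filter_upwards [haeΩ] with x hx
    obtain ⟨hz, hbd⟩ := hC hm i x (gradient f x) (EuclideanSpace.single i 1) (hessCol H i x)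
      (hK x hx)
    rw [norm_neg, norm_mul, Real.norm_eq_abs, Real.norm_eq_abs]
    by_cases h1 : 1 < ‖gradient f x‖
    · have hmem : x ∈ {x | 1 < ‖gradient f x‖} := h1
      simp only [hR]
      rw [indicator_of_mem hmem]
      have p1 : 0 ≤ Y x ^ (m x - 2) := (Real.rpow_pos_of_pos (bracket_pos _) _).le
      have p2 : 0 ≤ Y x ^ (m x - 1) * Real.log (Y x) := mul_nonneg
        (Real.rpow_pos_of_pos (bracket_pos _) _).le (Real.log_nonneg (one_le_bracket _))
      have p3 := norm_hessCol_le H i x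
      have p4 : ‖fderiv ℝ m x‖ ≤ |L| := (hL x hx).trans (le_abs_self _)
      have he : ‖(EuclideanSpace.single i 1 : E N)‖ = 1 := by simp
      rw [he, mul_one] at hbd
      refine (mul_le_mul_of_nonneg_right hbd (abs_nonneg _)).trans ?_
      have q1 : Y x ^ (m x - 2) * ‖hessCol H i x‖ ≤
          (1 + |L|) * (Y x ^ (m x - 2) * √(hessNormSq H x)) := by
        have := mul_le_mul_of_nonneg_left p3 p1
        have : 0 ≤ |L| * (Y x ^ (m x - 2) * √(hessNormSq H x)) := by positivity
        linarith
      have q2 : ‖fderiv ℝ m x‖ * (Y x ^ (m x - 1) * Real.log (Y x)) ≤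
          (1 + |L|) * (Y x ^ (m x - 1) * Real.log (Y x)) :=
        mul_le_mul_of_nonneg_right (by linarith) p2
      calc C * (Y x ^ (m x - 2) * ‖hessCol H i x‖ +
            ‖fderiv ℝ m x‖ * (Y x ^ (m x - 1) * Real.log (Y x))) * |f x|
          ≤ C * ((1 + |L|) * (Y x ^ (m x - 2) * √(hessNormSq H x)) +
            (1 + |L|) * (Y x ^ (m x - 1) * Real.log (Y x))) * |f x| := by gcongr
        _ = _ := by ring
    · rw [hz (not_lt.1 h1), abs_zero, zero_mul]
      exact mul_nonneg (by positivity) (hR0 x)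
  have hsum : ∀ x, ∑ i, truncField m i (x, gradient f x) * pd i f x =
      Real.smoothTransition (‖gradient f x‖ ^ 2 - 1) * Y x ^ (m x - 2) *
        ‖gradient f x‖ ^ 2 := by
    intro x
    simp only [truncField, pd_eq_gradient, mul_assoc]
    rw [← Finset.mul_sum, ← Finset.mul_sum, EuclideanSpace.real_norm_sq_eq]
    simp only [hY, sq]
  have hint : ∫ x in Ω, Y x ^ m x ≤ ∫ x in Ω, (3 ^ (K + 2) +
      2 * ∑ i, truncField m i (x, gradient f x) * pd i f x) := by
    refine integral_mono_of_nonneg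
      (ae_of_all _ fun x => (Real.rpow_pos_of_pos (bracket_pos _) _).le)
      ((integrable_const _).add ((integrable_finsetSum _ fun i _ => iΨ i).const_mul 2)) ?_
    filter_upwards [haeΩ] with x hx
    simp only [hsum]
    exact bracket_rpow_le_add (hK x hx)
  refine hint.trans ?_
  rw [integral_add (integrable_const _)
    ((integrable_finsetSum _ fun i _ => iΨ i).const_mul 2), integral_const_mul,
    integral_finsetSum _ fun i _ => iΨ i, integral_const, measureReal_restrict_apply_univ,
    smul_eq_mul]
  have h1 : ∑ i, ∫ x in Ω, truncField m i (x, gradient f x) * pd i f x ≤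
      N * (C * (1 + |L|) * ∫ x in Ω, R x) := by
    refine (Finset.sum_le_sum fun i _ => hpt i).trans (le_of_eq ?_)
    simp
  have hV : 0 ≤ volume.real Ω := measureReal_nonneg
  have hIR : 0 ≤ ∫ x in Ω, R x := integral_nonneg hR0
  have a1 : 0 ≤ 2 * (N * (C * (1 + |L|))) * volume.real Ω := by positivity
  have a2 : 0 ≤ (3 : ℝ) ^ (K + 2) * ∫ x in Ω, R x := by positivity
  change volume.real Ω * 3 ^ (K + 2) +
    2 * ∑ i, ∫ x in Ω, truncField m i (x, gradient f x) * pd i f x ≤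
    (3 ^ (K + 2) + 2 * (N * (C * (1 + |L|)))) * volume.real Ω +
      (3 ^ (K + 2) + 2 * (N * (C * (1 + |L|)))) * ∫ x in Ω, R x
  nlinarith

end

/-! ### Sobolev and Gagliardo–Nirenberg inequalities with variable exponents -/

section

variable {N : ℕ} {Ω : Set (E N)}

theorem norm_le_sum_abs (v : E N) : ‖v‖ ≤ ∑ i, |v i| := by
  have h : v = ∑ i, v i • (EuclideanSpace.single i (1 : ℝ) : E N) := by
    ext k
    simp [Pi.single_apply]
  calc ‖v‖ = ‖∑ i, v i • (EuclideanSpace.single i (1 : ℝ) : E N)‖ := by rw [← h]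
    _ ≤ ∑ i, ‖v i • (EuclideanSpace.single i (1 : ℝ) : E N)‖ := norm_sum_le _ _
    _ = ∑ i, |v i| := by simp [norm_smul]

theorem hasDerivAt_bracket (τ : ℝ) : HasDerivAt (bracket : ℝ → ℝ) (τ / bracket τ) τ := by
  have h1 : HasDerivAt (fun s : ℝ => 1 + ‖s‖ ^ 2) (2 * τ) τ := by
    simpa using (hasDerivAt_pow 2 τ).const_add 1
  have h2 := h1.sqrt (by positivity)
  rw [mul_div_mul_left _ _ two_ne_zero] at h2
  exact h2

/-- The gradient of `⟨ψ⟩^γ - 1` for a variable exponent `γ`. -/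
theorem norm_fderiv_bracket_rpow_le {γ ψ : E N → ℝ} {x : E N} (hγ : DifferentiableAt ℝ γ x)
    (hψ : DifferentiableAt ℝ ψ x) :
    ‖fderiv ℝ (fun y => bracket (ψ y) ^ γ y - 1) x‖ ≤
      ‖fderiv ℝ γ x‖ * (bracket (ψ x) ^ γ x * Real.log (bracket (ψ x))) +
        |γ x| * bracket (ψ x) ^ (γ x - 1) * ‖fderiv ℝ ψ x‖ := by
  have hX0 := bracket_pos (ψ x)
  have h1 := (hasDerivAt_bracket (ψ x)).comp_hasFDerivAt x hψ.hasFDerivAt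
  have h2 := (h1.rpow hγ.hasFDerivAt hX0).sub_const 1
  have h3 : fderiv ℝ (fun y => bracket (ψ y) ^ γ y - 1) x = _ := h2.fderiv
  rw [h3, add_comm]
  refine (norm_add_le _ _).trans (add_le_add ?_ ?_)
  · rw [norm_smul, Real.norm_eq_abs, Function.comp, abs_of_nonneg, mul_comm]
    exact mul_nonneg (Real.rpow_pos_of_pos hX0 _).le (Real.log_nonneg (one_le_bracket _))
  · rw [norm_smul, norm_smul, Real.norm_eq_abs, Real.norm_eq_abs, Function.comp, abs_mul,
      abs_of_pos (Real.rpow_pos_of_pos hX0 _), abs_div, abs_of_pos hX0]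
    refine mul_le_mul_of_nonneg_left ?_ (by positivity)
    refine mul_le_of_le_one_left (norm_nonneg _) ?_
    rw [div_le_one hX0]
    exact norm_le_bracket (ψ x)

/-- The Sobolev inequality for `⟨f⟩^γ - 1` with a variable exponent `γ`. -/
theorem exists_eLpNorm_bracket_le {N : ℕ} {p : NNReal}
    (hp : NNReal.HolderConjugate (N : NNReal) p) :
    ∃ C, 0 ≤ C ∧ ∀ {Ω : Set (E N)}, IsOpen Ω → Bornology.IsBounded Ω → ∀ {γ : E N → ℝ},
    ContDiff ℝ 1 γ → (∀ x ∈ Ω, 0 ≤ γ x) → ∀ {f : E N → ℝ}, MemX Ω f →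
    eLpNorm (fun x => bracket (f x) ^ γ x - 1) p (volume.restrict Ω) ≤
      ENNReal.ofReal (C * ∫ x in Ω,
        (‖fderiv ℝ γ x‖ * (bracket (f x) ^ γ x * Real.log (bracket (f x))) +
          γ x * bracket (f x) ^ (γ x - 1) * bracket (gradient f x))) := by
  set C := eLpNormLESNormFDerivOneConst (volume : Measure (E N)) p with hC
  refine ⟨C, C.coe_nonneg, ?_⟩
  intro Ω hΩ hb γ hγ hγ0 f hf
  have := isFiniteMeasure_restrict hb
  have haeΩ : ∀ᵐ x ∂(volume.restrict Ω), x ∈ Ω := ae_restrict_mem hΩ.measurableSet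
  obtain ⟨B, hB0, hB⟩ := hf.memC1.exists_bound hb
  obtain ⟨B', ψ, hψ, hψB, hψf, hψg⟩ := hf.exists_test_approx hΩ hb
  have hγc := hγ.continuous
  set Φ₁ : E N × ℝ × E N → ℝ := fun z =>
    ‖fderiv ℝ γ z.1‖ * (bracket z.2.1 ^ (γ z.1 + 0) * Real.log (bracket z.2.1)) +
      γ z.1 * bracket z.2.1 ^ (γ z.1 + -1) * bracket z.2.2 with hΦ₁
  set Φ₂ : E N × ℝ → ℝ := fun z => γ z.1 * bracket z.2 ^ (γ z.1 + -1) with hΦ₂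
  have cΦ₁ : Continuous Φ₁ := by
    have c0 : Continuous fun z : E N × ℝ × E N => (z.1, z.2.1) := by fun_prop
    have c1 := (continuous_bracket_rpow (V := ℝ) hγc 0).comp c0
    have c2 := (continuous_bracket_rpow (V := ℝ) hγc (-1)).comp c0
    have c3 : Continuous fun z : E N × ℝ × E N => ‖fderiv ℝ γ z.1‖ :=
      ((hγ.continuous_fderiv (by simp)).comp continuous_fst).norm
    have c4 : Continuous fun z : E N × ℝ × E N => Real.log (bracket z.2.1) :=
      continuous_log_bracket.comp (continuous_fst.comp continuous_snd)
    have c5 : Continuous fun z : E N × ℝ × E N => bracket z.2.2 :=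
      continuous_bracket.comp (continuous_snd.comp continuous_snd)
    exact (c3.mul (c1.mul c4)).add (((hγc.comp continuous_fst).mul c2).mul c5)
  have cΦ₂ : Continuous Φ₂ := (hγc.comp continuous_fst).mul (continuous_bracket_rpow hγc (-1))
  obtain ⟨C₁, hC₁⟩ := (hb.isCompact_closure.prod ((isCompact_closedBall (0 : ℝ) B').prod
    (isCompact_closedBall (0 : E N) B))).exists_bound_of_continuousOn cΦ₁.continuousOn
  obtain ⟨C₂, hC₂⟩ := (hb.isCompact_closure.prod
    (isCompact_closedBall (0 : ℝ) B')).exists_bound_of_continuousOn cΦ₂.continuousOn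
  have hψmem : ∀ n x, ψ n x ∈ Metric.closedBall (0 : ℝ) B' := fun n x => by
    simpa using hψB n x
  have hm₁ : ∀ n, ∀ x ∈ Ω, ‖Φ₁ (x, ψ n x, gradient f x)‖ ≤ C₁ := fun n x hx =>
    hC₁ _ ⟨subset_closure hx, hψmem n x, by simpa using (hB x hx).2⟩
  have hm₂ : ∀ n, ∀ x ∈ Ω, ‖Φ₂ (x, ψ n x)‖ ≤ C₂ := fun n x hx =>
    hC₂ _ ⟨subset_closure hx, hψmem n x⟩
  set S : ℕ → E N → ℝ := fun n x => ∑ i, |pd i (ψ n) x - pd i f x| with hS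
  have hS0 : ∀ n x, 0 ≤ S n x := fun n x => Finset.sum_nonneg fun _ _ => abs_nonneg _
  have hpi : ∀ i, IntegrableOn (pd i f) Ω := fun i => by
    refine integrableOn_of_bound hΩ hb (hf.memC1.continuousOn_pd i) (B := B) fun x hx => ?_
    rw [pd_eq_gradient]
    exact (PiLp.norm_apply_le _ i).trans (hB x hx).2
  have hSi' : ∀ n i, IntegrableOn (fun x => |pd i (ψ n) x - pd i f x|) Ω := fun n i =>
    (((((hψ n).pd i).memLp 1).integrable le_rfl).sub (hpi i)).abs
  have hSi : ∀ n, IntegrableOn (S n) Ω := fun n => integrable_finsetSum _ fun i _ => hSi' n i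
  have hSt : Tendsto (fun n => ∫ x in Ω, S n x) atTop (𝓝 0) := by
    have h := tendsto_finsetSum (Finset.univ : Finset (Fin N)) fun i _ => hψg i
    rw [Finset.sum_const_zero] at h
    refine h.congr fun n => ?_
    exact (integral_finsetSum _ fun i _ => hSi' n i).symm
  have hcont₁ : ∀ n, ContinuousOn (fun x => Φ₁ (x, ψ n x, gradient f x)) Ω := fun n =>
    cΦ₁.comp_continuousOn (continuousOn_id.prodMk
      ((hψ n).continuous.continuousOn.prodMk hf.memC1.continuousOn_gradient))
  have hcont₂ : ∀ n, Continuous (fun x => Φ₂ (x, ψ n x)) := fun n =>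
    cΦ₂.comp (continuous_id.prodMk (hψ n).continuous)
  have i₁ : ∀ n, IntegrableOn (fun x => Φ₁ (x, ψ n x, gradient f x)) Ω := fun n =>
    integrableOn_of_bound hΩ hb (hcont₁ n) (hm₁ n)
  have i₂ : ∀ n, IntegrableOn (fun x => Φ₂ (x, ψ n x) * S n x) Ω := fun n =>
    (hSi n).bdd_mul (c := C₂) (hcont₂ n).aestronglyMeasurable
      (haeΩ.mono fun x hx => hm₂ n x hx)
  have t₁ : Tendsto (fun n => ∫ x in Ω, Φ₁ (x, ψ n x, gradient f x)) atTop
      (𝓝 (∫ x in Ω, Φ₁ (x, f x, gradient f x))) := by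
    refine tendsto_integral_of_dominated_convergence (fun _ => C₁)
      (fun n => (i₁ n).1) (integrable_const _) (fun n => haeΩ.mono fun x hx => hm₁ n x hx) ?_
    filter_upwards [hψf] with x hx
    exact (cΦ₁.tendsto _).comp (tendsto_const_nhds.prodMk_nhds (hx.prodMk_nhds tendsto_const_nhds))
  have t₂ : Tendsto (fun n => ∫ x in Ω, Φ₂ (x, ψ n x) * S n x) atTop (𝓝 0) := by
    have h := hSt.const_mul C₂
    rw [mul_zero] at h
    refine squeeze_zero_norm (fun n => ?_) h
    rw [← integral_const_mul]
    refine norm_integral_le_of_norm_le ((hSi n).const_mul _) (haeΩ.mono fun x hx => ?_)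
    rw [norm_mul, Real.norm_of_nonneg (hS0 n x)]
    exact mul_le_mul_of_nonneg_right (hm₂ n x hx) (hS0 n x)
  -- the inequality along the approximating sequence
  set v : ℕ → E N → ℝ := fun n x => bracket (ψ n x) ^ γ x - 1 with hv
  have hvs : ∀ n, ContDiff ℝ 1 (v n) := fun n =>
    ((contDiff_bracket.comp ((hψ n).smooth.of_le (by simp))).rpow hγ
      fun x => (bracket_pos _).ne').sub contDiff_const
  have hv0 : ∀ n, Function.support (v n) ⊆ tsupport (ψ n) := fun n x hx => by
    by_contra h
    refine hx ?_
    simp [hv, image_eq_zero_of_notMem_tsupport h, bracket]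
  have hvt : ∀ n, tsupport (v n) ⊆ tsupport (ψ n) := fun n =>
    closure_minimal (hv0 n) (isClosed_tsupport _)
  have hvc : ∀ n, HasCompactSupport (v n) := fun n =>
    HasCompactSupport.of_support_subset_isCompact (hψ n).compact (hv0 n)
  have hsob : ∀ n, eLpNorm (v n) p (volume.restrict Ω) ≤ (C : ℝ≥0∞) *
      ENNReal.ofReal (∫ x in Ω, (Φ₁ (x, ψ n x, gradient f x) + Φ₂ (x, ψ n x) * S n x)) := by
    intro n
    have hfin : NNReal.HolderConjugate ((Module.finrank ℝ (E N) : ℕ) : NNReal) p := by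
      simpa using hp
    refine ((eLpNorm_mono_measure _ Measure.restrict_le_self).trans
      (eLpNorm_le_eLpNorm_fderiv_one volume (hvs n) (hvc n) hfin)).trans ?_
    refine mul_le_mul' le_rfl ?_
    have hsupp : Function.support (fderiv ℝ (v n)) ⊆ Ω :=
      (subset_tsupport _).trans ((tsupport_fderiv_subset ℝ).trans ((hvt n).trans (hψ n).subset))
    have hres : eLpNorm (fderiv ℝ (v n)) 1 (volume.restrict Ω) = eLpNorm (fderiv ℝ (v n)) 1 volume :=
      eLpNorm_restrict_eq_of_support_subset (ε := E N →L[ℝ] ℝ) hsupp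
    rw [← hres, eLpNorm_one_eq_lintegral_enorm]
    have hnn : ∀ x ∈ Ω, ‖fderiv ℝ (v n) x‖ ≤
        Φ₁ (x, ψ n x, gradient f x) + Φ₂ (x, ψ n x) * S n x := by
      intro x hx
      refine (norm_fderiv_bracket_rpow_le (hγ.differentiable (by simp) x)
        ((hψ n).differentiable x)).trans ?_
      have hd : ‖fderiv ℝ (ψ n) x‖ ≤ bracket (gradient f x) + S n x := by
        rw [norm_fderiv_eq_norm_gradient]
        have h1 := norm_le_sum_abs (gradient (ψ n) x - gradient f x)
        simp only [PiLp.sub_apply, ← pd_eq_gradient] at h1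
        have h2 := norm_le_bracket (gradient f x)
        have h3 : ‖gradient (ψ n) x‖ ≤ ‖gradient f x‖ + ‖gradient (ψ n) x - gradient f x‖ := by
          simpa using norm_add_le (gradient f x) (gradient (ψ n) x - gradient f x)
        linarith
      have hp0 : 0 ≤ γ x * bracket (ψ n x) ^ (γ x - 1) :=
        mul_nonneg (hγ0 x hx) (Real.rpow_pos_of_pos (bracket_pos _) _).le
      simp only [hΦ₁, hΦ₂, add_zero, ← sub_eq_add_neg]
      rw [abs_of_nonneg (hγ0 x hx)]
      have := mul_le_mul_of_nonneg_left hd hp0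
      linarith
    have hint : Integrable (fun x => Φ₁ (x, ψ n x, gradient f x) + Φ₂ (x, ψ n x) * S n x)
        (volume.restrict Ω) := (i₁ n).add (i₂ n)
    rw [ofReal_integral_eq_lintegral_ofReal hint
      (haeΩ.mono fun x hx => (norm_nonneg _).trans (hnn x hx))]
    refine lintegral_mono_ae (haeΩ.mono fun x hx => ?_)
    rw [← ofReal_norm]
    exact ENNReal.ofReal_le_ofReal (hnn x hx)
  have hlim : Tendsto (fun n => (C : ℝ≥0∞) * ENNReal.ofReal
      (∫ x in Ω, (Φ₁ (x, ψ n x, gradient f x) + Φ₂ (x, ψ n x) * S n x))) atTop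
      (𝓝 ((C : ℝ≥0∞) * ENNReal.ofReal (∫ x in Ω, Φ₁ (x, f x, gradient f x)))) := by
    refine ENNReal.Tendsto.const_mul (ENNReal.tendsto_ofReal ?_) (Or.inr ENNReal.coe_ne_top)
    have h := t₁.add t₂
    rw [add_zero] at h
    refine h.congr fun n => (integral_add (i₁ n) (i₂ n)).symm
  have hfatou := Lp.eLpNorm_lim_le_liminf_eLpNorm (p := (p : ℝ≥0∞)) (μ := volume.restrict Ω)
    (f := v) (fun n => (hvs n).continuous.aestronglyMeasurable)
    (fun x => bracket (f x) ^ γ x - 1) (by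
      filter_upwards [hψf] with x hx
      have h1 := (continuous_bracket.tendsto (f x)).comp hx
      exact (h1.rpow_const (Or.inl (bracket_pos (f x)).ne')).sub_const 1)
  refine hfatou.trans ((liminf_le_liminf (Eventually.of_forall hsob)).trans ?_)
  rw [hlim.liminf_eq, ENNReal.ofReal_mul C.coe_nonneg, ENNReal.ofReal_coe_nnreal]
  simp only [hΦ₁, add_zero, ← sub_eq_add_neg]
  exact le_rfl

/-- A Gagliardo–Nirenberg inequality with variable exponents: the `L²` norm gains `2/N` in the
exponent of integrability. -/
theorem exists_gagliardo_nirenberg {N : ℕ} (hN : 2 ≤ N) :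
    ∃ C, 0 ≤ C ∧ ∀ {Ω : Set (E N)}, IsOpen Ω → Bornology.IsBounded Ω → ∀ {γ : E N → ℝ},
    ContDiff ℝ 1 γ → (∀ x ∈ Ω, 0 ≤ γ x) → ∀ {f : E N → ℝ}, MemX Ω f →
    ∫ x in Ω, bracket (f x) ^ (γ x + 2 / N) ≤ (∫ x in Ω, bracket (f x) ^ 2) +
      (∫ x in Ω, bracket (f x) ^ 2) ^ (1 / N : ℝ) * (C * ∫ x in Ω,
        (‖fderiv ℝ γ x‖ * (bracket (f x) ^ γ x * Real.log (bracket (f x))) +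
          γ x * bracket (f x) ^ (γ x - 1) * bracket (gradient f x))) := by
  have hN1 : (1 : NNReal) < N := by exact_mod_cast hN
  have hN0 : (0 : ℝ) < N := by exact_mod_cast (by omega : 0 < N)
  have hp := NNReal.HolderConjugate.conjExponent hN1
  set p := NNReal.conjExponent (N : NNReal) with hpdef
  have hpR : (N : ℝ).HolderConjugate (p : ℝ) := by exact_mod_cast hp.coe
  obtain ⟨C, hC0, hC⟩ := exists_eLpNorm_bracket_le hp
  refine ⟨C, hC0, ?_⟩
  intro Ω hΩ hb γ hγ hγ0 f hf
  have := isFiniteMeasure_restrict hb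
  have haeΩ : ∀ᵐ x ∂(volume.restrict Ω), x ∈ Ω := ae_restrict_mem hΩ.measurableSet
  have hS := hC hΩ hb hγ hγ0 hf
  set I := ∫ x in Ω, (‖fderiv ℝ γ x‖ * (bracket (f x) ^ γ x * Real.log (bracket (f x))) +
          γ x * bracket (f x) ^ (γ x - 1) * bracket (gradient f x)) with hI
  have hI0 : 0 ≤ I := by
    refine integral_nonneg_of_ae (haeΩ.mono fun x hx => ?_)
    have h1 : 0 ≤ Real.log (bracket (f x)) := Real.log_nonneg (one_le_bracket _)
    have h2 : ∀ c : ℝ, 0 ≤ bracket (f x) ^ c := fun c => (Real.rpow_pos_of_pos (bracket_pos _) _).le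
    have h3 := hγ0 x hx
    have h4 := bracket_pos (gradient f x)
    have := h2 (γ x); have := h2 (γ x - 1)
    simp only [Pi.zero_apply]
    positivity
  have c0 : Continuous fun z : E N × ℝ × E N => (z.1, z.2.1) := by fun_prop
  have bX : ∀ c : ℝ, ContinuousOn (fun x => bracket (f x) ^ c) Ω ∧
      ∃ D, ∀ x ∈ Ω, ‖bracket (f x) ^ c‖ ≤ D := fun c => by
    have hc : Continuous fun z : E N × ℝ × E N => bracket z.2.1 ^ ((0 : ℝ) + c) :=
      (continuous_bracket_rpow (V := ℝ) (m := fun _ : E N => 0) continuous_const c).comp c0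
    simpa using hf.memC1.comp_bound hb hc
  have bXg : ContinuousOn (fun x => bracket (f x) ^ γ x) Ω ∧
      ∃ D, ∀ x ∈ Ω, ‖bracket (f x) ^ γ x‖ ≤ D := by
    simpa using hf.memC1.comp_bound hb
      ((continuous_bracket_rpow (V := ℝ) hγ.continuous 0).comp c0)
  have hmem : ∀ {k : E N → ℝ} (q : ℝ≥0∞), (ContinuousOn k Ω ∧ ∃ D, ∀ x ∈ Ω, ‖k x‖ ≤ D) →
      MemLp k q (volume.restrict Ω) := fun q ⟨h1, D, hD⟩ =>
    MemLp.of_bound (h1.aestronglyMeasurable hΩ.measurableSet) D (haeΩ.mono fun x hx => hD x hx)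
  have m1 : ∀ q : ℝ≥0∞, MemLp (fun x => bracket (f x) ^ (2 / N : ℝ)) q (volume.restrict Ω) :=
    fun q => hmem q (bX _)
  have m2 : ∀ q : ℝ≥0∞, MemLp (fun x => bracket (f x) ^ γ x - 1) q (volume.restrict Ω) :=
    fun q => (hmem q bXg).sub (memLp_const 1)
  have hv0 : ∀ᵐ x ∂(volume.restrict Ω), 0 ≤ bracket (f x) ^ γ x - 1 := haeΩ.mono fun x hx =>
    sub_nonneg.2 (Real.one_le_rpow (one_le_bracket _) (hγ0 x hx))
  have hX2 : IntegrableOn (fun x => bracket (f x) ^ 2) Ω := by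
    have := (hmem 1 (bX 2)).integrable le_rfl
    simp only [Real.rpow_two] at this
    exact this
  have hh := integral_mul_le_Lp_mul_Lq_of_nonneg (μ := volume.restrict Ω) hpR
    (f := fun x => bracket (f x) ^ (2 / N : ℝ)) (g := fun x => bracket (f x) ^ γ x - 1)
    (ae_of_all _ fun x => (Real.rpow_pos_of_pos (bracket_pos _) _).le) hv0 (m1 _) (m2 _)
  have e1 : ∀ x, (bracket (f x) ^ (2 / N : ℝ)) ^ (N : ℝ) = bracket (f x) ^ 2 := fun x => by
    rw [← Real.rpow_mul (bracket_pos _).le, div_mul_cancel₀ _ hN0.ne', Real.rpow_two]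
  simp only [e1] at hh
  have hp0 : (p : ℝ≥0∞) ≠ 0 := by
    have : (0 : ℝ) < p := hpR.symm.pos
    exact_mod_cast (show (p : ℝ) ≠ 0 from this.ne')
  have e2 : (∫ x in Ω, (bracket (f x) ^ γ x - 1) ^ (p : ℝ)) ^ (1 / (p : ℝ)) ≤ C * I := by
    rw [(m2 p).eLpNorm_eq_integral_rpow_norm hp0 ENNReal.coe_ne_top] at hS
    have h := (ENNReal.ofReal_le_ofReal_iff (by positivity)).1 hS
    rw [ENNReal.coe_toReal] at h
    rw [one_div]
    refine le_trans (le_of_eq ?_) h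
    congr 1
    refine integral_congr_ae (hv0.mono fun x hx => ?_)
    simp only [Real.norm_of_nonneg hx]
  have hJ0 : 0 ≤ ∫ x in Ω, bracket (f x) ^ 2 := integral_nonneg fun x => sq_nonneg _
  have i3 : IntegrableOn (fun x => bracket (f x) ^ (2 / N : ℝ) * (bracket (f x) ^ γ x - 1)) Ω :=
    (m1 2).integrable_mul (m2 2)
  calc ∫ x in Ω, bracket (f x) ^ (γ x + 2 / N)
      ≤ ∫ x in Ω, (bracket (f x) ^ 2 +
          bracket (f x) ^ (2 / N : ℝ) * (bracket (f x) ^ γ x - 1)) := by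
        refine integral_mono_of_nonneg
          (ae_of_all _ fun x => (Real.rpow_pos_of_pos (bracket_pos _) _).le) (hX2.add i3)
          (ae_of_all _ fun x => ?_)
        simp only
        rw [Real.rpow_add (bracket_pos _)]
        have : bracket (f x) ^ (2 / N : ℝ) ≤ bracket (f x) ^ 2 := by
          rw [← Real.rpow_two]
          refine Real.rpow_le_rpow_of_exponent_le (one_le_bracket _) ?_
          rw [div_le_iff₀ hN0]
          have : (2 : ℝ) ≤ N := by exact_mod_cast hN
          linarith
        linarith
    _ = (∫ x in Ω, bracket (f x) ^ 2) +
          ∫ x in Ω, bracket (f x) ^ (2 / N : ℝ) * (bracket (f x) ^ γ x - 1) :=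
        integral_add hX2 i3
    _ ≤ _ := by
        refine add_le_add le_rfl (hh.trans ?_)
        exact mul_le_mul_of_nonneg_left e2 (Real.rpow_nonneg hJ0 _)

end

/-! ### The interpolation inequality on a time slice -/

section

/-- A subcritical Young inequality, uniform in the exponents. -/
theorem exists_young_subcritical {θ η : ℝ} (hθ0 : 0 ≤ θ) (hθ1 : θ < 1) (hη : 0 < η) :
    ∃ C, 0 ≤ C ∧ ∀ X Y a b A B : ℝ, 1 ≤ X → 1 ≤ Y → 0 ≤ a → 0 ≤ b → 0 < A → 0 < B →
      a / A + b / B ≤ θ → X ^ a * Y ^ b ≤ η * (X ^ A + Y ^ B) + C := by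
  -- the threshold beyond which `Z ^ θ ≤ η Z`
  set R : ℝ := η ^ (-(1 / (1 - θ))) with hR
  have hR0 : 0 < R := Real.rpow_pos_of_pos hη _
  have h1θ : 0 < 1 - θ := by linarith
  refine ⟨R ^ θ, by positivity, fun X Y a b A B hX hY ha hb hA hB h => ?_⟩
  have hX0 : 0 < X := by linarith
  have hY0 : 0 < Y := by linarith
  have hXA : 1 ≤ X ^ A := Real.one_le_rpow hX hA.le
  have hYB : 1 ≤ Y ^ B := Real.one_le_rpow hY hB.le
  set Z := X ^ A + Y ^ B with hZ
  have hZ1 : 1 ≤ Z := by linarith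
  have hZ0 : 0 < Z := by linarith
  have e1 : X ^ a ≤ Z ^ (a / A) := by
    have : X ^ a = (X ^ A) ^ (a / A) := by
      rw [← Real.rpow_mul hX0.le, mul_div_cancel₀ _ hA.ne']
    rw [this]
    exact Real.rpow_le_rpow (by linarith) (by linarith) (by positivity)
  have e2 : Y ^ b ≤ Z ^ (b / B) := by
    have : Y ^ b = (Y ^ B) ^ (b / B) := by
      rw [← Real.rpow_mul hY0.le, mul_div_cancel₀ _ hB.ne']
    rw [this]
    exact Real.rpow_le_rpow (by linarith) (by linarith) (by positivity)
  have e3 : X ^ a * Y ^ b ≤ Z ^ θ := by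
    calc X ^ a * Y ^ b ≤ Z ^ (a / A) * Z ^ (b / B) := by gcongr
      _ = Z ^ (a / A + b / B) := (Real.rpow_add hZ0 _ _).symm
      _ ≤ Z ^ θ := Real.rpow_le_rpow_of_exponent_le hZ1 h
  refine e3.trans ?_
  rcases le_total Z R with hZR | hRZ
  · have : Z ^ θ ≤ R ^ θ := Real.rpow_le_rpow hZ0.le hZR hθ0
    have : 0 ≤ η * Z := by positivity
    linarith
  · have hle : Z ^ (θ - 1) ≤ η := by
      calc Z ^ (θ - 1) ≤ R ^ (θ - 1) :=
            Real.rpow_le_rpow_of_nonpos hR0 hRZ (by linarith)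
        _ = η := by
            rw [hR, ← Real.rpow_mul hη.le]
            have : -(1 / (1 - θ)) * (θ - 1) = 1 := by field_simp; ring
            rw [this, Real.rpow_one]
    have hZθ : Z ^ θ = Z ^ (θ - 1) * Z := by
      rw [← Real.rpow_add_one hZ0.ne']; congr 1; ring
    have : 0 ≤ R ^ θ := by positivity
    rw [hZθ]
    nlinarith

variable {N : ℕ} {Ω : Set (E N)}

theorem MemC1.integrableOn_bracket_rpow (hΩ : IsOpen Ω) (hb : Bornology.IsBounded Ω) {f : E N → ℝ}
    (hf : MemC1 Ω f) {k : E N → ℝ} (hk : Continuous k) :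
    IntegrableOn (fun x => bracket (f x) ^ k x) Ω := by
  have c0 : Continuous fun z : E N × ℝ × E N => (z.1, z.2.1) := by fun_prop
  simpa using hf.integrableOn_comp hΩ hb ((continuous_bracket_rpow (V := ℝ) hk 0).comp c0)

theorem MemC1.integrableOn_bracket_gradient_rpow (hΩ : IsOpen Ω) (hb : Bornology.IsBounded Ω)
    {f : E N → ℝ} (hf : MemC1 Ω f) {k : E N → ℝ} (hk : Continuous k) :
    IntegrableOn (fun x => bracket (gradient f x) ^ k x) Ω := by
  have c0 : Continuous fun z : E N × ℝ × E N => (z.1, z.2.2) := by fun_prop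
  simpa using hf.integrableOn_comp hΩ hb ((continuous_bracket_rpow (V := E N) hk 0).comp c0)

/-- The integrand `⟨∇f⟩^{s-2} |D²f|²`, restricted to the points where `|∇f| > 1`. -/
noncomputable def weightedHess (s : E N → ℝ) (f : E N → ℝ) (H : Fin N → Fin N → E N → ℝ) :
    E N → ℝ :=
  {x | 1 < ‖gradient f x‖}.indicator
    fun x => bracket (gradient f x) ^ (s x - 2) * hessNormSq H x

theorem weightedHess_nonneg (s f : E N → ℝ) (H : Fin N → Fin N → E N → ℝ) (x : E N) :
    0 ≤ weightedHess s f H x :=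
  indicator_nonneg (fun _ _ => mul_nonneg (Real.rpow_pos_of_pos (bracket_pos _) _).le
    (hessNormSq_nonneg _ _)) _

theorem integrableOn_weightedHess (hΩ : IsOpen Ω) (hb : Bornology.IsBounded Ω) {f : E N → ℝ}
    (hf : MemC1 Ω f) {H : Fin N → Fin N → E N → ℝ} (hH : IsWeakHessian Ω f H) {s : E N → ℝ}
    (hs : Continuous s) : IntegrableOn (weightedHess s f H) Ω := by
  have c0 : Continuous fun z : E N × ℝ × E N => (z.1, z.2.2) := by fun_prop
  have h := hf.integrableOn_comp_mul hΩ hb ((continuous_bracket_rpow (V := E N) hs (-2)).comp c0)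
    hH.integrable_hessNormSq
  exact Integrable.indicator₀ h (hf.nullMeasurableSet_gradient hΩ)

theorem integral_bracket_sq (hΩ : IsOpen Ω) (hb : Bornology.IsBounded Ω) {f : E N → ℝ}
    (hf : MemC1 Ω f) :
    ∫ x in Ω, bracket (f x) ^ 2 = volume.real Ω + ∫ x in Ω, f x ^ 2 := by
  have := isFiniteMeasure_restrict hb
  have c : Continuous fun z : E N × ℝ × E N => z.2.1 ^ 2 := by fun_prop
  simp only [bracket_sq, Real.norm_eq_abs, sq_abs]
  rw [integral_add (integrable_const _) (hf.integrableOn_comp hΩ hb c), integral_const,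
    measureReal_restrict_apply_univ, smul_eq_mul, mul_one]

/-- The bound of the lower-order power `⟨f⟩^κ`, `κ = lam * m`, by the integral of `⟨∇f⟩^m`, for
`lam` below the parabolic Gagliardo–Nirenberg exponent `(N + 2) / N`. -/
theorem exists_integral_bracket_rpow_le (hN : 2 ≤ N) (hΩ : IsOpen Ω) (hb : Bornology.IsBounded Ω)
    {lam m₁ : ℝ} (hlam : 0 < lam) (hlam' : lam < ((N : ℝ) + 2) / N) (hm₁ : 0 < m₁) (L M : ℝ) :
    ∃ C, 0 ≤ C ∧ ∀ {m : E N → ℝ}, ContDiff ℝ 1 m →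
    (∀ x ∈ Ω, 0 < m x ∧ m x ≤ m₁ ∧ 2 ≤ lam * m x) → (∀ x ∈ Ω, ‖fderiv ℝ m x‖ ≤ L) →
    ∀ {f : E N → ℝ}, MemX Ω f → ∫ x in Ω, f x ^ 2 ≤ M →
    ∫ x in Ω, bracket (f x) ^ (lam * m x) ≤
      (∫ x in Ω, bracket (gradient f x) ^ m x) + C := by
  have := isFiniteMeasure_restrict hb
  have hN0 : (0 : ℝ) < N := by exact_mod_cast (by omega : 0 < N)
  have hN2 : (2 : ℝ) ≤ N := by exact_mod_cast hN
  obtain ⟨G, hG0, hG⟩ := exists_gagliardo_nirenberg hN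
  set V := volume.real Ω with hV
  have hV0 : 0 ≤ V := measureReal_nonneg
  set J := V + |M| with hJ
  have hJ0 : 0 ≤ J := by positivity
  set Q := J ^ (1 / N : ℝ) * (G * (lam * |L| * N + lam * m₁)) with hQ
  have hQ0 : 0 ≤ Q := by positivity
  -- the largest sum of exponent ratios in the two applications of Young's inequality
  set θ := max 0 (max (1 - ((1 + 2 / N) / lam - 1) / m₁) (1 - 1 / (N * (lam * m₁)))) with hθ
  have hcrit : 0 < (1 + 2 / N) / lam - 1 := by
    rw [sub_pos, lt_div_iff₀ hlam, one_mul]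
    refine hlam'.trans_le (le_of_eq ?_)
    field_simp
  have hθ1 : θ < 1 := by
    refine max_lt one_pos (max_lt ?_ ?_)
    · have := div_pos hcrit hm₁; linarith
    · have : 0 < 1 / (N * (lam * m₁)) := by positivity
      linarith
  obtain ⟨C, hC0, hC⟩ := exists_young_subcritical (le_max_left _ _) hθ1
    (show 0 < 1 / (2 * (Q + 1)) by positivity)
  refine ⟨2 * (J + Q * (C * V)), by positivity, ?_⟩
  intro m hm hmb hL f hf hM
  have haeΩ : ∀ᵐ x ∂(volume.restrict Ω), x ∈ Ω := ae_restrict_mem hΩ.measurableSet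
  -- the Sobolev exponent, to which the `L²` bound adds the missing `2 / N`
  set γ : E N → ℝ := fun x => lam * m x - 2 / N with hγ
  have h2N : 2 / (N : ℝ) ≤ 1 := by rw [div_le_one hN0]; exact hN2
  have hγ1 : ∀ x ∈ Ω, 1 ≤ γ x := fun x hx => by
    have := (hmb x hx).2.2
    simp only [hγ]; linarith
  have hγs : ContDiff ℝ 1 γ := (contDiff_const.mul hm).sub contDiff_const
  have hγd : ∀ x ∈ Ω, ‖fderiv ℝ γ x‖ ≤ lam * |L| := fun x hx => by
    have hd : HasFDerivAt γ (lam • fderiv ℝ m x) x :=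
      (((hm.differentiable (by simp) x).hasFDerivAt).const_mul lam).sub_const _
    rw [hd.fderiv, norm_smul, Real.norm_of_nonneg hlam.le]
    exact mul_le_mul_of_nonneg_left ((hL x hx).trans (le_abs_self _)) hlam.le
  have hgn := hG hΩ hb hγs (fun x hx => zero_le_one.trans (hγ1 x hx)) hf
  have iX : IntegrableOn (fun x => bracket (f x) ^ (lam * m x)) Ω :=
    hf.memC1.integrableOn_bracket_rpow hΩ hb (continuous_const.mul hm.continuous)
  have iY : IntegrableOn (fun x => bracket (gradient f x) ^ m x) Ω :=
    hf.memC1.integrableOn_bracket_gradient_rpow hΩ hb hm.continuous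
  set IX := ∫ x in Ω, bracket (f x) ^ (lam * m x) with hIX
  set IY := ∫ x in Ω, bracket (gradient f x) ^ m x with hIY
  have hsq := integral_bracket_sq hΩ hb hf.memC1
  have hSJ : ∫ x in Ω, bracket (f x) ^ 2 ≤ J := by
    rw [hsq]; linarith [le_abs_self M]
  have hS0 : 0 ≤ ∫ x in Ω, bracket (f x) ^ 2 := integral_nonneg fun _ => sq_nonneg _
  have e1 : ∫ x in Ω, bracket (f x) ^ (γ x + 2 / N) = IX := by
    simp only [hγ, sub_add_cancel]; rfl
  rw [e1] at hgn
  set η := 1 / (2 * (Q + 1)) with hη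
  have hη0 : 0 < η := by positivity
  have hpt : ∀ x ∈ Ω, ‖fderiv ℝ γ x‖ * (bracket (f x) ^ γ x * Real.log (bracket (f x))) +
      γ x * bracket (f x) ^ (γ x - 1) * bracket (gradient f x) ≤
      (lam * |L| * N + lam * m₁) *
        (η * (bracket (f x) ^ (lam * m x) + bracket (gradient f x) ^ m x) + C) := by
    intro x hx
    obtain ⟨hm0, hmm₁, hm2⟩ := hmb x hx
    set X := bracket (f x)
    set Y := bracket (gradient f x)
    have hX1 : 1 ≤ X := one_le_bracket _
    have hY1 : 1 ≤ Y := one_le_bracket _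
    have hX0 : 0 < X := bracket_pos _
    have hκ0 : 0 < lam * m x := by positivity
    have y1 : X ^ (γ x + 1 / N) * Y ^ (0 : ℝ) ≤ η * (X ^ (lam * m x) + Y ^ m x) + C := by
      refine hC X Y _ _ _ _ hX1 hY1 ?_ le_rfl hκ0 hm0 ?_
      · have := hγ1 x hx
        positivity
      · refine le_trans (le_of_eq ?_) ((sub_le_sub_left
          (one_div_le_one_div_of_le (by positivity : 0 < N * (lam * m x))
          (by gcongr : N * (lam * m x) ≤ N * (lam * m₁))) 1).trans
          ((le_max_right _ _).trans (le_max_right _ _)))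
        simp only [hγ]
        field_simp
        ring
    have y2 : X ^ (γ x - 1) * Y ^ (1 : ℝ) ≤ η * (X ^ (lam * m x) + Y ^ m x) + C := by
      refine hC X Y _ _ _ _ hX1 hY1 (by linarith [hγ1 x hx]) zero_le_one hκ0 hm0 ?_
      refine le_trans (le_of_eq ?_) ((sub_le_sub_left
          (div_le_div_of_nonneg_left hcrit.le hm0 hmm₁) 1).trans
          ((le_max_left _ _).trans (le_max_right _ _)))
      simp only [hγ]
      field_simp
      ring
    have hlog : Real.log X ≤ N * X ^ (1 / N : ℝ) := by
      have := Real.log_le_rpow_div hX0.le (show 0 < 1 / (N : ℝ) by positivity)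
      rwa [div_div_eq_mul_div, div_one, mul_comm] at this
    have hP : 0 ≤ η * (X ^ (lam * m x) + Y ^ m x) + C := by
      have := bracket_pos (gradient f x)
      have h1 : 0 < X ^ (lam * m x) := Real.rpow_pos_of_pos hX0 _
      have h2 : 0 < Y ^ m x := Real.rpow_pos_of_pos this _
      positivity
    rw [Real.rpow_zero, mul_one] at y1
    rw [Real.rpow_one] at y2
    have hXγ : 0 < X ^ γ x := Real.rpow_pos_of_pos hX0 _
    have z1 : X ^ γ x * Real.log X ≤ N * (η * (X ^ (lam * m x) + Y ^ m x) + C) := by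
      calc X ^ γ x * Real.log X ≤ X ^ γ x * (N * X ^ (1 / N : ℝ)) := by gcongr
        _ = N * X ^ (γ x + 1 / N) := by rw [Real.rpow_add hX0]; ring
        _ ≤ _ := by gcongr
    have z2 : γ x ≤ lam * m₁ := by
      have : lam * m x ≤ lam * m₁ := by gcongr
      have : 0 ≤ 2 / (N : ℝ) := by positivity
      simp only [hγ]; linarith
    have z3 : 0 ≤ X ^ γ x * Real.log X := mul_nonneg hXγ.le (Real.log_nonneg hX1)
    have w1 : ‖fderiv ℝ γ x‖ * (X ^ γ x * Real.log X) ≤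
        lam * |L| * (N * (η * (X ^ (lam * m x) + Y ^ m x) + C)) :=
      mul_le_mul (hγd x hx) z1 z3 (by positivity)
    have w2 : γ x * (X ^ (γ x - 1) * Y) ≤ lam * m₁ * (η * (X ^ (lam * m x) + Y ^ m x) + C) :=
      mul_le_mul z2 y2 (mul_nonneg (Real.rpow_pos_of_pos hX0 _).le (bracket_pos _).le)
        (by positivity)
    linarith
  have hint : ∫ x in Ω, (‖fderiv ℝ γ x‖ * (bracket (f x) ^ γ x * Real.log (bracket (f x))) +
      γ x * bracket (f x) ^ (γ x - 1) * bracket (gradient f x)) ≤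
      (lam * |L| * N + lam * m₁) * (η * (IX + IY) + C * V) := by
    have i1 : Integrable (fun x => η * (bracket (f x) ^ (lam * m x) +
      bracket (gradient f x) ^ m x)) (volume.restrict Ω) := (iX.add iY).const_mul η
    have h : ∫ x in Ω, (lam * |L| * N + lam * m₁) *
        (η * (bracket (f x) ^ (lam * m x) + bracket (gradient f x) ^ m x) + C) =
        (lam * |L| * N + lam * m₁) * (η * (IX + IY) + C * V) := by
      rw [integral_const_mul, integral_add i1 (integrable_const _), integral_const_mul,
        integral_add iX iY, integral_const, measureReal_restrict_apply_univ, smul_eq_mul,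
        mul_comm C]
    rw [← h]
    refine integral_mono_of_nonneg (haeΩ.mono fun x hx => ?_)
      ((i1.add (integrable_const C)).const_mul _) (haeΩ.mono hpt)
    have := Real.log_nonneg (one_le_bracket (f x))
    have := hγ1 x hx
    have h2 : ∀ c : ℝ, 0 < bracket (f x) ^ c := fun c => Real.rpow_pos_of_pos (bracket_pos _) _
    have := h2 (γ x); have := h2 (γ x - 1); have := bracket_pos (gradient f x)
    simp only [Pi.zero_apply]
    positivity
  have hIX0 : 0 ≤ IX := integral_nonneg fun _ => (Real.rpow_pos_of_pos (bracket_pos _) _).le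
  have hIY0 : 0 ≤ IY := integral_nonneg fun _ => (Real.rpow_pos_of_pos (bracket_pos _) _).le
  have hA : IX ≤ J + Q * (η * (IX + IY) + C * V) := by
    refine hgn.trans (add_le_add hSJ ?_)
    calc _ ≤ J ^ (1 / N : ℝ) * (G * ((lam * |L| * N + lam * m₁) * (η * (IX + IY) + C * V))) := by
          refine mul_le_mul (Real.rpow_le_rpow hS0 hSJ (by positivity))
            (mul_le_mul_of_nonneg_left hint hG0) (mul_nonneg hG0 ?_) (by positivity)
          refine integral_nonneg_of_ae (haeΩ.mono fun x hx => ?_)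
          have := Real.log_nonneg (one_le_bracket (f x))
          have := hγ1 x hx
          have h2 : ∀ c : ℝ, 0 < bracket (f x) ^ c := fun c => Real.rpow_pos_of_pos (bracket_pos _) _
          have := h2 (γ x); have := h2 (γ x - 1); have := bracket_pos (gradient f x)
          simp only [Pi.zero_apply]
          positivity
      _ = _ := by rw [hQ]; ring
  have hQη : Q * η ≤ 1 / 2 := by
    rw [hη, mul_one_div, div_le_div_iff₀ (by positivity) two_pos]; linarith
  have : Q * η * (IX + IY) ≤ 1 / 2 * (IX + IY) := by gcongr
  linarith

/-- The weight `Y^{s+r-2}` of the second derivatives splits into the weight `Y^{s-2}` of their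
squares and a power that is subcritical. -/
theorem mul_rpow_mul_sqrt_le {F X Y h δ s r U : ℝ} (hF : |F| ≤ X) (hY : 0 < Y)
    (hh : 0 ≤ h) (hδ : 0 < δ) (hU : X ^ 2 * Y ^ (s + 2 * r - 2) ≤ U) :
    |F| * (Y ^ (s + r - 2) * √h) ≤ δ * (Y ^ (s - 2) * h) + 1 / (4 * δ) * U := by
  have hh0 : 0 ≤ √h := Real.sqrt_nonneg _
  have hhsq : h = √h ^ 2 := (Real.sq_sqrt hh).symm
  set A := Y ^ ((s - 2) / 2) with hA
  set B := Y ^ ((s + 2 * r - 2) / 2) with hB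
  have hA0 : 0 < A := Real.rpow_pos_of_pos hY _
  have hB0 : 0 < B := Real.rpow_pos_of_pos hY _
  have e1 : Y ^ (s + r - 2) = A * B := by
    rw [hA, hB, ← Real.rpow_add hY]; congr 1; ring
  have e2 : Y ^ (s - 2) = A ^ 2 := by
    rw [hA, sq, ← Real.rpow_add hY]; congr 1; ring
  have e3 : Y ^ (s + 2 * r - 2) = B ^ 2 := by
    rw [hB, sq, ← Real.rpow_add hY]; congr 1; ring
  rw [e3] at hU
  rw [e1, e2]
  have k1 : |F| * (A * B * √h) ≤ (A * √h) * (X * B) := by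
    calc |F| * (A * B * √h) ≤ X * (A * B * √h) := by gcongr
      _ = _ := by ring
  have k2 : (A * √h) * (X * B) ≤ δ * (A * √h) ^ 2 + 1 / (4 * δ) * (X * B) ^ 2 := by
    have h1 : 0 ≤ (2 * δ * (A * √h) - X * B) ^ 2 / (4 * δ) := by positivity
    have h2 : (2 * δ * (A * √h) - X * B) ^ 2 / (4 * δ) =
        δ * (A * √h) ^ 2 - (A * √h) * (X * B) + 1 / (4 * δ) * (X * B) ^ 2 := by
      field_simp; ring
    linarith only [h1, h2]
  have k3 : 1 / (4 * δ) * (X * B) ^ 2 ≤ 1 / (4 * δ) * U := by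
    rw [mul_pow]; gcongr
  have k4 : δ * (A * √h) ^ 2 = δ * (A ^ 2 * h) := by rw [mul_pow, ← hhsq]
  linarith only [k1, k2, k3, k4]

/-- The interpolation inequality on a time slice, with a smooth exponent `s` and `r` below the
critical value `4 / (N + 2)`. -/
theorem exists_slice_estimate (hN : 2 ≤ N) (hΩ : IsOpen Ω) (hb : Bornology.IsBounded Ω)
    {s₀ s₁ r β : ℝ} (hr0 : 0 < r) (hr : r < 4 / ((N : ℝ) + 2)) (hs₀ : 2 ≤ s₀ + 2 * r)
    (L M : ℝ) (hβ : 0 < β) :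
    ∃ C, 0 ≤ C ∧ ∀ {s : E N → ℝ}, ContDiff ℝ 1 s → (∀ x ∈ Ω, s x ∈ Icc s₀ s₁) →
    (∀ x ∈ Ω, ‖fderiv ℝ s x‖ ≤ L) → ∀ {f : E N → ℝ} {H : Fin N → Fin N → E N → ℝ},
    MemX Ω f → IsWeakHessian Ω f H → ∫ x in Ω, f x ^ 2 ≤ M →
    ∫ x in Ω, bracket (gradient f x) ^ (s x + r) ≤ β * (∫ x in Ω, weightedHess s f H x) + C := by
  have := isFiniteMeasure_restrict hb
  have hN0 : (0 : ℝ) < N := by exact_mod_cast (by omega : 0 < N)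
  have hN2 : (2 : ℝ) ≤ N := by exact_mod_cast hN
  have hr1 : r < 1 := hr.trans_le (by rw [div_le_one (by positivity)]; linarith)
  have hrN : r * (N + 2) < 4 := by rwa [lt_div_iff₀ (by positivity)] at hr
  -- the lower bound makes `X² Y^{m+r-2}` subcritical, the upper one the Sobolev step; the interval
  -- is nonempty because `r < 4 / (N + 2)`
  obtain ⟨lam, hlam1, hlam2⟩ : ∃ lam, 2 / (2 - r) < lam ∧ lam < ((N : ℝ) + 2) / N := by
    refine exists_between ?_
    rw [div_lt_div_iff₀ (by linarith) hN0]
    nlinarith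
  have hlam0 : 0 < lam := lt_trans (div_pos two_pos (by linarith)) hlam1
  have hlam2r : 2 < lam * (2 - r) := by rwa [div_lt_iff₀ (by linarith)] at hlam1
  have hlam_1 : 1 < lam := by nlinarith
  have h1lam : 1 / lam < 1 := by rw [div_lt_one hlam0]; exact hlam_1
  -- the power of `Y` that absorbs the logarithm coming from the variable exponent
  set ν := (1 - 1 / lam) / 2 with hν
  have hν0 : 0 < ν := by rw [hν]; linarith
  set m₁ := |s₁| + r + 1 with hm₁
  have hm₁0 : 0 < m₁ := by positivity
  obtain ⟨C₁, hC₁0, hC₁⟩ := exists_integral_bracket_rpow_le hN hΩ hb hlam0 hlam2 hm₁0 L M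
  obtain ⟨C₂, hC₂0, hC₂⟩ := exists_energy_estimate N (m₁ + 2) L
  set V := volume.real Ω with hV
  have hV0 : 0 ≤ V := measureReal_nonneg
  have hc1 : 0 < 2 - r - 2 / lam := by
    rw [sub_pos, div_lt_iff₀ hlam0]; linarith
  have hc2 : 0 < 1 - ν - 1 / lam := by rw [hν]; linarith
  -- the largest sum of exponent ratios in the two applications of Young's inequality
  set θ := max 0 (max (1 - (2 - r - 2 / lam) / m₁) (1 - (1 - ν - 1 / lam) / m₁)) with hθ
  have hθ1 : θ < 1 := by
    refine max_lt one_pos (max_lt ?_ ?_)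
    · have := div_pos hc1 hm₁0; linarith
    · have := div_pos hc2 hm₁0; linarith
  set δ := β / (2 * (C₂ + 1)) with hδ
  have hδ0 : 0 < δ := by positivity
  set P := C₂ * (1 / (4 * δ) + 1 / ν) with hP
  have hP0 : 0 ≤ P := by positivity
  set η := 1 / (4 * (P + 1)) with hη
  have hη0 : 0 < η := by positivity
  obtain ⟨C₃, hC₃0, hC₃⟩ := exists_young_subcritical (le_max_left _ _) hθ1 hη0
  refine ⟨2 * (C₂ * V + P * (C₃ * V)) + C₁, by positivity, ?_⟩
  intro s hs hsb hL f H hf hH hM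
  have haeΩ : ∀ᵐ x ∂(volume.restrict Ω), x ∈ Ω := ae_restrict_mem hΩ.measurableSet
  set m : E N → ℝ := fun x => s x + r with hm
  have hms : ContDiff ℝ 1 m := hs.add contDiff_const
  have hmd : ∀ x ∈ Ω, ‖fderiv ℝ m x‖ ≤ L := fun x hx => by
    have : fderiv ℝ m x = fderiv ℝ s x := fderiv_add_const r
    rw [this]; exact hL x hx
  have hmlow : ∀ x ∈ Ω, 2 - r ≤ m x := fun x hx => by
    have := (hsb x hx).1
    simp only [hm]; linarith
  have hmup : ∀ x ∈ Ω, m x ≤ m₁ := fun x hx => by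
    have := (hsb x hx).2
    simp only [hm, hm₁]; linarith [le_abs_self s₁]
  have hX := hC₁ hms (fun x hx => ⟨by linarith [hmlow x hx], hmup x hx,
    hlam2r.le.trans (mul_le_mul_of_nonneg_left (hmlow x hx) hlam0.le)⟩) hmd hf hM
  have hE := hC₂ hΩ hb hms (fun x hx => by
    rw [abs_le]
    constructor <;> linarith [hmlow x hx, hmup x hx]) hmd hf hH
  have iX : IntegrableOn (fun x => bracket (f x) ^ (lam * m x)) Ω :=
    hf.memC1.integrableOn_bracket_rpow hΩ hb (continuous_const.mul hms.continuous)
  have iY : IntegrableOn (fun x => bracket (gradient f x) ^ m x) Ω :=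
    hf.memC1.integrableOn_bracket_gradient_rpow hΩ hb hms.continuous
  have iD : IntegrableOn (weightedHess s f H) Ω :=
    integrableOn_weightedHess hΩ hb hf.memC1 hH hs.continuous
  set IX := ∫ x in Ω, bracket (f x) ^ (lam * m x) with hIX
  set IY := ∫ x in Ω, bracket (gradient f x) ^ m x with hIY
  set D := ∫ x in Ω, weightedHess s f H x with hD
  have hpt : ∀ x ∈ Ω, |f x| * ({x | 1 < ‖gradient f x‖}.indicator
      (fun x => bracket (gradient f x) ^ (m x - 2) * √(hessNormSq H x)) x +
        bracket (gradient f x) ^ (m x - 1) * Real.log (bracket (gradient f x))) ≤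
      δ * weightedHess s f H x + (1 / (4 * δ) + 1 / ν) *
        (η * (bracket (f x) ^ (lam * m x) + bracket (gradient f x) ^ m x) + C₃) := by
    intro x hx
    have hm0 : 0 < m x := by linarith [hmlow x hx]
    have hmm₁ := hmup x hx
    set X := bracket (f x)
    set Y := bracket (gradient f x)
    have hX1 : 1 ≤ X := one_le_bracket _
    have hY1 : 1 ≤ Y := one_le_bracket _
    have hX0 : 0 < X := bracket_pos _
    have hY0 : 0 < Y := bracket_pos _
    have hfX : |f x| ≤ X := norm_le_bracket (f x)
    have hκ0 : 0 < lam * m x := by positivity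
    have y1 : X ^ (2 : ℝ) * Y ^ (s x + 2 * r - 2) ≤ η * (X ^ (lam * m x) + Y ^ m x) + C₃ := by
      refine hC₃ X Y _ _ _ _ hX1 hY1 two_pos.le (by linarith [(hsb x hx).1]) hκ0 hm0 ?_
      refine le_trans (le_of_eq ?_) ((sub_le_sub_left
          (div_le_div_of_nonneg_left hc1.le hm0 hmm₁) 1).trans
          ((le_max_left _ _).trans (le_max_right _ _)))
      have hsm : s x + 2 * r - 2 = m x + r - 2 := by simp only [hm]; ring
      rw [hsm]
      field_simp
      ring
    have y2 : X ^ (1 : ℝ) * Y ^ (m x - 1 + ν) ≤ η * (X ^ (lam * m x) + Y ^ m x) + C₃ := by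
      refine hC₃ X Y _ _ _ _ hX1 hY1 zero_le_one (by linarith [hmlow x hx]) hκ0 hm0 ?_
      refine le_trans (le_of_eq ?_) ((sub_le_sub_left
          (div_le_div_of_nonneg_left hc2.le hm0 hmm₁) 1).trans
          ((le_max_right _ _).trans (le_max_right _ _)))
      field_simp
      ring
    set U := η * (X ^ (lam * m x) + Y ^ m x) + C₃ with hU
    rw [Real.rpow_two] at y1
    rw [Real.rpow_one] at y2
    have w2 : |f x| * (Y ^ (m x - 1) * Real.log Y) ≤ 1 / ν * U := by
      have hlog := Real.log_le_rpow_div hY0.le hν0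
      calc |f x| * (Y ^ (m x - 1) * Real.log Y) ≤ X * (Y ^ (m x - 1) * (Y ^ ν / ν)) := by
            have := Real.log_nonneg hY1
            gcongr
        _ = 1 / ν * (X * Y ^ (m x - 1 + ν)) := by rw [Real.rpow_add hY0]; ring
        _ ≤ _ := by gcongr
    have w1 : |f x| * {x | 1 < ‖gradient f x‖}.indicator
        (fun x => bracket (gradient f x) ^ (m x - 2) * √(hessNormSq H x)) x ≤
        δ * weightedHess s f H x + 1 / (4 * δ) * U := by
      have hU0 : 0 ≤ U := le_trans (by positivity) y1
      by_cases h1 : x ∈ {x | 1 < ‖gradient f x‖}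
      · rw [weightedHess, indicator_of_mem h1, indicator_of_mem h1]
        exact mul_rpow_mul_sqrt_le hfX hY0 (hessNormSq_nonneg H x) hδ0 y1
      · rw [indicator_of_notMem h1, mul_zero]
        have := weightedHess_nonneg s f H x
        positivity
    calc _ = _ := mul_add _ _ _
      _ ≤ (δ * weightedHess s f H x + 1 / (4 * δ) * U) + 1 / ν * U := add_le_add w1 w2
      _ = _ := by ring
  have hint : ∫ x in Ω, |f x| * ({x | 1 < ‖gradient f x‖}.indicator
      (fun x => bracket (gradient f x) ^ (m x - 2) * √(hessNormSq H x)) x +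
        bracket (gradient f x) ^ (m x - 1) * Real.log (bracket (gradient f x))) ≤
      δ * D + (1 / (4 * δ) + 1 / ν) * (η * (IX + IY) + C₃ * V) := by
    have i1 : Integrable (fun x => η * (bracket (f x) ^ (lam * m x) +
      bracket (gradient f x) ^ m x)) (volume.restrict Ω) := (iX.add iY).const_mul η
    have i2 : Integrable (fun x => (1 / (4 * δ) + 1 / ν) * (η * (bracket (f x) ^ (lam * m x) +
      bracket (gradient f x) ^ m x) + C₃)) (volume.restrict Ω) :=
      (i1.add (integrable_const C₃)).const_mul _
    have h : ∫ x in Ω, (δ * weightedHess s f H x + (1 / (4 * δ) + 1 / ν) *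
        (η * (bracket (f x) ^ (lam * m x) + bracket (gradient f x) ^ m x) + C₃)) =
        δ * D + (1 / (4 * δ) + 1 / ν) * (η * (IX + IY) + C₃ * V) := by
      rw [integral_add (iD.const_mul δ) i2, integral_const_mul, integral_const_mul,
        integral_add i1 (integrable_const _), integral_const_mul,
        integral_add iX iY, integral_const, measureReal_restrict_apply_univ, smul_eq_mul,
        mul_comm C₃]
    rw [← h]
    refine integral_mono_of_nonneg (ae_of_all _ fun x => ?_)
      ((iD.const_mul δ).add i2) (haeΩ.mono hpt)
    have h2 : ∀ c : ℝ, 0 ≤ bracket (gradient f x) ^ c := fun c =>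
      (Real.rpow_pos_of_pos (bracket_pos _) _).le
    exact mul_nonneg (abs_nonneg _) (add_nonneg
      (indicator_nonneg (fun y _ => mul_nonneg (Real.rpow_pos_of_pos (bracket_pos _) _).le
        (Real.sqrt_nonneg _)) _) (mul_nonneg (h2 _) (Real.log_nonneg (one_le_bracket _))))
  have hIX0 : 0 ≤ IX := integral_nonneg fun _ => (Real.rpow_pos_of_pos (bracket_pos _) _).le
  have hIY0 : 0 ≤ IY := integral_nonneg fun _ => (Real.rpow_pos_of_pos (bracket_pos _) _).le
  have hD0 : 0 ≤ D := integral_nonneg fun _ => weightedHess_nonneg _ _ _ _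
  have hA : IY ≤ C₂ * V + C₂ * δ * D + P * (η * (IX + IY) + C₃ * V) := by
    have := mul_le_mul_of_nonneg_left hint hC₂0
    calc IY ≤ C₂ * V + _ := hE
      _ ≤ C₂ * V + C₂ * (δ * D + (1 / (4 * δ) + 1 / ν) * (η * (IX + IY) + C₃ * V)) := by
        linarith
      _ = _ := by rw [hP]; ring
  have hPη : P * η ≤ 1 / 4 := by
    rw [hη, mul_one_div, div_le_div_iff₀ (by positivity) (by norm_num)]; linarith
  have h1 : P * η * (IX + IY) ≤ 1 / 4 * (IX + IY) := by gcongr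
  have h2 : C₂ * δ ≤ β / 2 := by
    rw [hδ, mul_div_assoc', div_le_div_iff₀ (by positivity) two_pos]
    nlinarith
  have h3 : C₂ * δ * D ≤ β / 2 * D := by gcongr
  linarith

end

/-! ### From smooth exponents to Lipschitz exponents, and from slices to the cylinder -/

section

variable {N : ℕ} {Ω : Set (E N)}

/-- A Lipschitz function is approximated from below by a `C¹` function with the same Lipschitz
constant. -/
theorem exists_contDiff_approx {K : NNReal} {g : E N → ℝ} (hg : LipschitzWith K g) {σ : ℝ}
    (hσ : 0 < σ) : ∃ s : E N → ℝ, ContDiff ℝ 1 s ∧ (∀ x, ‖fderiv ℝ s x‖ ≤ K) ∧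
      ∀ x, g x - σ ≤ s x ∧ s x ≤ g x := by
  obtain ⟨b, hbt⟩ := exists_bumps N
  obtain ⟨n, hn⟩ := ((tendsto_order.1 hbt).2 (σ / (2 * (K + 1))) (by positivity)).exists
  have hloc : LocallyIntegrable g := hg.continuous.locallyIntegrable
  have hlip : LipschitzWith K (mollify (b n) g) := by
    refine LipschitzWith.of_dist_le_mul fun x y => ?_
    have e : ∀ x, Integrable (fun t => (b n).normed volume t • g (x - t)) := fun x =>
      ((b n).hasCompactSupport_normed.convolutionExists_left (ContinuousLinearMap.lsmul ℝ ℝ)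
        (b n).continuous_normed hloc x).integrable
    rw [dist_eq_norm, mollify_apply, mollify_apply, ← integral_sub (e x) (e y)]
    have h := norm_integral_le_of_norm_le
      (f := fun t => (b n).normed volume t • g (x - t) - (b n).normed volume t • g (y - t))
      ((integrable_normed (b n)).mul_const (K * dist x y)) (ae_of_all _ fun t => by
        rw [← smul_sub, norm_smul, Real.norm_of_nonneg ((b n).nonneg_normed _), ← dist_eq_norm]
        refine mul_le_mul_of_nonneg_left ((hg.dist_le_mul _ _).trans (le_of_eq ?_))
          ((b n).nonneg_normed _)
        rw [dist_sub_right])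
    rwa [integral_mul_const, (b n).integral_normed, one_mul] at h
  have hclose : ∀ x, |mollify (b n) g x - g x| ≤ σ / 2 := fun x => by
    rw [← Real.dist_eq]
    refine ContDiffBump.dist_normed_convolution_le hg.continuous.aestronglyMeasurable
      fun y hy => (hg.dist_le_mul _ _).trans ?_
    have h1 : dist y x ≤ σ / (2 * (K + 1)) := (Metric.mem_ball.1 hy).le.trans hn.le
    calc (K : ℝ) * dist y x ≤ (K + 1) * (σ / (2 * (K + 1))) := by
          refine mul_le_mul (by linarith) h1 dist_nonneg (by positivity)
      _ = σ / 2 := by field_simp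
  refine ⟨fun x => mollify (b n) g x - σ / 2,
    ((contDiff_mollify _ hloc).of_le (by simp)).sub contDiff_const, fun x => ?_, fun x => ?_⟩
  · rw [fderiv_sub_const]
    exact norm_fderiv_le_of_lipschitz ℝ hlip
  · have := abs_le.1 (hclose x)
    constructor <;> linarith

/-- Lower bound of the regularized weight away from the degenerate set, uniform in `ε`. -/
theorem mul_bracket_rpow_le_flux {ε α K s p q a b : ℝ} {ξ : E N} (hξ : 1 < ‖ξ‖) (hε : ε < 1)
    (hε0 : 0 < ε) (hs : s ≤ min p q) (hK : |s - 2| ≤ K) (ha : 0 ≤ a) (hb : 0 ≤ b)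
    (hα : α ≤ a + b) :
    α * (2 ^ (-K) * bracket ξ ^ (s - 2)) ≤ a * (ε ^ 2 + ‖ξ‖ ^ 2) ^ ((p - 2) / 2) +
      b * (ε ^ 2 + ‖ξ‖ ^ 2) ^ ((q - 2) / 2) := by
  set w := ε ^ 2 + ‖ξ‖ ^ 2 with hw
  have hY0 := bracket_pos ξ
  have hsq := bracket_sq ξ
  have hw1 : 1 ≤ w := by nlinarith
  have hw0 : 0 < w := by linarith
  have hsq' : bracket ξ ^ (s - 2) = (bracket ξ ^ 2) ^ ((s - 2) / 2) := by
    rw [← Real.rpow_natCast_mul hY0.le]; congr 1; push_cast; ring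
  have h2K : (2 : ℝ) ^ (-K) ≤ 1 :=
    Real.rpow_le_one_of_one_le_of_nonpos one_le_two (by linarith [abs_nonneg (s - 2)])
  have key : 2 ^ (-K) * bracket ξ ^ (s - 2) ≤ w ^ ((s - 2) / 2) := by
    rw [hsq']
    rcases le_total 0 (s - 2) with h | h
    · have h1 : bracket ξ ^ 2 / 2 ≤ w := by nlinarith
      have h2 : (bracket ξ ^ 2 / 2) ^ ((s - 2) / 2) ≤ w ^ ((s - 2) / 2) :=
        Real.rpow_le_rpow (by positivity) h1 (by linarith)
      refine le_trans ?_ h2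
      have h3 : (bracket ξ ^ 2 / 2) ^ ((s - 2) / 2) =
          2 ^ (-((s - 2) / 2)) * (bracket ξ ^ 2) ^ ((s - 2) / 2) := by
        rw [Real.div_rpow (by positivity) two_pos.le, Real.rpow_neg two_pos.le, mul_comm,
          ← div_eq_mul_inv]
      rw [h3]
      refine mul_le_mul_of_nonneg_right ?_ (by positivity)
      refine Real.rpow_le_rpow_of_exponent_le one_le_two ?_
      linarith [(abs_le.1 hK).2]
    · have h1 : w ≤ bracket ξ ^ 2 := by nlinarith
      have h2 := Real.rpow_le_rpow_of_nonpos hw0 h1 (show (s - 2) / 2 ≤ 0 by linarith)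
      exact (mul_le_of_le_one_left (by positivity) h2K).trans h2
  have hp : w ^ ((s - 2) / 2) ≤ w ^ ((p - 2) / 2) :=
    Real.rpow_le_rpow_of_exponent_le hw1 (by linarith [hs.trans (min_le_left _ _)])
  have hq : w ^ ((s - 2) / 2) ≤ w ^ ((q - 2) / 2) :=
    Real.rpow_le_rpow_of_exponent_le hw1 (by linarith [hs.trans (min_le_right _ _)])
  have hk0 : 0 ≤ 2 ^ (-K) * bracket ξ ^ (s - 2) := by positivity
  calc α * (2 ^ (-K) * bracket ξ ^ (s - 2)) ≤ (a + b) * (2 ^ (-K) * bracket ξ ^ (s - 2)) :=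
        mul_le_mul_of_nonneg_right hα hk0
    _ = a * (2 ^ (-K) * bracket ξ ^ (s - 2)) + b * (2 ^ (-K) * bracket ξ ^ (s - 2)) := by ring
    _ ≤ _ := add_le_add (mul_le_mul_of_nonneg_left (key.trans hp) ha)
        (mul_le_mul_of_nonneg_left (key.trans hq) hb)

theorem rpow_mul_sq_le_bracket {ε e : ℝ} {ξ : E N} (hε : ε < 1) (hε0 : 0 < ε) (he : 0 ≤ e) :
    (ε ^ 2 + ‖ξ‖ ^ 2) ^ ((e - 2) / 2) * ‖ξ‖ ^ 2 ≤ bracket ξ ^ e := by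
  have hY0 := bracket_pos ξ
  have hw0 : 0 < ε ^ 2 + ‖ξ‖ ^ 2 := by positivity
  have hw : ε ^ 2 + ‖ξ‖ ^ 2 ≤ bracket ξ ^ 2 := by rw [bracket_sq]; nlinarith
  calc (ε ^ 2 + ‖ξ‖ ^ 2) ^ ((e - 2) / 2) * ‖ξ‖ ^ 2
      ≤ (ε ^ 2 + ‖ξ‖ ^ 2) ^ ((e - 2) / 2) * (ε ^ 2 + ‖ξ‖ ^ 2) := by
        gcongr; nlinarith
    _ = (ε ^ 2 + ‖ξ‖ ^ 2) ^ (e / 2) := by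
        rw [← Real.rpow_add_one hw0.ne']; congr 1; ring
    _ ≤ (bracket ξ ^ 2) ^ (e / 2) := Real.rpow_le_rpow hw0.le hw (by positivity)
    _ = bracket ξ ^ e := by
        rw [← Real.rpow_natCast_mul hY0.le]; congr 1; push_cast; ring

/-- The interpolation inequality on a time slice, for the regularized weight and Lipschitz
exponents. -/
theorem exists_slice_lintegral_estimate (hN : 2 ≤ N) (hΩ : IsOpen Ω) (hb : Bornology.IsBounded Ω)
    {pm qm α ς β : ℝ} (hpm : 2 * (N : ℝ) / ((N : ℝ) + 2) < pm)
    (hqm : 2 * (N : ℝ) / ((N : ℝ) + 2) < qm) (hα : 0 < α) (hς : 0 < ς) (hβ : 0 < β) (pp L M : ℝ) :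
    ∃ C, 0 ≤ C ∧ ∀ {p q a b : E N → ℝ},
    (∀ x ∈ closure Ω, pm ≤ p x ∧ p x ≤ pp ∧ qm ≤ q x) →
    (∀ x ∈ closure Ω, ∀ y ∈ closure Ω, |p x - p y| ≤ L * ‖x - y‖ ∧ |q x - q y| ≤ L * ‖x - y‖) →
    (∀ x ∈ closure Ω, 0 ≤ a x ∧ 0 ≤ b x ∧ α ≤ a x + b x) → ∀ {ε : ℝ}, 0 < ε → ε < 1 →
    ∀ {f : E N → ℝ} {H : Fin N → Fin N → E N → ℝ},
    MemX Ω f → IsWeakHessian Ω f H → ∫ x in Ω, f x ^ 2 ≤ M →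
    ∫⁻ x in Ω, ENNReal.ofReal (bracket (gradient f x) ^ (min (p x) (q x) + rSharp N - ς)) ≤
      ENNReal.ofReal β * (∫⁻ x in Ω, ENNReal.ofReal
        ((a x * (ε ^ 2 + ‖gradient f x‖ ^ 2) ^ ((p x - 2) / 2) +
          b x * (ε ^ 2 + ‖gradient f x‖ ^ 2) ^ ((q x - 2) / 2)) * hessNormSq H x)) +
        ENNReal.ofReal C := by
  have hN2 : (0 : ℝ) < (N : ℝ) + 2 := by positivity
  set c := 1 / ((N : ℝ) + 2) with hc
  have hc0 : 0 < c := by positivity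
  have h4 : rSharp N = 4 * c := by rw [rSharp, hc]; ring
  have h2N : 2 * (N : ℝ) / ((N : ℝ) + 2) = 2 - 4 * c := by rw [hc]; field_simp; ring
  -- a loss `σ ≤ ς` that is shared by the smoothing of the exponent and by the threshold; the bound
  -- `σ ≤ 2 / (N + 2)` gives `2 ≤ s₀ + 2 * r`
  set σ := min ς (2 * c) with hσ
  have hσ0 : 0 < σ := lt_min hς (by positivity)
  have hσς : σ ≤ ς := min_le_left _ _
  have hσc : σ ≤ 2 * c := min_le_right _ _
  set s₀ := min pm qm - σ / 2 with hs₀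
  set r := rSharp N - σ / 2 with hr
  have hmin : 2 - 4 * c < min pm qm := by rw [← h2N]; exact lt_min hpm hqm
  set K := |s₀| + |pp| + 2 with hK
  set β₁ := β * (α * 2 ^ (-K)) with hβ₁
  have h2K : (0 : ℝ) < 2 ^ (-K) := by positivity
  obtain ⟨C, hC0, hC⟩ := exists_slice_estimate (s₀ := s₀) (s₁ := pp) (r := r) hN hΩ hb
    (by rw [hr, h4]; linarith) (by rw [hr, rSharp]; linarith)
    (by rw [hs₀, hr, h4]; linarith) (|L|) M (show 0 < β₁ by positivity)
  refine ⟨C, hC0, ?_⟩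
  intro p q a b hpq hLip hab ε hε0 hε1 f H hf hH hM
  have := isFiniteMeasure_restrict hb
  have haeΩ : ∀ᵐ x ∂(volume.restrict Ω), x ∈ Ω := ae_restrict_mem hΩ.measurableSet
  have hlip : LipschitzOnWith (Real.toNNReal |L|) (fun x => min (p x) (q x)) (closure Ω) := by
    refine LipschitzOnWith.of_dist_le_mul fun x hx y hy => ?_
    rw [Real.dist_eq, dist_eq_norm, Real.coe_toNNReal _ (abs_nonneg _)]
    have hL : L * ‖x - y‖ ≤ |L| * ‖x - y‖ :=
      mul_le_mul_of_nonneg_right (le_abs_self L) (norm_nonneg _)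
    exact (abs_min_sub_min_le_max _ _ _ _).trans
      (max_le ((hLip x hx y hy).1.trans hL) ((hLip x hx y hy).2.trans hL))
  obtain ⟨g, hg, hgeq⟩ := hlip.extend_real
  obtain ⟨s, hs, hsd, hsg⟩ := exists_contDiff_approx hg (show 0 < σ / 2 by positivity)
  have hsΩ : ∀ x ∈ Ω, min (p x) (q x) - σ / 2 ≤ s x ∧ s x ≤ min (p x) (q x) := fun x hx => by
    have h := hsg x
    rwa [← hgeq (subset_closure hx)] at h
  have hsb : ∀ x ∈ Ω, s x ∈ Icc s₀ pp := fun x hx => by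
    obtain ⟨h1, h2, h3⟩ := hpq x (subset_closure hx)
    obtain ⟨h4, h5⟩ := hsΩ x hx
    have h6 : min pm qm ≤ min (p x) (q x) := min_le_min h1 h3
    exact ⟨by rw [hs₀]; linarith, h5.trans ((min_le_left _ _).trans h2)⟩
  have hest := hC hs hsb (fun x _ => by simpa using hsd x) hf hH hM
  have iY := hf.memC1.integrableOn_bracket_gradient_rpow hΩ hb (hs.continuous.add
    (continuous_const (y := r)))
  have iW := integrableOn_weightedHess hΩ hb hf.memC1 hH hs.continuous
  have hW : ENNReal.ofReal (α * 2 ^ (-K)) * (∫⁻ x in Ω, ENNReal.ofReal (weightedHess s f H x)) ≤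
      ∫⁻ x in Ω, ENNReal.ofReal
        ((a x * (ε ^ 2 + ‖gradient f x‖ ^ 2) ^ ((p x - 2) / 2) +
          b x * (ε ^ 2 + ‖gradient f x‖ ^ 2) ^ ((q x - 2) / 2)) * hessNormSq H x) := by
    rw [← lintegral_const_mul' _ _ ENNReal.ofReal_ne_top]
    refine lintegral_mono_ae (haeΩ.mono fun x hx => ?_)
    rw [← ENNReal.ofReal_mul (by positivity)]
    refine ENNReal.ofReal_le_ofReal ?_
    obtain ⟨ha, hb', hαab⟩ := hab x (subset_closure hx)
    by_cases h1 : x ∈ {x | 1 < ‖gradient f x‖}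
    · rw [weightedHess, indicator_of_mem h1, ← mul_assoc]
      refine mul_le_mul_of_nonneg_right ?_ (hessNormSq_nonneg _ _)
      rw [mul_assoc]
      refine mul_bracket_rpow_le_flux h1 hε1 hε0 (hsΩ x hx).2 ?_ ha hb' hαab
      have := hsb x hx
      rw [abs_le]
      constructor
      · linarith [this.1, neg_abs_le s₀, abs_nonneg pp]
      · linarith [this.2, le_abs_self pp, abs_nonneg s₀]
    · rw [weightedHess, indicator_of_notMem h1, mul_zero]
      have := hessNormSq_nonneg H x
      positivity
  calc ∫⁻ x in Ω, ENNReal.ofReal (bracket (gradient f x) ^ (min (p x) (q x) + rSharp N - ς))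
      ≤ ∫⁻ x in Ω, ENNReal.ofReal (bracket (gradient f x) ^ (s x + r)) := by
        refine lintegral_mono_ae (haeΩ.mono fun x hx => ENNReal.ofReal_le_ofReal
          (Real.rpow_le_rpow_of_exponent_le (one_le_bracket _) ?_))
        rw [hr]
        linarith [(hsΩ x hx).1]
    _ = ENNReal.ofReal (∫ x in Ω, bracket (gradient f x) ^ (s x + r)) :=
        (ofReal_integral_eq_lintegral_ofReal iY
          (ae_of_all _ fun x => (Real.rpow_pos_of_pos (bracket_pos _) _).le)).symm
    _ ≤ ENNReal.ofReal (β₁ * (∫ x in Ω, weightedHess s f H x) + C) :=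
        ENNReal.ofReal_le_ofReal hest
    _ = ENNReal.ofReal β * (ENNReal.ofReal (α * 2 ^ (-K)) *
          ∫⁻ x in Ω, ENNReal.ofReal (weightedHess s f H x)) + ENNReal.ofReal C := by
        have hW0 : 0 ≤ ∫ x in Ω, weightedHess s f H x :=
          integral_nonneg fun _ => weightedHess_nonneg _ _ _ _
        rw [ENNReal.ofReal_add (by positivity) hC0, hβ₁, ENNReal.ofReal_mul (by positivity),
          ENNReal.ofReal_mul hβ.le, mul_assoc, ofReal_integral_eq_lintegral_ofReal iW
          (ae_of_all _ fun x => weightedHess_nonneg _ _ _ _)]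
    _ ≤ _ := by gcongr

theorem LipschitzCyl.continuousOn {T L : ℝ} {f : E N → ℝ → ℝ} (hf : LipschitzCyl Ω T L f) :
    ContinuousOn (fun z : E N × ℝ => f z.1 z.2) (closure Ω ×ˢ Icc 0 T) := by
  intro z₀ hz₀
  rw [ContinuousWithinAt, tendsto_iff_norm_sub_tendsto_zero]
  have hc : Continuous fun z : E N × ℝ => L * √(‖z.1 - z₀.1‖ ^ 2 + (z.2 - z₀.2) ^ 2) := by
    fun_prop
  have h0 := (hc.tendsto z₀).mono_left (nhdsWithin_le_nhds (s := closure Ω ×ˢ Icc 0 T))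
  simp only [sub_self, norm_zero] at h0
  norm_num at h0
  refine squeeze_zero' (Eventually.of_forall fun _ => norm_nonneg _) ?_ h0
  filter_upwards [self_mem_nhdsWithin] with z hz
  exact hf z.1 hz.1 z₀.1 hz₀.1 z.2 hz.2 z₀.2 hz₀.2

theorem MemCX.continuousOn_gradient {T : ℝ} {u : ℝ → E N → ℝ}
    (hu : MemCX Ω T u) :
    ContinuousOn (fun z : E N × ℝ => gradient (u z.2) z.1) (Ω ×ˢ Icc 0 T) := by
  rintro ⟨x₀, t₀⟩ ⟨hx₀, ht₀⟩
  rw [ContinuousWithinAt, nhdsWithin_prod_eq, Metric.tendsto_nhds]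
  intro η hη
  have h1 := hu.continuous_C1 t₀ ht₀ (η / 2) (by positivity)
  have h2 := Metric.tendsto_nhds.1
    ((hu.mem t₀ ht₀).memC1.continuousOn_gradient x₀ hx₀) (η / 2) (by positivity)
  filter_upwards [(h2.and self_mem_nhdsWithin).prod_mk h1] with z hz
  obtain ⟨⟨hz2, hzΩ⟩, hz1⟩ := hz
  have h3 := (hz1 z.1 hzΩ).2
  rw [← dist_eq_norm] at h3
  calc dist (gradient (u z.2) z.1) (gradient (u t₀) x₀)
      ≤ dist (gradient (u z.2) z.1) (gradient (u t₀) z.1) +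
        dist (gradient (u t₀) z.1) (gradient (u t₀) x₀) := dist_triangle _ _ _
    _ < η := by linarith

theorem integrable_and_integral_le_of_lintegral_le {X : Type*} [MeasurableSpace X] {μ : Measure X}
    {F G : X → ℝ} {β C : ℝ} (hβ : 0 ≤ β) (hC : 0 ≤ C) (hF : AEStronglyMeasurable F μ)
    (hF0 : 0 ≤ᵐ[μ] F) (hG : Integrable G μ) (hG0 : 0 ≤ᵐ[μ] G)
    (h : ∫⁻ z, ENNReal.ofReal (F z) ∂μ ≤
      ENNReal.ofReal β * (∫⁻ z, ENNReal.ofReal (G z) ∂μ) + ENNReal.ofReal C) :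
    Integrable F μ ∧ ∫ z, F z ∂μ ≤ β * (∫ z, G z ∂μ) + C := by
  have hI : 0 ≤ ∫ z, G z ∂μ := integral_nonneg_of_ae hG0
  rw [← ofReal_integral_eq_lintegral_ofReal hG hG0, ← ENNReal.ofReal_mul hβ,
    ← ENNReal.ofReal_add (by positivity) hC] at h
  have hFi : Integrable F μ :=
    (lintegral_ofReal_ne_top_iff_integrable hF hF0).1 (ne_top_of_le_ne_top ENNReal.ofReal_ne_top h)
  refine ⟨hFi, ?_⟩
  rw [← ofReal_integral_eq_lintegral_ofReal hFi hF0] at h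
  exact (ENNReal.ofReal_le_ofReal_iff (by positivity)).1 h

end

end ParabolicInterp

theorem theorem4p1
    (N : ℕ) (hN : 2 ≤ N) (Ω : Set (E N)) (hΩ : IsC2Domain Ω) (T : ℝ) (hT : 0 < T)
    (pm pp qm qp Lpq Lab ap bp α M₀ ς β : ℝ)
    (hpm : 2 * (N : ℝ) / ((N : ℝ) + 2) < pm) (hqm : 2 * (N : ℝ) / ((N : ℝ) + 2) < qm)
    (hα : 0 < α) (hς : ς ∈ Ioo 0 (rSharp N)) (hβ : β ∈ Ioo (0 : ℝ) 1) :
    -- the constant depends only on the quantities listed above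
    ∃ C : ℝ, ∀ p q a b : E N → ℝ → ℝ,
      (∀ x ∈ closure Ω, ∀ t ∈ Icc 0 T, p x t ∈ Icc pm pp ∧ q x t ∈ Icc qm qp) →
      LipschitzCyl Ω T Lpq p → LipschitzCyl Ω T Lpq q →
      (∀ x ∈ closure Ω, ∀ t ∈ Icc 0 T, |p x t - q x t| < 2 / ((N : ℝ) + 2)) →
      (∀ x ∈ closure Ω, ∀ t ∈ Icc 0 T, a x t ∈ Icc 0 ap ∧ b x t ∈ Icc 0 bp) →
      LipschitzCyl Ω T Lab a → LipschitzCyl Ω T Lab b →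
      (∀ x ∈ closure Ω, ∀ t ∈ Icc 0 T, α ≤ a x t + b x t) →
      ∀ ε ∈ Ioo (0 : ℝ) 1,
      ∀ (u : ℝ → E N → ℝ) (W : Fin N → Fin N → E N → ℝ → ℝ),
        MemCX Ω T u → IsSpatialHessian Ω T u W →
        IntegrableOn (fun z : E N × ℝ =>
          flux ε a b p q 0 0 z.1 z.2 (gradient (u z.2) z.1) * hessSq W z.1 z.2) (cyl Ω T) →
        IsLUB ((fun t => ∫ x in Ω, u t x ^ 2) '' Ioo 0 T) M₀ →
        (IntegrableOn (fun z : E N × ℝ =>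
            flux ε a b p q (fun x t => rExp p q x t - ς) (fun x t => rExp q p x t - ς) z.1 z.2
              (gradient (u z.2) z.1) * ‖gradient (u z.2) z.1‖ ^ 2) (cyl Ω T) ∧
          ∫ z in cyl Ω T,
            flux ε a b p q (fun x t => rExp p q x t - ς) (fun x t => rExp q p x t - ς) z.1 z.2
              (gradient (u z.2) z.1) * ‖gradient (u z.2) z.1‖ ^ 2
            ≤ β * (∫ z in cyl Ω T,
              flux ε a b p q 0 0 z.1 z.2 (gradient (u z.2) z.1) * hessSq W z.1 z.2) + C) ∧
        (IntegrableOn (fun z : E N × ℝ =>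
            ‖gradient (u z.2) z.1‖ ^ (sMin p q z.1 z.2 + rSharp N - ς)) (cyl Ω T) ∧
          α * (∫ z in cyl Ω T,
            ‖gradient (u z.2) z.1‖ ^ (sMin p q z.1 z.2 + rSharp N - ς))
            ≤ β * (∫ z in cyl Ω T,
              flux ε a b p q 0 0 z.1 z.2 (gradient (u z.2) z.1) * hessSq W z.1 z.2) + C) := by
  have hO := hΩ.isOpen
  have hb := hΩ.isBounded
  set A : ℝ := |ap| + |bp| + 1 with hA
  have hA0 : 0 < A := by positivity
  obtain ⟨C, hC0, hC⟩ := exists_slice_lintegral_estimate hN hO hb hpm hqm hα hς.1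
    (show 0 < β / A from div_pos hβ.1 hA0) pp Lpq M₀
  refine ⟨A * C * T, ?_⟩
  intro p q a b hpq hLp hLq _ hab hLa hLb hαab ε hε u W hu hW hint hlub
  obtain ⟨x₀, hx₀⟩ := hΩ.isConnected.nonempty
  set μ : Measure (E N × ℝ) := volume.restrict (cyl Ω T) with hμ
  have hcyl : MeasurableSet (cyl Ω T) := hO.measurableSet.prod measurableSet_Ioc
  have hmemc : ∀ z ∈ cyl Ω T, z.1 ∈ closure Ω ∧ z.2 ∈ Icc 0 T := fun z hz =>
    ⟨subset_closure hz.1, Ioc_subset_Icc_self hz.2⟩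
  have haecyl : ∀ᵐ z ∂μ, z ∈ cyl Ω T := ae_restrict_mem hcyl
  have hμprod : μ = (volume.restrict Ω).prod (volume.restrict (Ioc 0 T)) := by
    rw [hμ, cyl, Measure.volume_eq_prod, Measure.prod_restrict]
  have hsubc : cyl Ω T ⊆ closure Ω ×ˢ Icc 0 T := prod_mono subset_closure Ioc_subset_Icc_self
  -- the exponent of the target integrands
  set k : E N × ℝ → ℝ := fun z => sMin p q z.1 z.2 + rSharp N - ς with hk
  have hkpos : ∀ z ∈ cyl Ω T, 0 < k z := fun z hz => by
    obtain ⟨h1, h2⟩ := hpq z.1 (hmemc z hz).1 z.2 (hmemc z hz).2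
    have h3 : 0 ≤ 2 * (N : ℝ) / ((N : ℝ) + 2) := by positivity
    have h4 : 0 < sMin p q z.1 z.2 := lt_min (by linarith [h1.1]) (by linarith [h2.1])
    have h5 := hς.2
    simp only [hk]; linarith
  have hG : ContinuousOn (fun z : E N × ℝ => gradient (u z.2) z.1) (cyl Ω T) :=
    hu.continuousOn_gradient.mono (prod_mono subset_rfl Ioc_subset_Icc_self)
  have cp := hLp.continuousOn.mono hsubc
  have cq := hLq.continuousOn.mono hsubc
  have ca := hLa.continuousOn.mono hsubc
  have cb := hLb.continuousOn.mono hsubc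
  have ck : ContinuousOn k (cyl Ω T) :=
    ((continuous_min.comp_continuousOn (cp.prodMk cq)).add continuousOn_const).sub continuousOn_const
  have hw0 : ∀ z : E N × ℝ, 0 < ε ^ 2 + ‖gradient (u z.2) z.1‖ ^ 2 := fun z => by
    have := hε.1
    positivity
  have cw : ContinuousOn (fun z : E N × ℝ => ε ^ 2 + ‖gradient (u z.2) z.1‖ ^ 2) (cyl Ω T) :=
    continuousOn_const.add (hG.norm.pow 2)
  set G : E N × ℝ → ℝ := fun z =>
    flux ε a b p q 0 0 z.1 z.2 (gradient (u z.2) z.1) * hessSq W z.1 z.2 with hGdef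
  have hG0 : 0 ≤ᵐ[μ] G := haecyl.mono fun z hz => by
    obtain ⟨h1, h2⟩ := hab z.1 (hmemc z hz).1 z.2 (hmemc z hz).2
    have h3 : 0 ≤ hessSq W z.1 z.2 :=
      Finset.sum_nonneg fun _ _ => Finset.sum_nonneg fun _ _ => sq_nonneg _
    have h4 := fun e => (Real.rpow_pos_of_pos (hw0 z) e).le
    exact mul_nonneg (add_nonneg (mul_nonneg h1.1 (h4 _)) (mul_nonneg h2.1 (h4 _))) h3
  -- the estimate on almost every time slice
  have hslice : ∀ᵐ t ∂(volume.restrict (Ioc 0 T)),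
      ∫⁻ x in Ω, ENNReal.ofReal (bracket (gradient (u t) x) ^ k (x, t)) ≤
        ENNReal.ofReal (β / A) * (∫⁻ x in Ω, ENNReal.ofReal (G (x, t))) + ENNReal.ofReal C := by
    -- the bound `M₀` is available for `t < T` only
    have hne : ∀ᵐ t ∂(volume.restrict (Ioc 0 T)), t ≠ T :=
      ae_restrict_of_ae (by simp [ae_iff, measure_singleton])
    filter_upwards [hW.hessian, ae_restrict_mem measurableSet_Ioc, hne] with t hH ht htT
    have htc : t ∈ Icc 0 T := Ioc_subset_Icc_self ht
    have hLip : ∀ {f : E N → ℝ → ℝ}, LipschitzCyl Ω T Lpq f → ∀ x ∈ closure Ω,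
        ∀ y ∈ closure Ω, |f x t - f y t| ≤ Lpq * ‖x - y‖ := fun hf x hx y hy => by
      simpa [Real.sqrt_sq (norm_nonneg _)] using hf x hx y hy t htc t htc
    have h := hC (p := fun x => p x t) (q := fun x => q x t) (a := fun x => a x t)
      (b := fun x => b x t)
      (fun x hx => ⟨(hpq x hx t htc).1.1, (hpq x hx t htc).1.2, (hpq x hx t htc).2.1⟩)
      (fun x hx y hy => ⟨hLip hLp x hx y hy, hLip hLq x hx y hy⟩)
      (fun x hx => ⟨(hab x hx t htc).1.1, (hab x hx t htc).2.1, hαab x hx t htc⟩)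
      hε.1 hε.2 (hu.mem t htc) hH (hlub.1 ⟨t, ⟨ht.1, lt_of_le_of_ne ht.2 htT⟩, rfl⟩)
    simp only [hGdef, flux, Pi.zero_apply, add_zero]
    exact h
  -- integration over time
  have hGm : AEMeasurable (fun z => ENNReal.ofReal (G z))
      ((volume.restrict Ω).prod (volume.restrict (Ioc 0 T))) := by
    rw [← hμprod]; exact hint.1.aemeasurable.ennreal_ofReal
  have cY : ContinuousOn (fun z : E N × ℝ => bracket (gradient (u z.2) z.1) ^ k z) (cyl Ω T) :=
    (continuous_bracket.comp_continuousOn hG).rpow ck fun z _ => Or.inl (bracket_pos _).ne'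
  have hYm : AEMeasurable (fun z : E N × ℝ =>
      ENNReal.ofReal (bracket (gradient (u z.2) z.1) ^ k z))
      ((volume.restrict Ω).prod (volume.restrict (Ioc 0 T))) := by
    rw [← hμprod]; exact (cY.aestronglyMeasurable hcyl).aemeasurable.ennreal_ofReal
  have hcylY : ∫⁻ z, ENNReal.ofReal (bracket (gradient (u z.2) z.1) ^ k z) ∂μ ≤
      ENNReal.ofReal (β / A) * (∫⁻ z, ENNReal.ofReal (G z) ∂μ) + ENNReal.ofReal (C * T) := by
    rw [hμprod, lintegral_prod_symm _ hYm, lintegral_prod_symm _ hGm]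
    refine (lintegral_mono_ae hslice).trans (le_of_eq ?_)
    rw [lintegral_add_right _ measurable_const, lintegral_const_mul' _ _ ENNReal.ofReal_ne_top,
      lintegral_const, Measure.restrict_apply_univ, Real.volume_Ioc, sub_zero,
      ← ENNReal.ofReal_mul hC0]
  have hfin : ∀ F : E N × ℝ → ℝ, ContinuousOn F (cyl Ω T) → (∀ z ∈ cyl Ω T, 0 ≤ F z) →
      (∀ z ∈ cyl Ω T, F z ≤ A * bracket (gradient (u z.2) z.1) ^ k z) →
      Integrable F μ ∧ ∫ z, F z ∂μ ≤ β * (∫ z, G z ∂μ) + A * C * T := by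
    intro F hF hF0 hFA
    refine integrable_and_integral_le_of_lintegral_le hβ.1.le (by positivity)
      (hF.aestronglyMeasurable hcyl) (haecyl.mono hF0) hint hG0 ?_
    calc ∫⁻ z, ENNReal.ofReal (F z) ∂μ
        ≤ ∫⁻ z, ENNReal.ofReal A * ENNReal.ofReal (bracket (gradient (u z.2) z.1) ^ k z) ∂μ := by
          refine lintegral_mono_ae (haecyl.mono fun z hz => ?_)
          rw [← ENNReal.ofReal_mul hA0.le]
          exact ENNReal.ofReal_le_ofReal (hFA z hz)
      _ ≤ ENNReal.ofReal A * (ENNReal.ofReal (β / A) * (∫⁻ z, ENNReal.ofReal (G z) ∂μ) +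
            ENNReal.ofReal (C * T)) := by
          rw [lintegral_const_mul' _ _ ENNReal.ofReal_ne_top]
          gcongr
      _ = _ := by
          rw [mul_add, ← mul_assoc, ← ENNReal.ofReal_mul hA0.le, ← ENNReal.ofReal_mul hA0.le,
            mul_div_cancel₀ _ hA0.ne', mul_assoc]
  have habA : ∀ z ∈ cyl Ω T, a z.1 z.2 + b z.1 z.2 ≤ A := fun z hz => by
    obtain ⟨h1, h2⟩ := hab z.1 (hmemc z hz).1 z.2 (hmemc z hz).2
    rw [hA]; linarith [h1.2, h2.2, le_abs_self ap, le_abs_self bp]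
  have hαA : α ≤ A := by
    have hT0 : T ∈ Icc 0 T := ⟨hT.le, le_rfl⟩
    exact (hαab x₀ (subset_closure hx₀) T hT0).trans (habA (x₀, T) ⟨hx₀, hT, le_rfl⟩)
  constructor
  · -- both summands of the flux have the same exponent
    have hflux : ∀ z : E N × ℝ, flux ε a b p q (fun x t => rExp p q x t - ς)
        (fun x t => rExp q p x t - ς) z.1 z.2 (gradient (u z.2) z.1) *
          ‖gradient (u z.2) z.1‖ ^ 2 = (a z.1 z.2 + b z.1 z.2) *
        ((ε ^ 2 + ‖gradient (u z.2) z.1‖ ^ 2) ^ ((k z - 2) / 2) *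
          ‖gradient (u z.2) z.1‖ ^ 2) := fun z => by
      have e1 : p z.1 z.2 + (rExp p q z.1 z.2 - ς) - 2 = k z - 2 := by
        simp only [rExp, hk]; ring
      have e2 : q z.1 z.2 + (rExp q p z.1 z.2 - ς) - 2 = k z - 2 := by
        simp only [rExp, hk, sMin, min_comm (q z.1 z.2)]; ring
      simp only [flux, e1, e2]
      ring
    simp only [hflux]
    refine hfin _ ?_ (fun z hz => ?_) (fun z hz => ?_)
    · refine (ca.add cb).mul (ContinuousOn.mul (cw.rpow ?_ fun z _ => Or.inl (hw0 z).ne')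
        (hG.norm.pow 2))
      exact (ck.sub continuousOn_const).div_const 2
    · obtain ⟨h1, h2⟩ := hab z.1 (hmemc z hz).1 z.2 (hmemc z hz).2
      have := (Real.rpow_pos_of_pos (hw0 z) ((k z - 2) / 2)).le
      exact mul_nonneg (add_nonneg h1.1 h2.1) (mul_nonneg this (sq_nonneg _))
    · have := (Real.rpow_pos_of_pos (hw0 z) ((k z - 2) / 2)).le
      exact mul_le_mul (habA z hz) (rpow_mul_sq_le_bracket hε.2 hε.1 (hkpos z hz).le)
        (mul_nonneg this (sq_nonneg _)) hA0.le
  · have cn : ContinuousOn (fun z : E N × ℝ => ‖gradient (u z.2) z.1‖ ^ k z) (cyl Ω T) :=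
      hG.norm.rpow ck fun z hz => Or.inr (hkpos z hz)
    have hle : ∀ z ∈ cyl Ω T, α * ‖gradient (u z.2) z.1‖ ^ k z ≤
        A * bracket (gradient (u z.2) z.1) ^ k z := fun z hz =>
      mul_le_mul hαA (Real.rpow_le_rpow (norm_nonneg _) (norm_le_bracket _) (hkpos z hz).le)
        (Real.rpow_nonneg (norm_nonneg _) _) hA0.le
    obtain ⟨h1, h2⟩ := hfin (fun z => α * ‖gradient (u z.2) z.1‖ ^ k z)
      (continuousOn_const.mul cn)
      (fun z _ => mul_nonneg hα.le (Real.rpow_nonneg (norm_nonneg _) _)) hle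
    rw [integral_const_mul] at h2
    refine ⟨?_, h2⟩
    have h3 := h1.const_mul α⁻¹
    simp only [inv_mul_cancel_left₀ hα.ne'] at h3
    exact h3
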